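/- Let $T>0$, $\Omega=\{x+i\tau\in\mathbb C: -T<\tau<T\}$ with closure $\overline\Omega$, $K\in\mathbb N$, and $D=d/dz$. For $f:\Omega\to\mathbb C^K$ analytic and $2\pi$-periodic let $c_n(f)=\frac1{2\pi}\int_0^{2\pi}f(x)e^{-inx}\,dx$. The Hardy space $\oplus_K\mathbb H^2$ is the space of all such $f$ with $\|f\|_H^2=\sum_{n\in\mathbb Z}\|c_n(f)\|^2\cosh(2nT)<\infty$, a Hilbert space with inner product $$\langle f,g\rangle_H=\sum_{n\in\mathbb Z}\cosh(2nT)\,c_n(g)^*c_n(f)=\frac1{4\pi}\int_0^{2\pi}\big[g(x+iT)^*f(x+iT)+g(x-iT)^*f(x-iT)\big]\,dx .$$ Let $P_2,P_1,P_0$ be $2\pi$-periodic $K\times K$ matrix valued functions on $\overline\Omega$, analytic in $\Omega$, such that the operator $$\mathcal L=-DP_2(z)D+P_1(z)D+P_0(z)$$ is regular: $P_j$ has $j$ continuous derivatives on $\overline\Omega$ ($j=0,1,2$), and $\det P_2(z)\ne0$ for all $z\in\overline\Omega$. Suppose that for some $C_0>0$ $$\operatorname{Re}(V^*P_2(z)V)\ge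 C_0\|V\|^2\qquad\text{for all }V\in\mathbb C^K,\ z\in\overline\Omega .$$ Consider $\mathcal L$ as an operator in $\oplus_K\mathbb H^2$ with domain $\mathcal D=\{f\in\oplus_K\mathbb H^2:\mathcal Lf\in\oplus_K\mathbb H^2\}$. Then: 1. $\mathcal D=\{f\in\oplus_K\mathbb H^2: f''\in\oplus_K\mathbb H^2\}$, the domain of $I_KD^2$. 2. There is $\mu_0>0$ such that for every real $\mu\ge\mu_0$ the operator $\mathcal L+\mu$ is m-sectorial with vertex $0$. That is, for every $\lambda\in\mathbb C$ with $\operatorname{Re}\lambda>0$ the operator $\mathcal L+\mu+\lambda$ has a bounded, everywhere defined inverse of norm at most $1/\operatorname{Re}\lambda$, and there is $\gamma>0$ with $$|\operatorname{Im}\langle(\mathcal L+\mu)f,f\rangle_H|\le\gamma\operatorname{Re}\langle(\mathcal L+\mu)f,f\rangle_H\qquad\text{for all }f\in\mathcal D .$$ 3. $\mathcal L$ generates a holomorphic semigroup $S(t)=e^{-t\mathcal L}$ on $\oplus_K\mathbb H^2$. That is, there is a strongly continuous semigroup $(S(t))_{t\ge0}$ of bounded operators whose infinitesimal generator is $-\mathcal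 L$ and which, for some $0<\delta<\pi/2$, extends to a (norm-)holomorphic bounded operator valued function $S(\zeta)$ on the sector $\{\zeta\ne0:|\arg\zeta|<\delta\}$, with $S(\zeta+\xi)=S(\zeta)S(\xi)$ for $\zeta,\xi$ in the sector, and $S(\zeta)f\to f$ for every $f$ as $\zeta\to0$ in the sector. -/

import Mathlib

open scoped ComplexConjugate

namespace PeriodicHardy

noncomputable section

/-- The open strip `Ω = {x + iτ : -T < τ < T}`. -/
def strip (T : ℝ) : Set ℂ := {z | -T < z.im ∧ z.im < T}

/-- The closed strip `{x + iτ : -T ≤ τ ≤ T}`. -/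
def closedStrip (T : ℝ) : Set ℂ := {z | -T ≤ z.im ∧ z.im ≤ T}

/-- The Fourier coefficient `c_n = (1/2π) ∫_0^{2π} f(x) e^{-inx} dx` of a vector valued function,
computed on the real axis. -/
def coeff {K : ℕ} (f : ℂ → EuclideanSpace ℂ (Fin K)) (n : ℤ) : EuclideanSpace ℂ (Fin K) :=
  ((1 / (2 * Real.pi) : ℝ) : ℂ) •
    ∫ x in (0 : ℝ)..(2 * Real.pi), Complex.exp (-(Complex.I * n * x)) • f x

/-- Membership in `⊕_K H²`: `f` is analytic in the strip, `2π`-periodic, and its Fourier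
coefficients satisfy `∑ |c_n|² cosh (2nT) < ∞`. Functions on the strip are represented by functions
on `ℂ` that vanish off the strip. -/
structure IsHardy (T : ℝ) {K : ℕ} (f : ℂ → EuclideanSpace ℂ (Fin K)) : Prop where
  analytic : DifferentiableOn ℂ f (strip T)
  periodic : ∀ z, f (z + 2 * Real.pi) = f z
  summable : Summable fun n : ℤ => ‖coeff f n‖ ^ 2 * Real.cosh (2 * n * T)
  eq_zero_off : ∀ z, z ∉ strip T → f z = 0

theorem isOpen_strip (T : ℝ) : IsOpen (strip T) :=
  (isOpen_lt continuous_const Complex.continuous_im).inter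
    (isOpen_lt Complex.continuous_im continuous_const)

theorem IsHardy.continuous_real {T : ℝ} {K : ℕ} {f : ℂ → EuclideanSpace ℂ (Fin K)}
    (hf : IsHardy T f) : Continuous fun x : ℝ => f x := by
  by_cases hT : 0 < T
  · refine hf.analytic.continuousOn.comp_continuous Complex.continuous_ofReal fun x => ?_
    simp [strip, hT]
  · have : (fun x : ℝ => f x) = fun _ => 0 := by
      funext x
      exact hf.eq_zero_off _ (by simp [strip, hT])
    rw [this]
    exact continuous_const

theorem IsHardy.intervalIntegrable {T : ℝ} {K : ℕ} {f : ℂ → EuclideanSpace ℂ (Fin K)}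
    (hf : IsHardy T f) (n : ℤ) :
    IntervalIntegrable (fun x : ℝ => Complex.exp (-(Complex.I * n * x)) • f x)
      MeasureTheory.volume 0 (2 * Real.pi) := by
  have h := hf.continuous_real
  have he : Continuous fun x : ℝ => Complex.exp (-(Complex.I * n * x)) := by fun_prop
  exact (he.smul h).intervalIntegrable _ _

theorem coeff_add {T : ℝ} {K : ℕ} {f g : ℂ → EuclideanSpace ℂ (Fin K)}
    (hf : IsHardy T f) (hg : IsHardy T g) (n : ℤ) : coeff (f + g) n = coeff f n + coeff g n := by
  simp only [coeff, Pi.add_apply, smul_add]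
  rw [intervalIntegral.integral_add (hf.intervalIntegrable n) (hg.intervalIntegrable n), smul_add]

theorem coeff_smul {K : ℕ} (c : ℂ) (f : ℂ → EuclideanSpace ℂ (Fin K)) (n : ℤ) :
    coeff (c • f) n = c • coeff f n := by
  simp only [coeff, Pi.smul_apply]
  have h : (∫ x in (0 : ℝ)..(2 * Real.pi), Complex.exp (-(Complex.I * n * x)) • c • f x) =
      c • ∫ x in (0 : ℝ)..(2 * Real.pi), Complex.exp (-(Complex.I * n * x)) • f x := by
    rw [← intervalIntegral.integral_smul]
    exact intervalIntegral.integral_congr fun x _ => smul_comm _ _ _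
  rw [h, smul_comm]

/-- `⊕_K H²` as a space of functions. -/
def hardySubmodule (T : ℝ) (K : ℕ) : Submodule ℂ (ℂ → EuclideanSpace ℂ (Fin K)) where
  carrier := {f | IsHardy T f}
  zero_mem' := by
    refine ⟨differentiableOn_const 0, fun _ => rfl, ?_, fun _ _ => rfl⟩
    simp [coeff]
  add_mem' := by
    intro f g hf hg
    refine ⟨hf.analytic.add hg.analytic, fun z => ?_, ?_, fun z hz => ?_⟩
    · simp [hf.periodic, hg.periodic]
    · refine Summable.of_nonneg_of_le (fun n => by positivity) (fun n => ?_)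
        ((hf.summable.add hg.summable).mul_left 2)
      rw [coeff_add hf hg]
      have h1 := norm_add_le (coeff f n) (coeff g n)
      have h2 : ‖coeff f n + coeff g n‖ ^ 2 ≤ 2 * (‖coeff f n‖ ^ 2 + ‖coeff g n‖ ^ 2) := by
        nlinarith [norm_nonneg (coeff f n + coeff g n), sq_nonneg (‖coeff f n‖ - ‖coeff g n‖)]
      have h3 := mul_le_mul_of_nonneg_right h2 (Real.cosh_pos (2 * n * T)).le
      linarith
    · simp [hf.eq_zero_off z hz, hg.eq_zero_off z hz]
  smul_mem' := by
    intro c f hf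
    refine ⟨hf.analytic.const_smul c, fun z => ?_, ?_, fun z hz => ?_⟩
    · simp [hf.periodic]
    · refine (hf.summable.mul_left (‖c‖ ^ 2)).congr fun n => ?_
      rw [coeff_smul, norm_smul]
      ring
    · simp [hf.eq_zero_off z hz]

/-- The Hardy space `⊕_K H²`. A separate type, so that its topology is the one of its norm. -/
def HardySpace (T : ℝ) (K : ℕ) : Type := hardySubmodule T K

instance (T : ℝ) (K : ℕ) : AddCommGroup (HardySpace T K) :=
  inferInstanceAs (AddCommGroup (hardySubmodule T K))

instance (T : ℝ) (K : ℕ) : Module ℂ (HardySpace T K) :=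
  inferInstanceAs (Module ℂ (hardySubmodule T K))

instance (T : ℝ) (K : ℕ) : CoeFun (HardySpace T K) fun _ => ℂ → EuclideanSpace ℂ (Fin K) :=
  ⟨fun f => f.1⟩

theorem HardySpace.ext_strip {T : ℝ} {K : ℕ} {f g : HardySpace T K}
    (h : ∀ z ∈ strip T, f z = g z) : f = g := by
  refine Subtype.ext (funext fun z => ?_)
  by_cases hz : z ∈ strip T
  · exact h z hz
  · rw [f.2.eq_zero_off z hz, g.2.eq_zero_off z hz]

/-- A continuous `2π`-periodic function all of whose Fourier coefficients vanish is zero. -/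
theorem eq_zero_of_coeff_eq_zero_real {T : ℝ} {K : ℕ} {f : ℂ → EuclideanSpace ℂ (Fin K)}
    (hf : IsHardy T f) (h : ∀ n, coeff f n = 0) (x : ℝ) : f x = 0 := by
  have : Fact (0 < 2 * Real.pi) := ⟨Real.two_pi_pos⟩
  ext k
  have hper : Function.Periodic (fun x : ℝ => f x k) (2 * Real.pi) := fun x => by
    have := hf.periodic x
    simp only [Complex.ofReal_add, Complex.ofReal_mul, Complex.ofReal_ofNat]
    rw [this]
  have hcont : Continuous fun x : ℝ => f x k := by
    exact (EuclideanSpace.proj (𝕜 := ℂ) k).continuous.comp hf.continuous_real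
  let F : C(AddCircle (2 * Real.pi), ℂ) :=
    ⟨hper.lift, hcont.quotient_lift _⟩
  have hF : ∀ n, fourierCoeff F n = 0 := fun n => by
    rw [fourierCoeff_eq_intervalIntegral _ n 0]
    have h1 := congrArg (fun v => v k) (h n)
    simp only [coeff] at h1
    have h2 : (∫ x in (0 : ℝ)..(2 * Real.pi), Complex.exp (-(Complex.I * n * x)) • f x) k =
        ∫ x in (0 : ℝ)..(2 * Real.pi), Complex.exp (-(Complex.I * n * x)) • f x k :=
      ((EuclideanSpace.proj (𝕜 := ℂ) k).intervalIntegral_comp_comm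
        (hf.intervalIntegrable n)).symm
    rw [PiLp.smul_apply, h2] at h1
    have hpi : ((1 / (2 * Real.pi) : ℝ) : ℂ) ≠ 0 := by
      exact_mod_cast (one_div_pos.mpr Real.two_pi_pos).ne'
    have h3 := (smul_eq_zero.mp (h1.trans (by simp))).resolve_left hpi
    have h4 : (∫ x in (0 : ℝ)..(2 * Real.pi),
        fourier (-n) (x : AddCircle (2 * Real.pi)) • F (x : AddCircle (2 * Real.pi))) = 0 := by
      rw [← h3]
      refine intervalIntegral.integral_congr fun x _ => ?_
      have : (F (x : AddCircle (2 * Real.pi))) = f x k := rfl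
      simp only [this, fourier_coe_apply]
      congr 2
      push_cast
      field_simp
    rw [zero_add, h4, smul_zero]
  have hs := has_pointwise_sum_fourier_series_of_summable (f := F)
    (by simp [funext hF, summable_zero]) (x : AddCircle (2 * Real.pi))
  simp only [hF, zero_smul] at hs
  exact (hs.unique hasSum_zero)

theorem eq_zero_of_coeff_eq_zero {T : ℝ} {K : ℕ} (f : HardySpace T K)
    (h : ∀ n, coeff f n = 0) : f = 0 := by
  refine HardySpace.ext_strip fun z hz => ?_
  have hT : 0 < T := by
    have := hz.1.trans hz.2
    linarith
  have han : AnalyticOnNhd ℂ (f : ℂ → EuclideanSpace ℂ (Fin K)) (strip T) :=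
    f.2.analytic.analyticOnNhd (isOpen_strip T)
  have hconv : Convex ℝ (strip T) :=
    (convex_halfSpace_im_gt (-T)).inter (convex_halfSpace_im_lt T)
  have h0 : (0 : ℂ) ∈ strip T := by simp [strip, hT]
  refine han.eqOn_zero_of_preconnected_of_frequently_eq_zero hconv.isPreconnected h0 ?_ hz
  have hmap : Filter.Tendsto (fun x : ℝ => (x : ℂ)) (nhdsWithin 0 {0}ᶜ) (nhdsWithin 0 {0}ᶜ) := by
    refine tendsto_nhdsWithin_iff.mpr ⟨?_, ?_⟩
    · exact (Complex.continuous_ofReal.tendsto' 0 0 (by simp)).mono_left nhdsWithin_le_nhds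
    · filter_upwards [self_mem_nhdsWithin] with x hx
      simpa using hx
  exact hmap.frequently (Filter.Eventually.of_forall fun x =>
    eq_zero_of_coeff_eq_zero_real f.2 h x).frequently

theorem summable_inner {T : ℝ} {K : ℕ} (f g : HardySpace T K) :
    Summable fun n : ℤ => ((Real.cosh (2 * n * T) : ℝ) : ℂ) * inner ℂ (coeff f n) (coeff g n) := by
  refine Summable.of_norm_bounded (f.2.summable.add g.2.summable) fun n => ?_
  rw [norm_mul, Complex.norm_real, Real.norm_of_nonneg (Real.cosh_pos _).le]
  have h1 := norm_inner_le_norm (𝕜 := ℂ) (coeff f n) (coeff g n)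
  have h2 : ‖inner ℂ (coeff f n) (coeff g n)‖ ≤ ‖coeff f n‖ ^ 2 + ‖coeff g n‖ ^ 2 := by
    nlinarith [sq_nonneg (‖coeff f n‖ - ‖coeff g n‖), sq_nonneg ‖coeff f n‖,
      sq_nonneg ‖coeff g n‖]
  have h3 := mul_le_mul_of_nonneg_left h2 (Real.cosh_pos (2 * n * T)).le
  linarith

/-- The inner product of `⊕_K H²`, for which the exponentials `e^{inz} E_k` are orthogonal with
`‖e^{inz} E_k‖² = cosh (2nT)`; with Mathlib's convention it is linear in the second variable.
It is the mean `(1/4π) ∫_0^{2π} [f(x+iT)^* g(x+iT) + f(x-iT)^* g(x-iT)] dx`, the boundary values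
`x ↦ f(x ± iT)` being the `L²` functions with Fourier coefficients `e^{∓nT} c_n(f)`. -/
@[reducible]
def hardyCore (T : ℝ) (K : ℕ) : InnerProductSpace.Core ℂ (HardySpace T K) where
  inner f g :=
    ∑' n : ℤ, ((Real.cosh (2 * n * T) : ℝ) : ℂ) * inner ℂ (coeff f n) (coeff g n)
  conj_inner_symm f g := by
    rw [Complex.conj_tsum]
    refine tsum_congr fun n => ?_
    rw [map_mul, Complex.conj_ofReal, inner_conj_symm]
  re_inner_nonneg f := by
    rw [RCLike.re_eq_complex_re, Complex.re_tsum (summable_inner f f)]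
    refine tsum_nonneg fun n => ?_
    rw [Complex.re_ofReal_mul]
    exact mul_nonneg (Real.cosh_pos _).le (inner_self_nonneg (𝕜 := ℂ))
  add_left f g h := by
    rw [← (summable_inner f h).tsum_add (summable_inner g h)]
    refine tsum_congr fun n => ?_
    rw [← mul_add, ← inner_add_left, ← coeff_add f.2 g.2]
    rfl
  smul_left f g c := by
    rw [← tsum_mul_left]
    refine tsum_congr fun n => ?_
    rw [mul_left_comm, ← inner_smul_left, ← coeff_smul]
    rfl
  definite f hf := by
    refine eq_zero_of_coeff_eq_zero f fun n => ?_
    have hre := congrArg Complex.re hf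
    rw [Complex.re_tsum (summable_inner f f), Complex.zero_re] at hre
    have hs : Summable fun n : ℤ => (((Real.cosh (2 * n * T) : ℝ) : ℂ) *
        inner ℂ (coeff f n) (coeff f n)).re := Complex.reCLM.summable (summable_inner f f)
    have hnn : ∀ n : ℤ, 0 ≤ (((Real.cosh (2 * n * T) : ℝ) : ℂ) *
        inner ℂ (coeff f n) (coeff f n)).re := fun n => by
      rw [Complex.re_ofReal_mul]
      exact mul_nonneg (Real.cosh_pos _).le (inner_self_nonneg (𝕜 := ℂ))
    have h0 := congrFun ((hasSum_zero_iff_of_nonneg hnn).mp (hre ▸ hs.hasSum)) n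
    simp only [Complex.re_ofReal_mul, Pi.zero_apply, mul_eq_zero, (Real.cosh_pos _).ne',
      false_or] at h0
    exact (inner_self_eq_zero (𝕜 := ℂ)).mp
      (Complex.ext h0 (inner_self_im (𝕜 := ℂ) (coeff f n)))

instance (T : ℝ) (K : ℕ) : NormedAddCommGroup (HardySpace T K) :=
  (hardyCore T K).toNormedAddCommGroup

instance (T : ℝ) (K : ℕ) : InnerProductSpace ℂ (HardySpace T K) :=
  InnerProductSpace.ofCore (hardyCore T K).toCore

/-! ### The differential operator -/

/-- A `2π`-periodic matrix function on the closed strip, analytic in the open strip, with `j`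
continuous derivatives on the closed strip (entrywise). -/
structure IsCoefficient (T : ℝ) {K : ℕ} (j : ℕ) (P : ℂ → Matrix (Fin K) (Fin K) ℂ) : Prop where
  analytic : ∀ k l, DifferentiableOn ℂ (fun z => P z k l) (strip T)
  periodic : ∀ z ∈ closedStrip T, P (z + 2 * Real.pi) = P z
  contDiff : ∀ k l, ContDiffOn ℂ (j : ℕ∞) (fun z => P z k l) (closedStrip T)

/-- Regularity of `-D P₂ D + P₁ D + P₀ = (-P₂) D² + (P₁ - P₂') D + P₀`: the coefficient of `D^j`
has `j` continuous derivatives on the closed strip, and the leading one is invertible there. As `P₂`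
has two continuous derivatives, `P₁ - P₂'` has one if and only if `P₁` has one. -/
structure IsRegular (T : ℝ) {K : ℕ} (P₂ P₁ P₀ : ℂ → Matrix (Fin K) (Fin K) ℂ) : Prop where
  coeff₂ : IsCoefficient T 2 P₂
  coeff₁ : IsCoefficient T 1 P₁
  coeff₀ : IsCoefficient T 0 P₀
  det_ne_zero : ∀ z ∈ closedStrip T, (P₂ z).det ≠ 0

/-- The expression `-D (P₂ D f) + P₁ D f + P₀ f`, `D = d/dz`. -/
def diffExpr {K : ℕ} (P₂ P₁ P₀ : ℂ → Matrix (Fin K) (Fin K) ℂ)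
    (f : ℂ → EuclideanSpace ℂ (Fin K)) (z : ℂ) : EuclideanSpace ℂ (Fin K) :=
  -deriv (fun w => Matrix.toEuclideanLin (P₂ w) (deriv f w)) z
    + Matrix.toEuclideanLin (P₁ z) (deriv f z) + Matrix.toEuclideanLin (P₀ z) (f z)

theorem differentiableOn_mulVec {T : ℝ} {K j : ℕ} {P : ℂ → Matrix (Fin K) (Fin K) ℂ}
    (hP : IsCoefficient T j P) {u : ℂ → EuclideanSpace ℂ (Fin K)}
    (hu : DifferentiableOn ℂ u (strip T)) :
    DifferentiableOn ℂ (fun w => Matrix.toEuclideanLin (P w) (u w)) (strip T) := by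
  rw [differentiableOn_euclidean] at hu ⊢
  intro k
  simp only [Matrix.toLpLin_apply, Matrix.mulVec, dotProduct]
  exact DifferentiableOn.fun_sum fun l _ => (hP.analytic k l).mul (hu l)

theorem diffExpr_add {T : ℝ} {K j : ℕ} {P₂ P₁ P₀ : ℂ → Matrix (Fin K) (Fin K) ℂ}
    (h : IsCoefficient T j P₂) (f g : HardySpace T K) {z : ℂ} (hz : z ∈ strip T) :
    diffExpr P₂ P₁ P₀ (f + g : HardySpace T K) z =
      diffExpr P₂ P₁ P₀ f z + diffExpr P₂ P₁ P₀ g z := by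
  have hd : ∀ u : HardySpace T K, ∀ w ∈ strip T, DifferentiableAt ℂ (u : ℂ → _) w := fun u w hw =>
    u.2.analytic.differentiableAt ((isOpen_strip T).mem_nhds hw)
  have hd2 : ∀ u : HardySpace T K,
      DifferentiableAt ℂ (fun w => Matrix.toEuclideanLin (P₂ w) (deriv (u : ℂ → _) w)) z :=
    fun u => (differentiableOn_mulVec h (u.2.analytic.deriv (isOpen_strip T))).differentiableAt
      ((isOpen_strip T).mem_nhds hz)
  have hadd : ∀ w ∈ strip T, deriv ((f + g : HardySpace T K) : ℂ → _) w =
      deriv (f : ℂ → _) w + deriv (g : ℂ → _) w := fun w hw =>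
    deriv_add (hd f w hw) (hd g w hw)
  have hval : (f + g : HardySpace T K) z = f z + g z := rfl
  have hev : (fun w => Matrix.toEuclideanLin (P₂ w) (deriv ((f + g : HardySpace T K) : ℂ → _) w))
      =ᶠ[nhds z] (fun w => Matrix.toEuclideanLin (P₂ w) (deriv (f : ℂ → _) w)) +
        fun w => Matrix.toEuclideanLin (P₂ w) (deriv (g : ℂ → _) w) := by
    filter_upwards [(isOpen_strip T).mem_nhds hz] with w hw
    rw [hadd w hw, map_add]
    rfl
  simp only [diffExpr]
  rw [hev.deriv_eq, deriv_add (hd2 f) (hd2 g), hadd z hz, hval, map_add, map_add]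
  abel

theorem diffExpr_smul {T : ℝ} {K : ℕ} {P₂ P₁ P₀ : ℂ → Matrix (Fin K) (Fin K) ℂ}
    (c : ℂ) (f : HardySpace T K) (z : ℂ) :
    diffExpr P₂ P₁ P₀ (c • f : HardySpace T K) z = c • diffExpr P₂ P₁ P₀ f z := by
  have hsm : ∀ w, deriv ((c • f : HardySpace T K) : ℂ → _) w = c • deriv (f : ℂ → _) w :=
    fun w => deriv_const_smul_field (c : ℂ) (f : ℂ → EuclideanSpace ℂ (Fin K))
  have hval : (c • f : HardySpace T K) z = c • f z := rfl
  have hfun : (fun w => Matrix.toEuclideanLin (P₂ w) (deriv ((c • f : HardySpace T K) : ℂ → _) w))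
      = c • fun w => Matrix.toEuclideanLin (P₂ w) (deriv (f : ℂ → _) w) := by
    funext w
    rw [hsm, map_smul]
    rfl
  simp only [diffExpr]
  rw [hfun, deriv_const_smul_field, hsm, hval, map_smul, map_smul, smul_add, smul_add, smul_neg]

/-- The domain `{f ∈ ⊕_K H² : L f ∈ ⊕_K H²}`. -/
def diffDomain {T : ℝ} {K : ℕ} {P₂ P₁ P₀ : ℂ → Matrix (Fin K) (Fin K) ℂ}
    (h : IsRegular T P₂ P₁ P₀) : Submodule ℂ (HardySpace T K) where
  carrier := {f | ∃ g : HardySpace T K, ∀ z ∈ strip T, g z = diffExpr P₂ P₁ P₀ f z}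
  zero_mem' := ⟨0, fun z _ => by
    have h0 := diffExpr_smul (P₂ := P₂) (P₁ := P₁) (P₀ := P₀) 0 (0 : HardySpace T K) z
    rw [zero_smul, zero_smul] at h0
    rw [h0]
    rfl⟩
  add_mem' := by
    rintro f f' ⟨g, hg⟩ ⟨g', hg'⟩
    refine ⟨g + g', fun z hz => ?_⟩
    rw [diffExpr_add h.coeff₂ f f' hz, ← hg z hz, ← hg' z hz]
    rfl
  smul_mem' := by
    rintro c f ⟨g, hg⟩
    refine ⟨c • g, fun z hz => ?_⟩
    rw [diffExpr_smul, ← hg z hz]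
    rfl

/-- The unbounded operator `L = -D P₂ D + P₁ D + P₀` in `⊕_K H²`. -/
def diffOp {T : ℝ} {K : ℕ} {P₂ P₁ P₀ : ℂ → Matrix (Fin K) (Fin K) ℂ}
    (h : IsRegular T P₂ P₁ P₀) : HardySpace T K →ₗ.[ℂ] HardySpace T K where
  domain := diffDomain h
  toFun :=
    { toFun := fun f => f.2.choose
      map_add' := fun f f' => HardySpace.ext_strip fun z hz => by
        rw [(f + f').2.choose_spec z hz]
        refine (diffExpr_add h.coeff₂ f.1 f'.1 hz).trans ?_
        rw [← f.2.choose_spec z hz, ← f'.2.choose_spec z hz]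
        rfl
      map_smul' := fun c f => HardySpace.ext_strip fun z hz => by
        rw [(c • f).2.choose_spec z hz]
        refine (diffExpr_smul c f.1 z).trans ?_
        rw [← f.2.choose_spec z hz]
        rfl }

theorem diffOp_apply {T : ℝ} {K : ℕ} {P₂ P₁ P₀ : ℂ → Matrix (Fin K) (Fin K) ℂ}
    (h : IsRegular T P₂ P₁ P₀) (f : (diffOp h).domain) {z : ℂ} (hz : z ∈ strip T) :
    diffOp h f z = diffExpr P₂ P₁ P₀ (f : HardySpace T K) z :=
  f.2.choose_spec z hz

/-! ### Sectorial operators and semigroups -/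

/-- `A` is m-accretive: for `Re λ > 0` the operator `A + λ` has a bounded everywhere defined
inverse, of norm at most `1 / Re λ`. -/
def IsMAccretive {H : Type*} [NormedAddCommGroup H] [InnerProductSpace ℂ H]
    (A : H →ₗ.[ℂ] H) : Prop :=
  ∀ c : ℂ, 0 < c.re → ∃ R : H →L[ℂ] H, ‖R‖ ≤ 1 / c.re ∧
    ∀ x y : H, R x = y ↔ ∃ hy : y ∈ A.domain, A ⟨y, hy⟩ + c • y = x

/-- `A` is m-sectorial with vertex `0`: it is m-accretive and its numerical range lies in a sector
`|Im ζ| ≤ γ Re ζ`. -/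
def IsMSectorial {H : Type*} [NormedAddCommGroup H] [InnerProductSpace ℂ H]
    (A : H →ₗ.[ℂ] H) : Prop :=
  IsMAccretive A ∧ ∃ γ : ℝ, 0 < γ ∧ ∀ u : A.domain,
    |(inner ℂ (u : H) (A u)).im| ≤ γ * (inner ℂ (u : H) (A u)).re

/-- The shifted operator `A + μ`, with the domain of `A`. -/
def shift {H : Type*} [AddCommGroup H] [Module ℂ H] (A : H →ₗ.[ℂ] H) (μ : ℝ) : H →ₗ.[ℂ] H where
  domain := A.domain
  toFun := A.toFun + (μ : ℂ) • A.domain.subtype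

/-- `(S t)_{t ≥ 0}` is a strongly continuous semigroup of bounded operators (the values for `t < 0`
are irrelevant). -/
structure IsC0Semigroup {H : Type*} [NormedAddCommGroup H] [NormedSpace ℂ H]
    (S : ℝ → H →L[ℂ] H) : Prop where
  map_zero : S 0 = 1
  map_add : ∀ s t, 0 ≤ s → 0 ≤ t → S (s + t) = S s * S t
  tendsto : ∀ x, Filter.Tendsto (fun t => S t x) (nhdsWithin 0 (Set.Ioi 0)) (nhds x)

/-- The open sector `|arg ζ| < δ`, without its vertex. -/
def sector (δ : ℝ) : Set ℂ := {ζ | ζ ≠ 0 ∧ |ζ.arg| < δ}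

/-- `S` is a strongly continuous semigroup that extends, with its semigroup properties, to a
holomorphic bounded operator valued function on a sector `|arg ζ| < δ`, `0 < δ < π/2`. -/
structure IsHolomorphicSemigroup {H : Type*} [NormedAddCommGroup H] [NormedSpace ℂ H]
    (S : ℝ → H →L[ℂ] H) : Prop where
  isC0 : IsC0Semigroup S
  extends_to_sector : ∃ δ : ℝ, 0 < δ ∧ δ < Real.pi / 2 ∧ ∃ Z : ℂ → H →L[ℂ] H,
    DifferentiableOn ℂ Z (sector δ) ∧
    (∀ t : ℝ, 0 < t → Z t = S t) ∧
    (∀ ζ ∈ sector δ, ∀ ξ ∈ sector δ, Z (ζ + ξ) = Z ζ * Z ξ) ∧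
    ∀ x, Filter.Tendsto (fun ζ => Z ζ x) (nhdsWithin 0 (sector δ)) (nhds x)

/-- `B` is the infinitesimal generator of `S`: `x ∈ dom B` with `B x = y` if and only if
`(S t x - x) / t → y` as `t ↓ 0`. -/
def IsGenerator {H : Type*} [NormedAddCommGroup H] [NormedSpace ℂ H]
    (B : H →ₗ.[ℂ] H) (S : ℝ → H →L[ℂ] H) : Prop :=
  ∀ x y : H, (∃ hx : x ∈ B.domain, B ⟨x, hx⟩ = y) ↔
    Filter.Tendsto (fun t : ℝ => ((t : ℂ)⁻¹) • (S t x - x)) (nhdsWithin 0 (Set.Ioi 0)) (nhds y)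

end

end PeriodicHardy

namespace PeriodicHardy

open MeasureTheory Filter Topology

/-! By Cauchy's theorem the Fourier coefficients of `f` on the line `Im z = τ` are `e^{-nτ} c_n(f)`.
Parseval's identity then makes `‖f‖²` the limit, as `τ ↑ T`, of the mean of `|f|²` over the two
lines `Im z = ±τ`. So pointwise quadratic inequalities in the open strip become inequalities of
norms (`HardySpace.norm_sq_add_le`), and boundary values are never needed. Multiplication by a
bounded analytic matrix is therefore bounded, and the positivity of `P₂` passes to its
multiplication operator `M₂` (`le_re_inner_mulOp`).

Differentiation has the imaginary symbol `in`, hence is skew-symmetric, and `⟨f, L f⟩ = ⟨f', M₂ f'⟩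
+ ⟨f, M₁ f'⟩ + ⟨f, M₀ f⟩`. Young's inequality gives Gårding's inequality (`IsSymbol.re_form_ge`),
while the imaginary part is bounded by a multiple of `‖f'‖² + ‖f‖²`: the numerical range of a shift
of `L` lies in a sector. Conjugation by `(1 - D²)^{-1/2}` turns `L + c` into a bounded coercive
operator, which solves `(L + c) u = g` with `u' ∈ H²` (`IsSymbol.exists_solution`).

The domain only asks that `f` and `L f` lie in `H²`, so `f' ∈ H²` has to be proved before the form
can be used. Let `u` be the solution above of `(L + c) u = (L + c) f`. The difference `f - u` solves
a homogeneous equation with bounded coefficients; Grönwall's inequality along vertical segments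
bounds its derivative on the whole strip, so that derivative is in `H²`, and `f'` with it
(`IsSymbol.exists_deriv_of_mem_domain`). Solving the equation for `P₂ f''` puts `f''` in `H²` as
well.

For the semigroup, the Yosida approximations of `L + μ` are bounded, commute, and keep the sector of
the numerical range. Their exponentials at `ζ` are contractions for `ζ` in a cone and converge
there, locally uniformly in `ζ` on each vector, to a holomorphic semigroup
(`IsMSectorial.exists_semigroup`). The factor `e^{μζ}` removes the shift. -/

theorem inner_self_eq_ofReal_norm_sq {H : Type*} [NormedAddCommGroup H] [InnerProductSpace ℂ H]
    (x : H) : inner ℂ x x = ((‖x‖ ^ 2 : ℝ) : ℂ) := by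
  rw [inner_self_eq_norm_sq_to_K]
  push_cast
  rfl

/-! ### Fourier coefficients and Parseval's identity on horizontal lines. -/

/-- The components of the Fourier coefficients are the Fourier coefficients of the components. -/
theorem coeff_apply {K : ℕ} {g : ℂ → EuclideanSpace ℂ (Fin K)}
    (hg : Continuous fun x : ℝ => g x) (n : ℤ) (k : Fin K) :
    coeff g n k = fourierCoeffOn Real.two_pi_pos (fun x : ℝ => g x k) n := by
  have hint : IntervalIntegrable (fun x : ℝ => Complex.exp (-(Complex.I * n * x)) • g x)
      volume 0 (2 * Real.pi) := by
    have he : Continuous fun x : ℝ => Complex.exp (-(Complex.I * n * x)) := by fun_prop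
    exact (he.smul hg).intervalIntegrable _ _
  have h2 : (∫ x in (0 : ℝ)..(2 * Real.pi), Complex.exp (-(Complex.I * n * x)) • g x) k =
      ∫ x in (0 : ℝ)..(2 * Real.pi), Complex.exp (-(Complex.I * n * x)) • g x k :=
    ((EuclideanSpace.proj (𝕜 := ℂ) k).intervalIntegral_comp_comm hint).symm
  rw [fourierCoeffOn_eq_integral, coeff, PiLp.smul_apply, h2, sub_zero, Complex.coe_smul]
  congr 1
  refine intervalIntegral.integral_congr fun x _ => ?_
  simp only [fourier_coe_apply]
  congr 2
  push_cast
  field_simp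

/-- Parseval's identity on the real axis. -/
theorem hasSum_sq_coeff {K : ℕ} {g : ℂ → EuclideanSpace ℂ (Fin K)}
    (hg : Continuous fun x : ℝ => g x) :
    HasSum (fun n : ℤ => ‖coeff g n‖ ^ 2)
      ((2 * Real.pi)⁻¹ * ∫ x in (0 : ℝ)..(2 * Real.pi), ‖g x‖ ^ 2) := by
  have hk : ∀ k, Continuous fun x : ℝ => g x k := fun k =>
    (EuclideanSpace.proj (𝕜 := ℂ) k).continuous.comp hg
  have h1 : ∀ k, HasSum (fun n : ℤ => ‖coeff g n k‖ ^ 2)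
      ((2 * Real.pi)⁻¹ * ∫ x in (0 : ℝ)..(2 * Real.pi), ‖g x k‖ ^ 2) := fun k => by
    have hL : MemLp (fun x : ℝ => g x k) 2 (volume.restrict (Set.Ioc 0 (2 * Real.pi))) := by
      obtain ⟨C, hC⟩ := (isCompact_Icc (a := (0 : ℝ)) (b := 2 * Real.pi)).exists_bound_of_continuousOn
        (hk k).continuousOn
      exact MemLp.of_bound (hk k).aestronglyMeasurable C
        ((ae_restrict_iff' measurableSet_Ioc).mpr (ae_of_all _ fun x hx => hC x ⟨hx.1.le, hx.2⟩))
    have := hasSum_sq_fourierCoeffOn Real.two_pi_pos hL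
    simpa only [← coeff_apply hg, sub_zero, smul_eq_mul] using this
  have h2 := hasSum_sum fun k (_ : k ∈ Finset.univ) => h1 k
  simp only [← Finset.mul_sum] at h2
  rw [← intervalIntegral.integral_finsetSum (f := fun k (x : ℝ) => ‖g x k‖ ^ 2)
    fun k _ => ((hk k).norm.pow 2).intervalIntegrable _ _] at h2
  simpa only [EuclideanSpace.norm_sq_eq] using h2

/-- Analytic and `2π`-periodic functions on the strip. -/
structure IsPeriodicAnalytic (T : ℝ) {E : Type*} [NormedAddCommGroup E] [NormedSpace ℂ E]
    (f : ℂ → E) : Prop where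
  analytic : DifferentiableOn ℂ f (strip T)
  periodic : ∀ z ∈ strip T, f (z + 2 * Real.pi) = f z

theorem add_two_pi_mem_strip {T : ℝ} {z : ℂ} : z + 2 * Real.pi ∈ strip T ↔ z ∈ strip T := by
  simp [strip]

theorem ofReal_add_mul_I_mem_strip {T τ : ℝ} (hτ : |τ| < T) (x : ℝ) :
    (x : ℂ) + τ * Complex.I ∈ strip T := by
  simpa [strip, abs_lt] using hτ

theorem IsHardy.isPeriodicAnalytic {T : ℝ} {K : ℕ} {f : ℂ → EuclideanSpace ℂ (Fin K)}
    (hf : IsHardy T f) : IsPeriodicAnalytic T f :=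
  ⟨hf.analytic, fun z _ => hf.periodic z⟩

theorem IsPeriodicAnalytic.continuous_line {T τ : ℝ} {E : Type*} [NormedAddCommGroup E]
    [NormedSpace ℂ E] {f : ℂ → E} (hf : IsPeriodicAnalytic T f) (hτ : |τ| < T) :
    Continuous fun x : ℝ => f (x + τ * Complex.I) :=
  hf.analytic.continuousOn.comp_continuous (by fun_prop) (ofReal_add_mul_I_mem_strip hτ)

/-- The Fourier coefficients on the line `Im z = τ`, by Cauchy's theorem. -/
theorem IsPeriodicAnalytic.coeff_line {T τ : ℝ} {K : ℕ} {f : ℂ → EuclideanSpace ℂ (Fin K)}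
    (hf : IsPeriodicAnalytic T f) (hτ : |τ| < T) (n : ℤ) :
    coeff (fun z => f (z + τ * Complex.I)) n = ((Real.exp (-(n * τ)) : ℝ) : ℂ) • coeff f n := by
  set F : ℂ → EuclideanSpace ℂ (Fin K) := fun z => Complex.exp (-(Complex.I * n * z)) • f z with hF
  have hFd : DifferentiableOn ℂ F (strip T) := by
    have he : Differentiable ℂ fun z : ℂ => Complex.exp (-(Complex.I * n * z)) := by fun_prop
    exact he.differentiableOn.smul hf.analytic
  have hexp : ∀ z : ℂ, Complex.exp (-(Complex.I * n * (z + 2 * Real.pi))) =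
      Complex.exp (-(Complex.I * n * z)) := fun z => by
    rw [Complex.exp_eq_exp_iff_exists_int]
    exact ⟨-n, by push_cast; ring⟩
  have hrect := Complex.integral_boundary_rect_eq_zero_of_differentiableOn F 0
    (((2 * Real.pi : ℝ) : ℂ) + τ * Complex.I) (hFd.mono fun z hz => by
      have h2 := hz.2
      simp only [Complex.zero_im, Complex.add_im, Complex.ofReal_im, Complex.mul_im,
        Complex.ofReal_re, Complex.I_im, Complex.I_re, mul_one, mul_zero, zero_add,
        add_zero, Set.mem_preimage, Set.mem_uIcc] at h2
      have := abs_lt.mp hτ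
      rcases h2 with h | h <;> exact ⟨by linarith, by linarith⟩)
  simp only [Complex.zero_im, Complex.add_im, Complex.ofReal_im, Complex.mul_im, Complex.zero_re,
        Complex.ofReal_re, Complex.I_im, Complex.I_re, mul_one, mul_zero, zero_add, Complex.add_re,
        Complex.mul_re, sub_zero, zero_mul, Complex.ofReal_zero,
        add_zero] at hrect
  -- The vertical sides of the rectangle differ by a period, so their contributions cancel.
  have hvert : (∫ y in (0 : ℝ)..τ, F (((2 * Real.pi : ℝ) : ℂ) + y * Complex.I)) =
      ∫ y in (0 : ℝ)..τ, F (y * Complex.I) := by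
    refine intervalIntegral.integral_congr fun y hy => ?_
    have hy' : (y * Complex.I : ℂ) ∈ strip T := by
      have hyT : |y| < T := by
        rw [Set.mem_uIcc] at hy
        have := abs_lt.mp hτ
        rw [abs_lt]
        rcases hy with h | h <;> exact ⟨by linarith, by linarith⟩
      simpa using ofReal_add_mul_I_mem_strip hyT 0
    have h1 : ((2 * Real.pi : ℝ) : ℂ) + y * Complex.I = y * Complex.I + 2 * Real.pi := by
      push_cast; ring
    simp only [hF]
    rw [h1, hexp, hf.periodic _ hy']
  rw [hvert, add_sub_cancel_right, sub_eq_zero] at hrect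
  have h3 : (∫ x in (0 : ℝ)..(2 * Real.pi), F (x + τ * Complex.I)) =
      Complex.exp (n * τ) • ∫ x in (0 : ℝ)..(2 * Real.pi),
        Complex.exp (-(Complex.I * n * x)) • f (x + τ * Complex.I) := by
    rw [← intervalIntegral.integral_smul]
    refine intervalIntegral.integral_congr fun x _ => ?_
    simp only [hF, smul_smul, ← Complex.exp_add]
    congr 2
    linear_combination (-(n * τ) : ℂ) * Complex.I_sq
  rw [h3] at hrect
  simp only [coeff]
  rw [hrect, smul_comm _ (Complex.exp (n * τ)), smul_smul, Complex.ofReal_exp, ← Complex.exp_add]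
  simp

/-- Parseval's identity on the line `Im z = τ`. -/
theorem IsPeriodicAnalytic.hasSum_line {T τ : ℝ} {K : ℕ} {f : ℂ → EuclideanSpace ℂ (Fin K)}
    (hf : IsPeriodicAnalytic T f) (hτ : |τ| < T) :
    HasSum (fun n : ℤ => ‖coeff f n‖ ^ 2 * Real.exp (-(2 * n * τ)))
      ((2 * Real.pi)⁻¹ * ∫ x in (0 : ℝ)..(2 * Real.pi), ‖f (x + τ * Complex.I)‖ ^ 2) := by
  have h := hasSum_sq_coeff (g := fun z => f (z + τ * Complex.I)) (hf.continuous_line hτ)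
  have h1 : (fun n : ℤ => ‖coeff (fun z => f (z + τ * Complex.I)) n‖ ^ 2) =
      fun n : ℤ => ‖coeff f n‖ ^ 2 * Real.exp (-(2 * n * τ)) := by
    funext n
    rw [hf.coeff_line hτ, norm_smul, Complex.norm_real, Real.norm_of_nonneg (Real.exp_pos _).le,
      mul_pow, mul_comm, ← Real.exp_nat_mul]
    congr 2
    push_cast
    ring
  rwa [h1] at h

/-- The mean of `‖f‖²` over the two lines `Im z = ±τ`. -/
noncomputable def lineMean {E : Type*} [NormedAddCommGroup E] (f : ℂ → E) (τ : ℝ) : ℝ :=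
  ((2 * Real.pi)⁻¹ * (∫ x in (0 : ℝ)..(2 * Real.pi), ‖f (x + τ * Complex.I)‖ ^ 2) +
    (2 * Real.pi)⁻¹ * ∫ x in (0 : ℝ)..(2 * Real.pi), ‖f (x + (-τ : ℝ) * Complex.I)‖ ^ 2) / 2

theorem IsPeriodicAnalytic.hasSum_lineMean {T τ : ℝ} {K : ℕ} {f : ℂ → EuclideanSpace ℂ (Fin K)}
    (hf : IsPeriodicAnalytic T f) (hτ : |τ| < T) :
    HasSum (fun n : ℤ => ‖coeff f n‖ ^ 2 * Real.cosh (2 * n * τ)) (lineMean f τ) := by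
  have h := ((hf.hasSum_line hτ).add (hf.hasSum_line (τ := -τ) (by rwa [abs_neg]))).div_const 2
  have h1 : (fun n : ℤ => (‖coeff f n‖ ^ 2 * Real.exp (-(2 * n * τ)) +
      ‖coeff f n‖ ^ 2 * Real.exp (-(2 * n * -τ))) / 2) =
      fun n : ℤ => ‖coeff f n‖ ^ 2 * Real.cosh (2 * n * τ) := by
    funext n
    rw [Real.cosh_eq]
    ring_nf
  rwa [h1] at h

/-- The value spaces may differ, so that a vector function can be compared with a scalar constant.
-/
theorem lineMean_mono {E F : Type*} [NormedAddCommGroup E] [NormedSpace ℂ E]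
    [NormedAddCommGroup F] [NormedSpace ℂ F] {T τ : ℝ} {f : ℂ → E} {g : ℂ → F}
    (hf : IsPeriodicAnalytic T f) (hg : IsPeriodicAnalytic T g) (hτ : |τ| < T)
    (h : ∀ z ∈ strip T, ‖f z‖ ≤ ‖g z‖) : lineMean f τ ≤ lineMean g τ := by
  have key : ∀ σ : ℝ, |σ| < T → (∫ x in (0 : ℝ)..(2 * Real.pi), ‖f (x + σ * Complex.I)‖ ^ 2) ≤
      ∫ x in (0 : ℝ)..(2 * Real.pi), ‖g (x + σ * Complex.I)‖ ^ 2 := fun σ hσ =>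
    intervalIntegral.integral_mono_on Real.two_pi_pos.le
      (((hf.continuous_line hσ).norm.pow 2).intervalIntegrable _ _)
      (((hg.continuous_line hσ).norm.pow 2).intervalIntegrable _ _) fun x _ => by
        gcongr
        exact h _ (ofReal_add_mul_I_mem_strip hσ x)
  have h1 := key τ hτ
  have h2 := key (-τ) (by rwa [abs_neg])
  unfold lineMean
  gcongr

/-! ### The norm as a limit of line means, and criteria for membership in the Hardy space. -/

section Hardy

variable {T : ℝ} {K : ℕ}

theorem HardySpace.coeff_add (f g : HardySpace T K) (n : ℤ) :
    coeff (f + g : HardySpace T K) n = coeff f n + coeff g n :=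
  PeriodicHardy.coeff_add f.2 g.2 n

theorem HardySpace.coeff_smul (c : ℂ) (f : HardySpace T K) (n : ℤ) :
    coeff (c • f : HardySpace T K) n = c • coeff f n :=
  PeriodicHardy.coeff_smul c f n

theorem HardySpace.coeff_sub (f g : HardySpace T K) (n : ℤ) :
    coeff (f - g : HardySpace T K) n = coeff f n - coeff g n := by
  have h : f - g = f + (-1 : ℂ) • g := by rw [neg_one_smul, sub_eq_add_neg]
  rw [h, HardySpace.coeff_add, HardySpace.coeff_smul, neg_one_smul, sub_eq_add_neg]

theorem HardySpace.ext_coeff {f g : HardySpace T K} (h : ∀ n, coeff f n = coeff g n) : f = g :=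
  sub_eq_zero.mp (eq_zero_of_coeff_eq_zero _ fun n => by
    rw [HardySpace.coeff_sub, h, sub_self])

theorem HardySpace.add_apply (f g : HardySpace T K) (z : ℂ) : (f + g : HardySpace T K) z = f z + g z :=
  rfl

theorem HardySpace.smul_apply (c : ℂ) (f : HardySpace T K) (z : ℂ) :
    (c • f : HardySpace T K) z = c • f z :=
  rfl

theorem HardySpace.neg_apply (f : HardySpace T K) (z : ℂ) : (-f : HardySpace T K) z = -f z :=
  rfl

theorem HardySpace.sub_apply (f g : HardySpace T K) (z : ℂ) :
    (f - g : HardySpace T K) z = f z - g z :=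
  rfl

theorem HardySpace.inner_def (f g : HardySpace T K) : inner ℂ f g =
    ∑' n : ℤ, ((Real.cosh (2 * n * T) : ℝ) : ℂ) * inner ℂ (coeff f n) (coeff g n) :=
  rfl

theorem HardySpace.hasSum_norm_sq (f : HardySpace T K) :
    HasSum (fun n : ℤ => ‖coeff f n‖ ^ 2 * Real.cosh (2 * n * T)) (‖f‖ ^ 2) := by
  have h := Complex.reCLM.hasSum (summable_inner f f).hasSum
  rw [← HardySpace.inner_def] at h
  have h1 : (fun n : ℤ => ‖coeff f n‖ ^ 2 * Real.cosh (2 * n * T)) =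
      fun n : ℤ => Complex.reCLM
        (((Real.cosh (2 * n * T) : ℝ) : ℂ) * inner ℂ (coeff f n) (coeff f n)) := by
    funext n
    have h2 : (inner ℂ (coeff f n) (coeff f n)).re = ‖coeff f n‖ ^ 2 :=
      inner_self_eq_norm_sq (𝕜 := ℂ) _
    rw [Complex.reCLM_apply, Complex.re_ofReal_mul, h2, mul_comm]
  have h2 : Complex.reCLM (inner ℂ f f) = ‖f‖ ^ 2 := inner_self_eq_norm_sq (𝕜 := ℂ) f
  rw [h1, ← h2]
  exact h

theorem cosh_le_cosh_two_mul {τ : ℝ} (h : |τ| ≤ T) (n : ℤ) :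
    Real.cosh (2 * n * τ) ≤ Real.cosh (2 * n * T) := by
  rw [Real.cosh_le_cosh, abs_mul (2 * (n : ℝ)) τ, abs_mul (2 * (n : ℝ)) T]
  exact mul_le_mul_of_nonneg_left (h.trans (le_abs_self T)) (abs_nonneg _)

/-- The norm of `⊕_K H²` is the limit of the means over the lines `Im z = ±τ`, `τ ↑ T`. -/
theorem HardySpace.tendsto_lineMean (hT : 0 < T) (f : HardySpace T K) :
    Tendsto (lineMean f) (𝓝[<] T) (𝓝 (‖f‖ ^ 2)) := by
  have hev : ∀ᶠ τ in 𝓝[<] T, |τ| < T := by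
    filter_upwards [Ioo_mem_nhdsLT (show -T < T by linarith)] with τ hτ
    exact abs_lt.mpr hτ
  have h : Tendsto (fun τ : ℝ => ∑' n : ℤ, ‖coeff f n‖ ^ 2 * Real.cosh (2 * n * τ)) (𝓝[<] T)
      (𝓝 (∑' n : ℤ, ‖coeff f n‖ ^ 2 * Real.cosh (2 * n * T))) := by
    refine tendsto_tsum_of_dominated_convergence f.2.summable (fun n => ?_) ?_
    · have hc : Continuous fun τ : ℝ => ‖coeff f n‖ ^ 2 * Real.cosh (2 * n * τ) := by fun_prop
      exact (hc.tendsto T).mono_left nhdsWithin_le_nhds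
    · filter_upwards [hev] with τ hτ n
      rw [Real.norm_of_nonneg (mul_nonneg (sq_nonneg _) (Real.cosh_pos _).le)]
      exact mul_le_mul_of_nonneg_left (cosh_le_cosh_two_mul hτ.le n) (sq_nonneg _)
  rw [f.hasSum_norm_sq.tsum_eq] at h
  refine h.congr' ?_
  filter_upwards [hev] with τ hτ
  exact (f.2.isPeriodicAnalytic.hasSum_lineMean hτ).tsum_eq

/-- Pointwise quadratic inequalities on the strip pass to the norms. -/
theorem HardySpace.norm_sq_add_le (hT : 0 < T) {f g h : HardySpace T K} {a : ℝ}
    (hfg : ∀ z ∈ strip T, ‖f z‖ ^ 2 + a * ‖h z‖ ^ 2 ≤ ‖g z‖ ^ 2) :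
    ‖f‖ ^ 2 + a * ‖h‖ ^ 2 ≤ ‖g‖ ^ 2 := by
  refine le_of_tendsto_of_tendsto ((f.tendsto_lineMean hT).add ((h.tendsto_lineMean hT).const_mul a))
    (g.tendsto_lineMean hT) ?_
  filter_upwards [Ioo_mem_nhdsLT (show -T < T by linarith)] with τ hτ
  have hτ' : |τ| < T := abs_lt.mpr hτ
  have key : ∀ σ : ℝ, |σ| < T → (∫ x in (0 : ℝ)..(2 * Real.pi), ‖f (x + σ * Complex.I)‖ ^ 2) +
      a * (∫ x in (0 : ℝ)..(2 * Real.pi), ‖h (x + σ * Complex.I)‖ ^ 2) ≤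
      ∫ x in (0 : ℝ)..(2 * Real.pi), ‖g (x + σ * Complex.I)‖ ^ 2 := fun σ hσ => by
    have hc : ∀ u : HardySpace T K, Continuous fun x : ℝ => ‖u (x + σ * Complex.I)‖ ^ 2 :=
      fun u => (u.2.isPeriodicAnalytic.continuous_line hσ).norm.pow 2
    have hi : ∀ u : HardySpace T K, IntervalIntegrable (fun x : ℝ => ‖u (x + σ * Complex.I)‖ ^ 2)
        volume 0 (2 * Real.pi) := fun u => (hc u).intervalIntegrable _ _
    rw [← intervalIntegral.integral_const_mul,
      ← intervalIntegral.integral_add (hi f) ((hi h).const_mul a)]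
    exact intervalIntegral.integral_mono_on Real.two_pi_pos.le
      ((hi f).add ((hi h).const_mul a)) (hi g) fun x _ => hfg _ (ofReal_add_mul_I_mem_strip hσ x)
  have h1 := mul_le_mul_of_nonneg_left (key τ hτ') (inv_nonneg.mpr Real.two_pi_pos.le)
  have h2 := mul_le_mul_of_nonneg_left (key (-τ) (by rwa [abs_neg]))
    (inv_nonneg.mpr Real.two_pi_pos.le)
  simp only [lineMean]
  linarith

theorem coeff_congr {f g : ℂ → EuclideanSpace ℂ (Fin K)} (h : ∀ x : ℝ, f x = g x) (n : ℤ) :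
    coeff f n = coeff g n := by
  simp only [coeff, h]

theorem ofReal_mem_strip (hT : 0 < T) (x : ℝ) : (x : ℂ) ∈ strip T := by
  simp [strip, hT]

theorem coeff_congr_strip (hT : 0 < T) {f g : ℂ → EuclideanSpace ℂ (Fin K)}
    (h : ∀ z ∈ strip T, f z = g z) (n : ℤ) : coeff f n = coeff g n :=
  coeff_congr (fun x => h x (ofReal_mem_strip hT x)) n

/-- A periodic analytic function on the strip whose Fourier coefficients are summable with the
weights `cosh (2nT)` is an element of `⊕_K H²`. -/
theorem IsPeriodicAnalytic.exists_hardy_of_summable (hT : 0 < T)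
    {F : ℂ → EuclideanSpace ℂ (Fin K)} (hF : IsPeriodicAnalytic T F)
    (hs : Summable fun n : ℤ => ‖coeff F n‖ ^ 2 * Real.cosh (2 * n * T)) :
    ∃ g : HardySpace T K, ∀ z ∈ strip T, g z = F z := by
  classical
  have hi : ∀ z ∈ strip T, (strip T).indicator F z = F z := fun z hz => Set.indicator_of_mem hz F
  refine ⟨⟨(strip T).indicator F, hF.analytic.congr hi, fun z => ?_, ?_,
    fun z hz => Set.indicator_of_notMem hz F⟩, hi⟩
  · by_cases hz : z ∈ strip T
    · rw [hi _ (add_two_pi_mem_strip.mpr hz), hi z hz, hF.periodic z hz]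
    · rw [Set.indicator_of_notMem hz, Set.indicator_of_notMem (fun h => hz (add_two_pi_mem_strip.mp h))]
  · simpa only [coeff_congr_strip hT hi] using hs

/-- A periodic analytic function on the strip with bounded quadratic means over lines is an element
of `⊕_K H²`. -/
theorem IsPeriodicAnalytic.exists_hardy_of_lineMean_le (hT : 0 < T)
    {F : ℂ → EuclideanSpace ℂ (Fin K)} (hF : IsPeriodicAnalytic T F) {C : ℝ}
    (hC : ∀ τ, 0 ≤ τ → τ < T → lineMean F τ ≤ C) :
    ∃ g : HardySpace T K, ∀ z ∈ strip T, g z = F z := by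
  refine hF.exists_hardy_of_summable hT (summable_of_sum_le (c := C)
    (fun n => mul_nonneg (sq_nonneg _) (Real.cosh_pos _).le) fun s => ?_)
  -- A finite partial sum is continuous in `τ` up to `T`, so its bound for `τ < T` survives at `T`,
  -- where nothing is known of `F`.
  have hc : Continuous fun τ : ℝ => ∑ n ∈ s, ‖coeff F n‖ ^ 2 * Real.cosh (2 * n * τ) := by fun_prop
  refine le_of_tendsto ((hc.tendsto T).mono_left (nhdsWithin_le_nhds (s := Set.Iio T))) ?_
  filter_upwards [Ioo_mem_nhdsLT hT] with τ hτ
  have hs := hF.hasSum_lineMean (abs_lt.mpr ⟨by linarith [hτ.1], hτ.2⟩)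
  exact (sum_le_hasSum s (fun n _ => mul_nonneg (sq_nonneg _) (Real.cosh_pos _).le) hs).trans
    (hC τ hτ.1.le hτ.2)

theorem HardySpace.lineMean_le {τ : ℝ} (hτ : |τ| < T) (f : HardySpace T K) :
    lineMean f τ ≤ ‖f‖ ^ 2 :=
  hasSum_le (fun n => mul_le_mul_of_nonneg_left (cosh_le_cosh_two_mul hτ.le n) (sq_nonneg _))
    (f.2.isPeriodicAnalytic.hasSum_lineMean hτ) f.hasSum_norm_sq

theorem IsPeriodicAnalytic.exists_hardy_of_norm_le_norm (hT : 0 < T)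
    {F : ℂ → EuclideanSpace ℂ (Fin K)} (hF : IsPeriodicAnalytic T F) (h : HardySpace T K) {C : ℝ}
    (hC : ∀ z ∈ strip T, ‖F z‖ ≤ C * ‖h z‖) :
    ∃ g : HardySpace T K, ∀ z ∈ strip T, g z = F z := by
  refine hF.exists_hardy_of_lineMean_le hT (C := ‖(C : ℂ) • h‖ ^ 2) fun τ h0 hτ => ?_
  have hτ' : |τ| < T := abs_lt.mpr ⟨by linarith, hτ⟩
  refine (lineMean_mono hF ((C : ℂ) • h).2.isPeriodicAnalytic hτ' fun z hz => ?_).trans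
    (((C : ℂ) • h).lineMean_le hτ')
  rw [HardySpace.smul_apply, norm_smul, Complex.norm_real]
  exact (hC z hz).trans (mul_le_mul_of_nonneg_right (le_abs_self C) (norm_nonneg _))

theorem IsPeriodicAnalytic.exists_hardy_of_norm_le (hT : 0 < T)
    {F : ℂ → EuclideanSpace ℂ (Fin K)} (hF : IsPeriodicAnalytic T F) {C : ℝ}
    (hC : ∀ z ∈ strip T, ‖F z‖ ≤ C) : ∃ g : HardySpace T K, ∀ z ∈ strip T, g z = F z := by
  refine hF.exists_hardy_of_lineMean_le hT (C := lineMean (fun _ => (C : ℂ)) 0) fun τ h0 hτ => ?_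
  have hτ' : |τ| < T := abs_lt.mpr ⟨by linarith, hτ⟩
  have hconst : IsPeriodicAnalytic T fun _ : ℂ => (C : ℂ) :=
    ⟨differentiableOn_const _, fun _ _ => rfl⟩
  -- The mean of a constant is the same on every line, by definition; hence the bound taken at `0`.
  refine (lineMean_mono hF hconst hτ' fun z hz => ?_).trans le_rfl
  rw [Complex.norm_real]
  exact (hC z hz).trans (le_abs_self C)

/-! ### Fourier coefficients of derivatives. -/

theorem IsPeriodicAnalytic.deriv {E : Type*} [NormedAddCommGroup E] [NormedSpace ℂ E] [CompleteSpace E]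
    {F : ℂ → E} (hF : IsPeriodicAnalytic T F) : IsPeriodicAnalytic T (deriv F) := by
  refine ⟨hF.analytic.deriv (isOpen_strip T), fun z hz => ?_⟩
  rw [← deriv_comp_add_const]
  refine Filter.EventuallyEq.deriv_eq ?_
  filter_upwards [(isOpen_strip T).mem_nhds hz] with w hw
  exact hF.periodic w hw

/-- Integration by parts over a period of the real axis; the boundary terms cancel by periodicity.
-/
theorem IsPeriodicAnalytic.coeff_deriv (hT : 0 < T) {F : ℂ → EuclideanSpace ℂ (Fin K)}
    (hF : IsPeriodicAnalytic T F) (n : ℤ) :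
    coeff (_root_.deriv F) n = (Complex.I * n) • coeff F n := by
  have hd : ∀ x : ℝ, HasDerivAt (fun x : ℝ => Complex.exp (-(Complex.I * n * x)) • F x)
      (Complex.exp (-(Complex.I * n * x)) • _root_.deriv F x +
        (Complex.exp (-(Complex.I * n * x)) * -(Complex.I * n)) • F x) x := fun x => by
    have h1 : HasDerivAt (fun x : ℝ => F x) (_root_.deriv F x) x := by
      have h := HasDerivAt.scomp x (hF.analytic.differentiableAt
        ((isOpen_strip T).mem_nhds (ofReal_mem_strip hT x))).hasDerivAt
        Complex.ofRealCLM.hasDerivAt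
      rw [Complex.ofRealCLM_apply, Complex.ofReal_one, one_smul] at h
      exact h
    have h2 : HasDerivAt (fun z : ℂ => Complex.exp (-(Complex.I * n * z)))
        (Complex.exp (-(Complex.I * n * x)) * -(Complex.I * n)) (x : ℂ) := by
      simpa using (((hasDerivAt_id (x : ℂ)).const_mul (Complex.I * n)).neg).cexp
    exact h2.comp_ofReal.smul h1
  have hc : ∀ {G : ℂ → EuclideanSpace ℂ (Fin K)}, IsPeriodicAnalytic T G →
      IntervalIntegrable (fun x : ℝ => Complex.exp (-(Complex.I * n * x)) • G x)
        volume 0 (2 * Real.pi) := fun {G} hG => by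
    have he : Continuous fun x : ℝ => Complex.exp (-(Complex.I * n * x)) := by fun_prop
    have hG' : Continuous fun x : ℝ => G x :=
      hG.analytic.continuousOn.comp_continuous Complex.continuous_ofReal (ofReal_mem_strip hT)
    exact (he.smul hG').intervalIntegrable _ _
  have hc2 : IntervalIntegrable
      (fun x : ℝ => (Complex.exp (-(Complex.I * n * x)) * -(Complex.I * n)) • F x)
        volume 0 (2 * Real.pi) := by
    have := (hc hF).smul (-(Complex.I * n))
    refine this.congr_ae (ae_of_all _ fun x => ?_)
    simp only [Pi.smul_apply, smul_smul, mul_comm]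
  have hint := intervalIntegral.integral_eq_sub_of_hasDerivAt (fun x _ => hd x)
    ((hc hF.deriv).add hc2)
  have hexp : Complex.exp (-(Complex.I * n * ((2 * Real.pi : ℝ) : ℂ))) = 1 := by
    rw [Complex.exp_eq_one_iff]
    exact ⟨-n, by push_cast; ring⟩
  have hper : F ((2 * Real.pi : ℝ) : ℂ) = F ((0 : ℝ) : ℂ) := by
    have := hF.periodic _ (ofReal_mem_strip hT 0)
    rw [← this]
    congr 1
    push_cast
    ring
  rw [hexp, hper, one_smul, Complex.ofReal_zero, mul_zero, neg_zero, Complex.exp_zero, one_smul,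
    sub_self, intervalIntegral.integral_add (hc hF.deriv) hc2] at hint
  have h3 : (∫ x in (0 : ℝ)..(2 * Real.pi),
      (Complex.exp (-(Complex.I * n * x)) * -(Complex.I * n)) • F x) =
      -((Complex.I * n) • ∫ x in (0 : ℝ)..(2 * Real.pi), Complex.exp (-(Complex.I * n * x)) • F x) := by
    rw [← intervalIntegral.integral_smul, ← intervalIntegral.integral_neg]
    refine intervalIntegral.integral_congr fun x _ => ?_
    simp only [smul_smul, ← neg_smul]
    ring_nf
  rw [h3, add_neg_eq_zero] at hint
  simp only [coeff]
  rw [hint, smul_comm]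

/-! ### Synthesis from Fourier coefficients, and completeness. -/

theorem summable_exp_neg_mul_abs_int {r : ℝ} (hr : 0 < r) :
    Summable fun n : ℤ => Real.exp (-(r * |(n : ℝ)|)) := by
  have h : Summable fun n : ℕ => Real.exp (-(r * n)) := by
    have := Real.summable_exp_nat_mul_iff.mpr (neg_lt_zero.mpr hr)
    refine this.congr fun n => ?_
    ring_nf
  refine Summable.of_nat_of_neg ?_ ?_ <;> simpa using h

theorem norm_exp_I_mul_int_mul_le {S : ℝ} {z : ℂ} (hz : z ∈ strip S) (n : ℤ) :
    ‖Complex.exp (Complex.I * n * z)‖ ≤ Real.exp (S * |(n : ℝ)|) := by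
  rw [Complex.norm_exp, Real.exp_le_exp]
  have h1 : (Complex.I * n * z).re = -(n * z.im) := by simp
  have h2 : |z.im| ≤ S := (abs_lt.mpr hz).le
  rw [h1]
  calc -(n * z.im) ≤ |n * z.im| := neg_le_abs _
    _ = |z.im| * |(n : ℝ)| := by rw [abs_mul, mul_comm]
    _ ≤ S * |(n : ℝ)| := mul_le_mul_of_nonneg_right h2 (abs_nonneg _)

theorem exp_abs_le_two_mul_cosh (x : ℝ) : Real.exp |x| ≤ 2 * Real.cosh x := by
  rw [← Real.cosh_abs, Real.cosh_eq]
  have := Real.exp_pos (-|x|)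
  linarith

theorem coeff_exp_smul (m : ℤ) (v : EuclideanSpace ℂ (Fin K)) (n : ℤ) :
    coeff (fun z => Complex.exp (Complex.I * m * z) • v) n = if m = n then v else 0 := by
  have h1 : ∀ x : ℝ, Complex.exp (-(Complex.I * n * x)) • Complex.exp (Complex.I * m * x) • v =
      Complex.exp (Complex.I * (m - n) * x) • v := fun x => by
    rw [smul_smul, ← Complex.exp_add]
    ring_nf
  have hpi : (Real.pi : ℂ) ≠ 0 := by exact_mod_cast Real.pi_ne_zero
  simp only [coeff, h1, intervalIntegral.integral_smul_const]
  split_ifs with h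
  · subst h
    simp [smul_smul]
    field_simp
    simp
  · have hne : (Complex.I * (m - n) : ℂ) ≠ 0 :=
      mul_ne_zero Complex.I_ne_zero (sub_ne_zero.mpr (by exact_mod_cast h))
    have hexp : Complex.exp (Complex.I * (m - n) * ((2 * Real.pi : ℝ) : ℂ)) = 1 := by
      rw [Complex.exp_eq_one_iff]
      exact ⟨m - n, by push_cast; ring⟩
    rw [integral_exp_mul_complex hne, hexp]
    simp

/-- Fourier series with square summable coefficients for the weights `cosh (2nT)` converge to
elements of `⊕_K H²`. -/
theorem exists_hardy_coeff_eq (hT : 0 < T) {a : ℤ → EuclideanSpace ℂ (Fin K)}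
    (ha : Summable fun n : ℤ => ‖a n‖ ^ 2 * Real.cosh (2 * n * T)) :
    ∃ f : HardySpace T K, ∀ n, coeff f n = a n := by
  -- Each term of the series is at most its sum `B`, and `e^{2|n|T} ≤ 2 cosh (2nT)`, whence `‖a n‖ ≤
  -- √(2B) e^{-T|n|}`.
  obtain ⟨M, hM0, hM⟩ : ∃ M : ℝ, 0 ≤ M ∧ ∀ n, ‖a n‖ ≤ M * Real.exp (-(T * |(n : ℝ)|)) := by
    set B := ∑' n : ℤ, ‖a n‖ ^ 2 * Real.cosh (2 * n * T) with hB
    have hB0 : 0 ≤ B := tsum_nonneg fun n => mul_nonneg (sq_nonneg _) (Real.cosh_pos _).le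
    refine ⟨Real.sqrt (2 * B), Real.sqrt_nonneg _, fun n => ?_⟩
    have h1 : ‖a n‖ ^ 2 * Real.cosh (2 * n * T) ≤ B :=
      ha.le_tsum n fun m _ => mul_nonneg (sq_nonneg _) (Real.cosh_pos _).le
    have h2 := exp_abs_le_two_mul_cosh (2 * n * T)
    have h3 : Real.exp |2 * n * T| = Real.exp (T * |(n : ℝ)|) ^ 2 := by
      rw [← Real.exp_nat_mul, abs_mul, abs_mul, abs_of_pos hT]
      congr 1
      norm_num
      ring
    rw [Real.exp_neg, ← div_eq_mul_inv, le_div_iff₀ (Real.exp_pos _)]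
    refine Real.le_sqrt_of_sq_le ?_
    rw [mul_pow, ← h3]
    nlinarith [mul_le_mul_of_nonneg_left h2 (sq_nonneg ‖a n‖)]
  set u : ℝ → ℤ → ℝ := fun S n => M * Real.exp (-((T - S) * |(n : ℝ)|)) with hu
  have husum : ∀ {S}, S < T → Summable (u S) := fun {S} hS =>
    (summable_exp_neg_mul_abs_int (sub_pos.mpr hS)).mul_left M
  set G : ℤ → ℂ → EuclideanSpace ℂ (Fin K) := fun n z => Complex.exp (Complex.I * n * z) • a n with hG
  have hGu : ∀ {S} (n : ℤ), ∀ z ∈ strip S, ‖G n z‖ ≤ u S n := fun {S} n z hz => by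
    rw [hG, norm_smul]
    refine (mul_le_mul (norm_exp_I_mul_int_mul_le hz n) (hM n) (norm_nonneg _)
      (Real.exp_pos _).le).trans_eq ?_
    rw [hu, mul_left_comm, ← Real.exp_add]
    ring_nf
  have hGd : ∀ n, Differentiable ℂ (G n) := fun n => by
    have he : Differentiable ℂ fun z : ℂ => Complex.exp (Complex.I * n * z) := by fun_prop
    exact he.smul_const _
  set F : ℂ → EuclideanSpace ℂ (Fin K) := fun z => ∑' n, G n z with hF
  have hFp : IsPeriodicAnalytic T F := by
    refine ⟨fun z hz => ?_, fun z _ => ?_⟩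
    -- The majorants `u S` are summable only for `S < T`, so analyticity is shown on each narrower
    -- strip.
    · obtain ⟨S, hS1, hS2⟩ := exists_between (abs_lt.mpr hz)
      have := Complex.differentiableOn_tsum_of_summable_norm (husum hS2)
        (fun n => (hGd n).differentiableOn) (isOpen_strip S) hGu
      exact (this.differentiableAt
        ((isOpen_strip S).mem_nhds (abs_lt.mp hS1))).differentiableWithinAt
    · refine tsum_congr fun n => ?_
      have : Complex.exp (Complex.I * n * (z + 2 * Real.pi)) = Complex.exp (Complex.I * n * z) := by
        rw [Complex.exp_eq_exp_iff_exists_int]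
        exact ⟨n, by ring⟩
      simp only [hG, this]
  have hcF : ∀ n, coeff F n = a n := fun n => by
    have h0 : ∀ x : ℝ, (x : ℂ) ∈ strip (T / 2) := fun x => ofReal_mem_strip (by linarith) x
    have hsum : HasSum (fun m : ℤ => ∫ x in (0 : ℝ)..(2 * Real.pi),
        Complex.exp (-(Complex.I * n * x)) • G m x)
        (∫ x in (0 : ℝ)..(2 * Real.pi), Complex.exp (-(Complex.I * n * x)) • F x) := by
      refine intervalIntegral.hasSum_integral_of_dominated_convergence
        (fun m _ => u (T / 2) m) (fun m => ?_) (fun m => ?_) ?_ ?_ ?_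
      · have hc : Continuous fun x : ℝ => Complex.exp (-(Complex.I * n * x)) • G m x := by
          have h1 : Continuous fun x : ℝ => Complex.exp (-(Complex.I * n * x)) := by fun_prop
          exact h1.smul ((hGd m).continuous.comp Complex.continuous_ofReal)
        exact hc.aestronglyMeasurable
      · refine ae_of_all _ fun x _ => ?_
        have h1 : ‖Complex.exp (-(Complex.I * n * x))‖ = 1 := by
          rw [Complex.norm_exp]
          simp
        rw [norm_smul, h1, one_mul]
        exact hGu m x (h0 x)
      · exact ae_of_all _ fun x _ => husum (by linarith)
      · exact intervalIntegrable_const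
      · refine ae_of_all _ fun x _ => HasSum.const_smul _ ?_
        exact (Summable.of_norm_bounded (husum (by linarith : T / 2 < T))
          fun m => hGu m x (h0 x)).hasSum
    have hsum' := hsum.const_smul ((1 / (2 * Real.pi) : ℝ) : ℂ)
    have h2 : (fun m : ℤ => ((1 / (2 * Real.pi) : ℝ) : ℂ) • ∫ x in (0 : ℝ)..(2 * Real.pi),
        Complex.exp (-(Complex.I * n * x)) • G m x) = fun m => if m = n then a m else 0 :=
      funext fun m => coeff_exp_smul m (a m) n
    rw [h2] at hsum'
    have h3 := hasSum_single (f := fun m => if m = n then a m else 0) n fun m hm => if_neg hm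
    rw [if_pos rfl] at h3
    exact hsum'.unique h3
  obtain ⟨g, hg⟩ := hFp.exists_hardy_of_summable hT (by simpa only [hcF] using ha)
  exact ⟨g, fun n => (coeff_congr_strip hT hg n).trans (hcF n)⟩

theorem memℓp_sqrt_cosh_smul_coeff (f : HardySpace T K) :
    Memℓp (fun n : ℤ => ((Real.sqrt (Real.cosh (2 * n * T)) : ℝ) : ℂ) • coeff f n) 2 := by
  refine (memℓp_gen_iff (by norm_num)).mpr (f.2.summable.congr fun n => ?_)
  rw [norm_smul, Complex.norm_real, Real.norm_of_nonneg (Real.sqrt_nonneg _),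
    ENNReal.toReal_ofNat, Real.rpow_two, mul_pow, Real.sq_sqrt (Real.cosh_pos _).le, mul_comm]

/-- The isometry of `⊕_K H²` with a space of square summable sequences. -/
noncomputable def hardyToLp (T : ℝ) (K : ℕ) :
    HardySpace T K →ₗᵢ[ℂ] lp (fun _ : ℤ => EuclideanSpace ℂ (Fin K)) 2 where
  toFun f := ⟨fun n => ((Real.sqrt (Real.cosh (2 * n * T)) : ℝ) : ℂ) • coeff f n, memℓp_sqrt_cosh_smul_coeff f⟩
  map_add' f g := by
    ext1
    funext n
    simp only [HardySpace.coeff_add, smul_add]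
    rfl
  map_smul' c f := by
    ext1
    funext n
    simp only [HardySpace.coeff_smul, smul_comm _ c]
    rfl
  norm_map' f := by
    have h := lp.hasSum_norm (p := 2) (by norm_num)
      (⟨_, memℓp_sqrt_cosh_smul_coeff f⟩ : lp (fun _ : ℤ => EuclideanSpace ℂ (Fin K)) 2)
    simp only [norm_smul, Complex.norm_real, Real.norm_of_nonneg (Real.sqrt_nonneg _),
      ENNReal.toReal_ofNat, Real.rpow_two, mul_pow, Real.sq_sqrt (Real.cosh_pos _).le] at h
    have h2 := f.hasSum_norm_sq
    simp only [mul_comm (‖coeff _ _‖ ^ 2)] at h2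
    exact (pow_left_inj₀ (norm_nonneg _) (norm_nonneg _) two_ne_zero).mp (h.unique h2)

theorem hardyToLp_surjective (hT : 0 < T) : Function.Surjective (hardyToLp T K) := by
  intro a
  have hpos : ∀ n : ℤ, ((Real.sqrt (Real.cosh (2 * n * T)) : ℝ) : ℂ) ≠ 0 := fun n => by
    exact_mod_cast (Real.sqrt_pos.mpr (Real.cosh_pos _)).ne'
  obtain ⟨f, hf⟩ := exists_hardy_coeff_eq hT
    (a := fun n => ((Real.sqrt (Real.cosh (2 * n * T)) : ℝ) : ℂ)⁻¹ • a n) (by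
      refine (((memℓp_gen_iff (by norm_num)).mp (lp.memℓp a))).congr fun n => ?_
      rw [norm_smul, norm_inv, Complex.norm_real, Real.norm_of_nonneg (Real.sqrt_nonneg _),
        ENNReal.toReal_ofNat, Real.rpow_two, mul_pow, inv_pow, Real.sq_sqrt (Real.cosh_pos _).le]
      have := (Real.cosh_pos (2 * n * T)).ne'
      field_simp)
  refine ⟨f, ?_⟩
  ext1
  funext n
  change ((Real.sqrt (Real.cosh (2 * n * T)) : ℝ) : ℂ) • coeff f n = a n
  rw [hf, smul_inv_smul₀ (hpos n)]

/-- Completeness comes from `ℓ²` through a surjective isometry. It is what the inversion of coercive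
operators and the limits of semigroups rest on. -/
theorem completeSpace_hardySpace (hT : 0 < T) : CompleteSpace (HardySpace T K) := by
  rw [completeSpace_iff_isComplete_range (hardyToLp T K).isometry.isUniformInducing,
    (hardyToLp_surjective hT).range_eq]
  exact isComplete_univ

/-! ### Fourier multipliers and multiplication by matrix functions. -/

/-- Fourier multipliers with bounded symbol. -/
theorem exists_diagOp (hT : 0 < T) {m : ℤ → ℂ} {C : ℝ} (hm : ∀ n, ‖m n‖ ≤ C) :
    ∃ D : HardySpace T K →L[ℂ] HardySpace T K, ∀ f : HardySpace T K, ∀ n,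
      coeff (D f) n = m n • coeff f n := by
  have hC : 0 ≤ C := (norm_nonneg _).trans (hm 0)
  have hle : ∀ (f : HardySpace T K) (n : ℤ), ‖m n • coeff f n‖ ^ 2 * Real.cosh (2 * n * T) ≤
      C ^ 2 * (‖coeff f n‖ ^ 2 * Real.cosh (2 * n * T)) := fun f n => by
    rw [norm_smul, mul_pow, mul_assoc]
    have := Real.cosh_pos (2 * n * T)
    gcongr
    exact hm n
  have hex : ∀ f : HardySpace T K, ∃ g : HardySpace T K, ∀ n, coeff g n = m n • coeff f n :=
    fun f => exists_hardy_coeff_eq hT (Summable.of_nonneg_of_le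
      (fun n => mul_nonneg (sq_nonneg _) (Real.cosh_pos _).le) (hle f) (f.2.summable.mul_left _))
  choose D hD using hex
  let D' : HardySpace T K →ₗ[ℂ] HardySpace T K :=
    { toFun := D
      map_add' := fun f g => HardySpace.ext_coeff fun n => by
        rw [HardySpace.coeff_add, hD, hD, hD, HardySpace.coeff_add, smul_add]
      map_smul' := fun c f => HardySpace.ext_coeff fun n => by
        rw [RingHom.id_apply, HardySpace.coeff_smul, hD, hD, HardySpace.coeff_smul, smul_comm] }
  refine ⟨D'.mkContinuous C fun f => ?_, hD⟩
  refine (pow_le_pow_iff_left₀ (norm_nonneg _) (by positivity) two_ne_zero).mp ?_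
  rw [mul_pow]
  refine hasSum_le (fun n => ?_) (D f).hasSum_norm_sq (f.hasSum_norm_sq.mul_left _)
  rw [hD]
  exact hle f n

/-- Bounded periodic analytic matrix functions on the strip. -/
structure IsMultiplier (T : ℝ) (P : ℂ → Matrix (Fin K) (Fin K) ℂ) : Prop where
  analytic : ∀ k l, DifferentiableOn ℂ (fun z => P z k l) (strip T)
  periodic : ∀ z ∈ strip T, P (z + 2 * Real.pi) = P z
  bounded : ∃ C : ℝ, 0 ≤ C ∧ ∀ z ∈ strip T, ∀ V : EuclideanSpace ℂ (Fin K),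
    ‖Matrix.toEuclideanLin (P z) V‖ ≤ C * ‖V‖

theorem IsMultiplier.isPeriodicAnalytic {P : ℂ → Matrix (Fin K) (Fin K) ℂ} (hP : IsMultiplier T P)
    {u : ℂ → EuclideanSpace ℂ (Fin K)} (hu : IsPeriodicAnalytic T u) :
    IsPeriodicAnalytic T fun z => Matrix.toEuclideanLin (P z) (u z) := by
  refine ⟨?_, fun z hz => by rw [hP.periodic z hz, hu.periodic z hz]⟩
  have hu' := hu.analytic
  rw [differentiableOn_euclidean] at hu' ⊢
  intro k
  simp only [Matrix.toLpLin_apply, Matrix.mulVec, dotProduct]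
  exact DifferentiableOn.fun_sum fun l _ => (hP.analytic k l).mul (hu' l)

/-- Multiplication by a bounded periodic analytic matrix function. -/
theorem IsMultiplier.exists_mulOp (hT : 0 < T) {P : ℂ → Matrix (Fin K) (Fin K) ℂ}
    (hP : IsMultiplier T P) : ∃ M : HardySpace T K →L[ℂ] HardySpace T K,
      ∀ f : HardySpace T K, ∀ z ∈ strip T, M f z = Matrix.toEuclideanLin (P z) (f z) := by
  obtain ⟨C, hC0, hC⟩ := hP.bounded
  have hex : ∀ f : HardySpace T K, ∃ g : HardySpace T K, ∀ z ∈ strip T,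
      g z = Matrix.toEuclideanLin (P z) (f z) := fun f =>
    (hP.isPeriodicAnalytic f.2.isPeriodicAnalytic).exists_hardy_of_norm_le_norm hT f
      fun z hz => hC z hz (f z)
  choose M hM using hex
  let M' : HardySpace T K →ₗ[ℂ] HardySpace T K :=
    { toFun := M
      map_add' := fun f g => HardySpace.ext_strip fun z hz => by
        rw [HardySpace.add_apply, hM _ z hz, hM _ z hz, hM _ z hz, HardySpace.add_apply, map_add]
      map_smul' := fun c f => HardySpace.ext_strip fun z hz => by
        rw [RingHom.id_apply, HardySpace.smul_apply, hM _ z hz, hM _ z hz, HardySpace.smul_apply,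
          map_smul] }
  refine ⟨M'.mkContinuous C fun f => ?_, hM⟩
  have h := HardySpace.norm_sq_add_le hT (f := M f) (g := (C : ℂ) • f) (h := 0) (a := 0)
    fun z hz => by
      rw [zero_mul, add_zero, hM f z hz, HardySpace.smul_apply, norm_smul, Complex.norm_real,
        Real.norm_of_nonneg hC0]
      exact pow_le_pow_left₀ (norm_nonneg _) (hC z hz _) 2
  rw [zero_mul, add_zero, norm_smul, Complex.norm_real, Real.norm_of_nonneg hC0] at h
  exact (pow_le_pow_iff_left₀ (norm_nonneg _) (by positivity) two_ne_zero).mp h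

/-- Pointwise positivity of a multiplier passes to the multiplication operator. -/
theorem le_re_inner_mulOp (hT : 0 < T) {P : ℂ → Matrix (Fin K) (Fin K) ℂ}
    {M : HardySpace T K →L[ℂ] HardySpace T K}
    (hM : ∀ f : HardySpace T K, ∀ z ∈ strip T, M f z = Matrix.toEuclideanLin (P z) (f z)) {C₀ : ℝ}
    (hpos : ∀ z ∈ strip T, ∀ V : EuclideanSpace ℂ (Fin K),
      C₀ * ‖V‖ ^ 2 ≤ (inner ℂ V (Matrix.toEuclideanLin (P z) V)).re) (f : HardySpace T K) :
    C₀ * ‖f‖ ^ 2 ≤ (inner ℂ f (M f)).re := by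
  -- Polarization, `‖V + PV‖² - ‖V - PV‖² = 4 Re ⟨V, PV⟩`, writes positivity as an inequality
  -- between squared norms, the only kind that passes to the limit of line means here.
  have h := HardySpace.norm_sq_add_le hT (f := f - M f) (g := f + M f) (h := f) (a := 4 * C₀)
    fun z hz => by
      have h1 := hpos z hz (f z)
      rw [HardySpace.sub_apply, HardySpace.add_apply, hM f z hz, norm_sub_sq (𝕜 := ℂ),
        norm_add_sq (𝕜 := ℂ), RCLike.re_eq_complex_re]
      linarith
  rw [norm_sub_sq (𝕜 := ℂ), norm_add_sq (𝕜 := ℂ), RCLike.re_eq_complex_re] at h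
  linarith

/-! ### Boundedness of the coefficients on the strip. -/

theorem closedStrip_subset_of_strip : strip T ⊆ closedStrip T := fun _ hz => ⟨hz.1.le, hz.2.le⟩

theorem uniqueDiffOn_closedStrip (hT : 0 < T) : UniqueDiffOn ℂ (closedStrip T) := by
  have hconv : Convex ℝ (closedStrip T) :=
    (convex_halfSpace_im_ge (-T)).inter (convex_halfSpace_im_le T)
  refine uniqueDiffOn_convex_of_isRCLikeNormedField hconv ⟨0, ?_⟩
  exact interior_maximal closedStrip_subset_of_strip (isOpen_strip T) (by simpa using ofReal_mem_strip hT 0)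

/-- Periodicity brings every point of the strip into the compact rectangle `[0, 2π] × [-T, T]`. -/
theorem exists_norm_le_of_continuousOn_closedStrip {E : Type*} [NormedAddCommGroup E] {g : ℂ → E}
    (hg : ContinuousOn g (closedStrip T)) (hper : ∀ z ∈ strip T, g (z + 2 * Real.pi) = g z) :
    ∃ C : ℝ, 0 ≤ C ∧ ∀ z ∈ strip T, ‖g z‖ ≤ C := by
  classical
  have hcpt : IsCompact (Set.Icc 0 (2 * Real.pi) ×ℂ Set.Icc (-T) T) :=
    isCompact_Icc.reProdIm isCompact_Icc
  obtain ⟨C, hC⟩ := hcpt.exists_bound_of_continuousOn (hg.mono fun z hz => hz.2)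
  refine ⟨|C|, abs_nonneg C, fun z hz => ?_⟩
  -- Since `g` is periodic only on the strip, its extension by zero is used: it is periodic on all
  -- of `ℂ`, which allows translation by any multiple of `2π`.
  have hp : Function.Periodic ((strip T).indicator g) (2 * Real.pi : ℂ) := fun w => by
    by_cases hw : w ∈ strip T
    · rw [Set.indicator_of_mem hw, Set.indicator_of_mem (add_two_pi_mem_strip.mpr hw), hper w hw]
    · rw [Set.indicator_of_notMem hw,
        Set.indicator_of_notMem fun h => hw (add_two_pi_mem_strip.mp h)]
  obtain ⟨m, hm, -⟩ := existsUnique_add_zsmul_mem_Ico Real.two_pi_pos z.re 0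
  have hz' : z + m * (2 * Real.pi) ∈ strip T := by simpa [strip] using hz
  have h1 := hp.int_mul m z
  rw [Set.indicator_of_mem hz, Set.indicator_of_mem hz'] at h1
  rw [← h1]
  refine (hC _ ⟨?_, (closedStrip_subset_of_strip hz')⟩).trans (le_abs_self C)
  simp only [zsmul_eq_mul, zero_add] at hm
  simpa using ⟨hm.1, hm.2.le⟩

/-- Two functions are needed for the derivative of `P₂`: the derivative within the closed strip
(`Q`) is continuous up to the boundary, and the ordinary derivative (`P`) agrees with it in the open
strip. -/
theorem isMultiplier_of_continuousOn {P Q : ℂ → Matrix (Fin K) (Fin K) ℂ}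
    (hP : ∀ k l, DifferentiableOn ℂ (fun z => P z k l) (strip T))
    (hper : ∀ z ∈ strip T, P (z + 2 * Real.pi) = P z)
    (hQ : ∀ k l, ContinuousOn (fun z => Q z k l) (closedStrip T))
    (hPQ : ∀ z ∈ strip T, P z = Q z) : IsMultiplier T P := by
  refine ⟨hP, hper, ?_⟩
  let Φ : Matrix (Fin K) (Fin K) ℂ →ₗ[ℂ] (EuclideanSpace ℂ (Fin K) →L[ℂ] EuclideanSpace ℂ (Fin K)) :=
    (LinearMap.toContinuousLinearMap (𝕜 := ℂ) (E := EuclideanSpace ℂ (Fin K))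
      (F' := EuclideanSpace ℂ (Fin K))).toLinearMap ∘ₗ
      (Matrix.toEuclideanLin (𝕜 := ℂ) (m := Fin K) (n := Fin K)).toLinearMap
  have hΦ : Continuous Φ := Φ.continuous_of_finiteDimensional
  have hQc : ContinuousOn Q (closedStrip T) :=
    continuousOn_pi.mpr fun k => continuousOn_pi.mpr fun l => hQ k l
  obtain ⟨C, hC0, hC⟩ := exists_norm_le_of_continuousOn_closedStrip (hΦ.comp_continuousOn hQc)
    fun z hz => by
      simp only [Function.comp_apply]
      rw [← hPQ z hz, ← hPQ _ (add_two_pi_mem_strip.mpr hz), hper z hz]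
  refine ⟨C, hC0, fun z hz V => ?_⟩
  have h1 := (Φ (Q z)).le_of_opNorm_le (hC z hz) V
  rwa [← hPQ z hz] at h1

theorem IsCoefficient.periodic_strip {j : ℕ} {P : ℂ → Matrix (Fin K) (Fin K) ℂ}
    (hP : IsCoefficient T j P) {z : ℂ} (hz : z ∈ strip T) : P (z + 2 * Real.pi) = P z :=
  hP.periodic z (closedStrip_subset_of_strip hz)

theorem IsCoefficient.isMultiplier {j : ℕ} {P : ℂ → Matrix (Fin K) (Fin K) ℂ}
    (hP : IsCoefficient T j P) : IsMultiplier T P :=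
  isMultiplier_of_continuousOn (Q := P) hP.analytic (fun _ hz => hP.periodic_strip hz)
    (fun k l => (hP.contDiff k l).continuousOn) fun _ _ => rfl

theorem IsCoefficient.isMultiplier_deriv (hT : 0 < T) {j : ℕ} (hj : 1 ≤ j)
    {P : ℂ → Matrix (Fin K) (Fin K) ℂ} (hP : IsCoefficient T j P) :
    IsMultiplier T fun z => Matrix.of fun k l => deriv (fun w => P w k l) z := by
  refine isMultiplier_of_continuousOn
    (Q := fun z => Matrix.of fun k l => derivWithin (fun w => P w k l) (closedStrip T) z)
    (fun k l => (hP.analytic k l).deriv (isOpen_strip T)) (fun z hz => ?_) (fun k l => ?_)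
    fun z hz => ?_
  · ext k l
    exact IsPeriodicAnalytic.periodic (IsPeriodicAnalytic.deriv
      ⟨hP.analytic k l, fun w hw => by rw [hP.periodic_strip hw]⟩) z hz
  · exact (hP.contDiff k l).continuousOn_derivWithin (uniqueDiffOn_closedStrip hT)
      (by exact_mod_cast hj)
  · ext k l
    exact (derivWithin_of_mem_nhds (mem_of_superset ((isOpen_strip T).mem_nhds hz)
      closedStrip_subset_of_strip)).symm

/-! ### Differentiation on the Fourier side. -/

/-- The inner product is diagonal in the Fourier coefficients, so conjugating a symbol gives the
adjoint. Being about elements and not operators, this covers the unbounded operator `D` too. -/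
theorem HardySpace.inner_eq_inner_of_coeff {u u' w w' : HardySpace T K} {m : ℤ → ℂ}
    (hw : ∀ n, coeff w' n = m n • coeff w n) (hu : ∀ n, coeff u' n = conj (m n) • coeff u n) :
    inner ℂ u w' = inner ℂ u' w := by
  rw [HardySpace.inner_def, HardySpace.inner_def]
  refine tsum_congr fun n => ?_
  rw [hw, hu, inner_smul_right, inner_smul_left, Complex.conj_conj]

theorem coeff_eq_of_deriv (hT : 0 < T) {f g : HardySpace T K}
    (h : ∀ z ∈ strip T, g z = deriv f z) (n : ℤ) : coeff g n = (Complex.I * n) • coeff f n :=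
  (coeff_congr_strip hT h n).trans (f.2.isPeriodicAnalytic.coeff_deriv hT n)

/-- Because `g` lies in the space, the coefficients of `f'` are square summable with the weights;
`f'` is then an element of the space and is determined by its coefficients. This turns identities of
coefficients back into differential equations. -/
theorem deriv_eq_of_coeff (hT : 0 < T) {f g : HardySpace T K}
    (h : ∀ n, coeff g n = (Complex.I * n) • coeff f n) : ∀ z ∈ strip T, g z = deriv f z := by
  have hc := f.2.isPeriodicAnalytic.coeff_deriv hT
  obtain ⟨g', hg'⟩ := f.2.isPeriodicAnalytic.deriv.exists_hardy_of_summable hT (by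
    simpa only [hc, ← h] using g.2.summable)
  have : g = g' := HardySpace.ext_coeff fun n => by rw [h, coeff_congr_strip hT hg' n, hc]
  rw [this]
  exact hg'

/-- The symbol `in` is purely imaginary. This plays the role of integration by parts on the lines
`Im z = ±T`. -/
theorem inner_deriv (hT : 0 < T) {u u' w w' : HardySpace T K}
    (hu : ∀ z ∈ strip T, u' z = deriv u z) (hw : ∀ z ∈ strip T, w' z = deriv w z) :
    inner ℂ u w' = -inner ℂ u' w := by
  rw [← inner_neg_left]
  refine HardySpace.inner_eq_inner_of_coeff (coeff_eq_of_deriv hT hw) fun n => ?_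
  have h : -u' = (-1 : ℂ) • u' := by rw [neg_one_smul]
  rw [h, HardySpace.coeff_smul, coeff_eq_of_deriv hT hu, smul_smul]
  congr 1
  simp

/-- The product rule for a multiplier. -/
theorem IsMultiplier.deriv_mulVec {P : ℂ → Matrix (Fin K) (Fin K) ℂ} (hP : IsMultiplier T P)
    {u : ℂ → EuclideanSpace ℂ (Fin K)} (hu : DifferentiableOn ℂ u (strip T)) {z : ℂ}
    (hz : z ∈ strip T) :
    deriv (fun w => Matrix.toEuclideanLin (P w) (u w)) z =
      Matrix.toEuclideanLin (Matrix.of fun k l => deriv (fun w => P w k l) z) (u z) +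
        Matrix.toEuclideanLin (P z) (deriv u z) := by
  have hz' := (isOpen_strip T).mem_nhds hz
  have hu' : HasDerivAt u (deriv u z) z := (hu.differentiableAt hz').hasDerivAt
  have hul : ∀ l, HasDerivAt (fun w => u w l) (deriv u z l) z := fun l => by
    have := (EuclideanSpace.proj (𝕜 := ℂ) l : EuclideanSpace ℂ (Fin K) →L[ℂ] ℂ).hasFDerivAt.comp_hasDerivAt
      z hu'
    exact this
  have hPl : ∀ k l, HasDerivAt (fun w => P w k l) (deriv (fun w => P w k l) z) z := fun k l =>
    ((hP.analytic k l).differentiableAt hz').hasDerivAt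
  have hd : DifferentiableAt ℂ (fun w => Matrix.toEuclideanLin (P w) (u w)) z := by
    rw [differentiableAt_euclidean]
    intro k
    simp only [Matrix.toLpLin_apply, Matrix.mulVec, dotProduct]
    exact DifferentiableAt.fun_sum fun l _ =>
      (hPl k l).differentiableAt.mul (hul l).differentiableAt
  ext k
  have h1 : HasDerivAt (fun w => ∑ l, P w k l * u w l) _ z := (EuclideanSpace.proj (𝕜 := ℂ) k :
    EuclideanSpace ℂ (Fin K) →L[ℂ] ℂ).hasFDerivAt.comp_hasDerivAt z hd.hasDerivAt
  refine h1.unique ?_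
  simp only [Matrix.toLpLin_apply, Matrix.mulVec, dotProduct, PiLp.add_apply, Matrix.of_apply,
    ← Finset.sum_add_distrib]
  exact HasDerivAt.fun_sum fun l _ => (hPl k l).mul (hul l)

/-! ### The sesquilinear form and solvability of `(L + c) f = g`. -/

/-- The operators of multiplication by the coefficients of the differential operator, and by the
derivative of the leading coefficient, which is uniformly positive. -/
structure IsSymbol (T : ℝ) (P₂ P₁ P₀ : ℂ → Matrix (Fin K) (Fin K) ℂ) (C₀ : ℝ)
    (M₂ N₂ M₁ M₀ : HardySpace T K →L[ℂ] HardySpace T K) : Prop where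
  pos_T : 0 < T
  pos_C : 0 < C₀
  mult₂ : IsMultiplier T P₂
  mult₂' : IsMultiplier T fun z => Matrix.of fun k l => deriv (fun w => P₂ w k l) z
  mult₁ : IsMultiplier T P₁
  mult₀ : IsMultiplier T P₀
  apply₂ : ∀ f : HardySpace T K, ∀ z ∈ strip T, M₂ f z = Matrix.toEuclideanLin (P₂ z) (f z)
  apply₂' : ∀ f : HardySpace T K, ∀ z ∈ strip T, N₂ f z =
    Matrix.toEuclideanLin (Matrix.of fun k l => deriv (fun w => P₂ w k l) z) (f z)
  apply₁ : ∀ f : HardySpace T K, ∀ z ∈ strip T, M₁ f z = Matrix.toEuclideanLin (P₁ z) (f z)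
  apply₀ : ∀ f : HardySpace T K, ∀ z ∈ strip T, M₀ f z = Matrix.toEuclideanLin (P₀ z) (f z)
  pos : ∀ z ∈ strip T, ∀ V : EuclideanSpace ℂ (Fin K),
    C₀ * ‖V‖ ^ 2 ≤ (inner ℂ V (Matrix.toEuclideanLin (P₂ z) V)).re

theorem IsRegular.exists_isSymbol {P₂ P₁ P₀ : ℂ → Matrix (Fin K) (Fin K) ℂ}
    (hreg : IsRegular T P₂ P₁ P₀) (hT : 0 < T) {C₀ : ℝ} (hC₀ : 0 < C₀)
    (hpos : ∀ z ∈ closedStrip T, ∀ V : EuclideanSpace ℂ (Fin K),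
      C₀ * ‖V‖ ^ 2 ≤ (inner ℂ V (Matrix.toEuclideanLin (P₂ z) V)).re) :
    ∃ M₂ N₂ M₁ M₀ : HardySpace T K →L[ℂ] HardySpace T K, IsSymbol T P₂ P₁ P₀ C₀ M₂ N₂ M₁ M₀ := by
  have h2 := hreg.coeff₂.isMultiplier_deriv hT one_le_two
  obtain ⟨M₂, hM₂⟩ := hreg.coeff₂.isMultiplier.exists_mulOp hT
  obtain ⟨N₂, hN₂⟩ := h2.exists_mulOp hT
  obtain ⟨M₁, hM₁⟩ := hreg.coeff₁.isMultiplier.exists_mulOp hT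
  obtain ⟨M₀, hM₀⟩ := hreg.coeff₀.isMultiplier.exists_mulOp hT
  exact ⟨M₂, N₂, M₁, M₀, hT, hC₀, hreg.coeff₂.isMultiplier, h2, hreg.coeff₁.isMultiplier,
    hreg.coeff₀.isMultiplier, hM₂, hN₂, hM₁, hM₀,
    fun z hz => hpos z (closedStrip_subset_of_strip hz)⟩

namespace IsSymbol

variable {P₂ P₁ P₀ : ℂ → Matrix (Fin K) (Fin K) ℂ} {C₀ : ℝ}
  {M₂ N₂ M₁ M₀ : HardySpace T K →L[ℂ] HardySpace T K}

theorem deriv_mulOp_eq (h : IsSymbol T P₂ P₁ P₀ C₀ M₂ N₂ M₁ M₀) {f f₁ : HardySpace T K}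
    (hf₁ : ∀ z ∈ strip T, f₁ z = deriv f z) {z : ℂ} (hz : z ∈ strip T) :
    deriv (fun w => Matrix.toEuclideanLin (P₂ w) (deriv f w)) z = deriv (M₂ f₁) z := by
  refine Filter.EventuallyEq.deriv_eq ?_
  filter_upwards [(isOpen_strip T).mem_nhds hz] with w hw
  rw [h.apply₂ _ w hw, hf₁ w hw]

/-- Cauchy–Schwarz applied to coercivity. It allows division by the leading coefficient at the cost
of a factor `C₀⁻¹`. -/
theorem le_norm_apply (h : IsSymbol T P₂ P₁ P₀ C₀ M₂ N₂ M₁ M₀) {z : ℂ} (hz : z ∈ strip T)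
    (V : EuclideanSpace ℂ (Fin K)) : C₀ * ‖V‖ ≤ ‖Matrix.toEuclideanLin (P₂ z) V‖ := by
  rcases eq_or_lt_of_le (norm_nonneg V) with hV | hV
  · rw [← hV, mul_zero]
    exact norm_nonneg _
  · have h1 := (h.pos z hz V).trans ((Complex.re_le_norm _).trans (norm_inner_le_norm _ _))
    refine le_of_mul_le_mul_left ?_ hV
    linarith

/-- The sesquilinear form of the differential operator. -/
theorem inner_diffExpr (h : IsSymbol T P₂ P₁ P₀ C₀ M₂ N₂ M₁ M₀) {f f₁ g : HardySpace T K}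
    (hf₁ : ∀ z ∈ strip T, f₁ z = deriv f z) (hg : ∀ z ∈ strip T, g z = diffExpr P₂ P₁ P₀ f z) :
    inner ℂ f g = inner ℂ f₁ (M₂ f₁) + inner ℂ f (M₁ f₁) + inner ℂ f (M₀ f) := by
  -- The equation itself shows that the derivative of `M₂ f₁` is in the space, so skew-symmetry
  -- applies with no assumption on `f''`.
  have hw : ∀ z ∈ strip T, (M₁ f₁ + M₀ f - g : HardySpace T K) z = deriv (M₂ f₁) z := fun z hz => by
    rw [HardySpace.sub_apply, HardySpace.add_apply, hg z hz, diffExpr, h.deriv_mulOp_eq hf₁ hz,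
      h.apply₁ _ z hz, h.apply₀ _ z hz, hf₁ z hz]
    abel
  have h1 := inner_deriv h.pos_T hf₁ hw
  rw [inner_sub_right, inner_add_right] at h1
  linear_combination -h1

/-- Gårding's inequality. Half of the leading term absorbs the first order term, leaving `‖M₁‖² / (2
C₀)` by completion of the square; the summand `C₀ / 2` pays for `‖f‖²` on the left. -/
theorem re_form_ge (h : IsSymbol T P₂ P₁ P₀ C₀ M₂ N₂ M₁ M₀) (f f₁ : HardySpace T K) :
    C₀ / 2 * (‖f₁‖ ^ 2 + ‖f‖ ^ 2) ≤
      (inner ℂ f₁ (M₂ f₁) + inner ℂ f (M₁ f₁) + inner ℂ f (M₀ f)).re +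
        (C₀ / 2 + ‖M₀‖ + ‖M₁‖ ^ 2 / (2 * C₀)) * ‖f‖ ^ 2 := by
  have h2 := le_re_inner_mulOp h.pos_T h.apply₂ h.pos f₁
  have h1 : -(‖f‖ * (‖M₁‖ * ‖f₁‖)) ≤ (inner ℂ f (M₁ f₁)).re :=
    (abs_le.mp ((Complex.abs_re_le_norm _).trans ((norm_inner_le_norm _ _).trans
      (mul_le_mul_of_nonneg_left (M₁.le_opNorm f₁) (norm_nonneg _))))).1
  have h0 : -(‖f‖ * (‖M₀‖ * ‖f‖)) ≤ (inner ℂ f (M₀ f)).re :=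
    (abs_le.mp ((Complex.abs_re_le_norm _).trans ((norm_inner_le_norm _ _).trans
      (mul_le_mul_of_nonneg_left (M₀.le_opNorm f) (norm_nonneg _))))).1
  have hC := h.pos_C
  have hsq : 0 ≤ (C₀ * ‖f₁‖ - ‖M₁‖ * ‖f‖) ^ 2 / (2 * C₀) := by positivity
  have hexp : (C₀ * ‖f₁‖ - ‖M₁‖ * ‖f‖) ^ 2 / (2 * C₀) =
      C₀ / 2 * ‖f₁‖ ^ 2 - ‖f‖ * (‖M₁‖ * ‖f₁‖) + ‖M₁‖ ^ 2 / (2 * C₀) * ‖f‖ ^ 2 := by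
    field_simp
    ring
  rw [hexp] at hsq
  rw [Complex.add_re, Complex.add_re]
  linarith

/-- Every term is controlled by `‖f₁‖² + ‖f‖²`, the quantity that Gårding's inequality bounds by the
real part; the ratio of the two constants is the slope of the sector. -/
theorem abs_im_form_le (f f₁ : HardySpace T K) :
    |(inner ℂ f₁ (M₂ f₁) + inner ℂ f (M₁ f₁) + inner ℂ f (M₀ f)).im| ≤
      (‖M₂‖ + ‖M₁‖ + ‖M₀‖) * (‖f₁‖ ^ 2 + ‖f‖ ^ 2) := by
  have key : ∀ (M : HardySpace T K →L[ℂ] HardySpace T K) (u v : HardySpace T K),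
      ‖inner ℂ u (M v)‖ ≤ ‖M‖ * (‖u‖ * ‖v‖) := fun M u v =>
    (norm_inner_le_norm _ _).trans ((mul_le_mul_of_nonneg_left (M.le_opNorm v) (norm_nonneg _)).trans_eq
      (mul_left_comm _ _ _))
  refine (Complex.abs_im_le_norm _).trans ((norm_add₃_le).trans ?_)
  have h2 := key M₂ f₁ f₁
  have h1 := key M₁ f f₁
  have h0 := key M₀ f f
  have e2 : ‖f₁‖ * ‖f₁‖ ≤ ‖f₁‖ ^ 2 + ‖f‖ ^ 2 := by nlinarith [sq_nonneg ‖f‖]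
  have e1 : ‖f‖ * ‖f₁‖ ≤ ‖f₁‖ ^ 2 + ‖f‖ ^ 2 := by
    nlinarith [sq_nonneg (‖f‖ - ‖f₁‖), sq_nonneg ‖f‖, sq_nonneg ‖f₁‖]
  have e0 : ‖f‖ * ‖f‖ ≤ ‖f₁‖ ^ 2 + ‖f‖ ^ 2 := by nlinarith [sq_nonneg ‖f₁‖]
  have g2 := mul_le_mul_of_nonneg_left e2 (norm_nonneg M₂)
  have g1 := mul_le_mul_of_nonneg_left e1 (norm_nonneg M₁)
  have g0 := mul_le_mul_of_nonneg_left e0 (norm_nonneg M₀)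
  linarith

/-- Solvability of `(L + c) f = g` in `⊕_K H²`, by the Lax-Milgram argument after conjugation by
`(1 - D²)^{-1/2}`. -/
theorem exists_solution (h : IsSymbol T P₂ P₁ P₀ C₀ M₂ N₂ M₁ M₀) {c : ℂ}
    (hc : C₀ / 2 + ‖M₀‖ + ‖M₁‖ ^ 2 / (2 * C₀) ≤ c.re) :
    ∃ R : HardySpace T K →L[ℂ] HardySpace T K, ∀ g : HardySpace T K,
      (∃ f₁ : HardySpace T K, ∀ z ∈ strip T, f₁ z = deriv (R g) z) ∧
      ∀ z ∈ strip T, diffExpr P₂ P₁ P₀ (R g) z + c • R g z = g z := by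
  have hT := h.pos_T
  have hC := h.pos_C
  have := completeSpace_hardySpace (K := K) hT
  set s : ℤ → ℝ := fun n => Real.sqrt (1 + (n : ℝ) ^ 2) with hs
  have hs2 : ∀ n, s n ^ 2 = 1 + (n : ℝ) ^ 2 := fun n => Real.sq_sqrt (by positivity)
  have hs0 : ∀ n, 0 < s n := fun n => Real.sqrt_pos.mpr (by positivity)
  have hsC : ∀ n, (s n : ℂ) ≠ 0 := fun n => by exact_mod_cast (hs0 n).ne'
  -- `J = (1 - D²)^{-1/2}` and, below, `E = D J` are contractions, the first self-adjoint and the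
  -- second skew-adjoint.
  obtain ⟨J, hJ⟩ := exists_diagOp (K := K) hT (m := fun n => ((s n)⁻¹ : ℂ)) (C := 1) fun n => by
    rw [norm_inv, Complex.norm_real, Real.norm_of_nonneg (hs0 n).le]
    refine inv_le_one_of_one_le₀ ?_
    nlinarith [hs2 n, hs0 n, sq_nonneg (n : ℝ)]
  obtain ⟨E, hE⟩ := exists_diagOp (K := K) hT (m := fun n => Complex.I * n * (s n : ℂ)⁻¹) (C := 1)
    fun n => by
      rw [norm_mul, norm_mul, Complex.norm_I, one_mul, norm_inv, Complex.norm_real,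
        Real.norm_of_nonneg (hs0 n).le, Complex.norm_intCast, ← div_eq_mul_inv, div_le_one (hs0 n)]
      refine abs_le_of_sq_le_sq ?_ (hs0 n).le
      rw [hs2]
      linarith
  have hJadj : ∀ u w : HardySpace T K, inner ℂ u (J w) = inner ℂ (J u) w := fun u w =>
    HardySpace.inner_eq_inner_of_coeff (hJ w) fun n => by
      rw [hJ, map_inv₀, Complex.conj_ofReal]
  have hEadj : ∀ u w : HardySpace T K, inner ℂ u (E w) = -inner ℂ (E u) w := fun u w => by
    rw [← inner_neg_left]
    refine HardySpace.inner_eq_inner_of_coeff (hE w) fun n => ?_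
    have h1 : -(E u) = (-1 : ℂ) • E u := by rw [neg_one_smul]
    rw [h1, HardySpace.coeff_smul, hE, smul_smul]
    congr 1
    simp
  -- The symbols satisfy `(n² + 1) / s² = 1`. Thus Gårding's inequality for `J u` is coercivity in
  -- `u` itself.
  have hnorm : ∀ u : HardySpace T K, ‖E u‖ ^ 2 + ‖J u‖ ^ 2 = ‖u‖ ^ 2 := fun u => by
    refine ((E u).hasSum_norm_sq.add (J u).hasSum_norm_sq).unique ?_
    have h1 : (fun n : ℤ => ‖coeff (E u) n‖ ^ 2 * Real.cosh (2 * n * T) +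
        ‖coeff (J u) n‖ ^ 2 * Real.cosh (2 * n * T)) =
        fun n : ℤ => ‖coeff u n‖ ^ 2 * Real.cosh (2 * n * T) := by
      funext n
      rw [hE, hJ, norm_smul, norm_smul, norm_mul, norm_mul, Complex.norm_I, one_mul, norm_inv,
        Complex.norm_real, Real.norm_of_nonneg (hs0 n).le, Complex.norm_intCast, mul_pow, mul_pow,
        mul_pow, sq_abs, inv_pow, hs2]
      have : (1 + (n : ℝ) ^ 2) ≠ 0 := by positivity
      field_simp
      ring
    rw [h1]
    exact u.hasSum_norm_sq
  -- Formally `B = J (L + c) J`, written with bounded operators only; `f = J u` with `B u = J g` is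
  -- then the solution.
  set B : HardySpace T K →L[ℂ] HardySpace T K :=
    -(E ∘L M₂ ∘L E) + J ∘L M₁ ∘L E + J ∘L M₀ ∘L J + c • (J ∘L J) with hB
  have hBapply : ∀ u, B u = -E (M₂ (E u)) + J (M₁ (E u)) + J (M₀ (J u)) + c • J (J u) :=
    fun u => rfl
  have hBinner : ∀ u, inner ℂ u (B u) = inner ℂ (E u) (M₂ (E u)) + inner ℂ (J u) (M₁ (E u)) +
      inner ℂ (J u) (M₀ (J u)) + c * inner ℂ (J u) (J u) := fun u => by
    rw [hBapply, inner_add_right, inner_add_right, inner_add_right, inner_neg_right, hEadj, hJadj,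
      hJadj, inner_smul_right, hJadj, neg_neg]
  have hcoer : ∀ u, ‖u‖ ^ 2 * (C₀ / 2) ≤ ‖inner ℂ (B u) u‖ := fun u => by
    have h1 := h.re_form_ge (J u) (E u)
    have h2 : (c * inner ℂ (J u) (J u)).re = c.re * ‖J u‖ ^ 2 := by
      rw [inner_self_eq_ofReal_norm_sq, Complex.re_mul_ofReal]
    have h3 := mul_le_mul_of_nonneg_right hc (sq_nonneg ‖J u‖)
    rw [← norm_inner_symm, hBinner]
    refine le_trans ?_ (Complex.re_le_norm _)
    rw [Complex.add_re, h2, ← hnorm u]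
    linarith
  obtain ⟨B', hB'⟩ := ContinuousLinearMap.isUnit_of_forall_le_norm_inner_map B
    (c := Real.toNNReal (C₀ / 2)) (Real.toNNReal_pos.mpr (half_pos hC)) fun u => by
      rw [Real.coe_toNNReal _ (half_pos hC).le]
      exact hcoer u
  refine ⟨J ∘L (↑(B'⁻¹) : HardySpace T K →L[ℂ] HardySpace T K) ∘L J, fun g => ?_⟩
  set u : HardySpace T K := (↑(B'⁻¹) : HardySpace T K →L[ℂ] HardySpace T K) (J g) with hu
  have hBu : B u = J g := by
    rw [hu, ← hB', ← mul_apply_eq_comp, Units.mul_inv]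
    rfl
  change (∃ f₁ : HardySpace T K, ∀ z ∈ strip T, f₁ z = deriv (J u) z) ∧
    ∀ z ∈ strip T, diffExpr P₂ P₁ P₀ (J u) z + c • J u z = g z
  have hf₁ : ∀ z ∈ strip T, E u z = deriv (J u) z := deriv_eq_of_coeff hT fun n => by
    rw [hE, hJ, smul_smul]
  refine ⟨⟨E u, hf₁⟩, fun z hz => ?_⟩
  -- Multiplying the coefficients of `B u = J g` by `s n` cancels one factor `J` and leaves the
  -- differential equation for `J u`.
  have hder : ∀ z ∈ strip T, (M₁ (E u) + M₀ (J u) + c • J u - g : HardySpace T K) z =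
      deriv (M₂ (E u)) z := deriv_eq_of_coeff hT fun n => by
    have h1 : E (M₂ (E u)) = J (M₁ (E u) + M₀ (J u) + c • J u - g) := by
      rw [map_sub, map_add, map_add, map_smul, ← hBu, hBapply]
      abel
    have h2 := congrArg (fun f : HardySpace T K => (s n : ℂ) • coeff f n) h1
    simp only [hE, hJ, smul_smul] at h2
    rw [mul_inv_cancel₀ (hsC n), one_smul, mul_left_comm, mul_inv_cancel₀ (hsC n), mul_one] at h2
    exact h2.symm
  have h1 := hder z hz
  rw [HardySpace.sub_apply, HardySpace.add_apply, HardySpace.add_apply, HardySpace.smul_apply,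
    h.apply₁ _ z hz, h.apply₀ _ z hz, hf₁ z hz] at h1
  rw [diffExpr, h.deriv_mulOp_eq hf₁ hz, ← h1]
  abel

end IsSymbol

/-! ### Bounded derivatives of solutions, by Grönwall's inequality. -/

theorem IsPeriodicAnalytic.exists_norm_le_real (hT : 0 < T) {E : Type*} [NormedAddCommGroup E]
    [NormedSpace ℂ E] {F : ℂ → E} (hF : IsPeriodicAnalytic T F) :
    ∃ C : ℝ, ∀ x : ℝ, ‖F x‖ ≤ C := by
  have hsub : closedStrip (T / 2) ⊆ strip T := fun z hz => ⟨by linarith [hz.1], by linarith [hz.2]⟩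
  obtain ⟨C, -, hC⟩ := exists_norm_le_of_continuousOn_closedStrip
    (hF.analytic.continuousOn.mono hsub)
    fun z hz => hF.periodic z (hsub (closedStrip_subset_of_strip hz))
  exact ⟨C, fun x => hC x (ofReal_mem_strip (by linarith) x)⟩

/-- Solutions of second order equations with bounded coefficients have bounded first derivative in
the strip, by Grönwall's inequality on vertical segments. -/
theorem exists_norm_deriv_le (hT : 0 < T) {E : Type*} [NormedAddCommGroup E] [NormedSpace ℂ E]
    [CompleteSpace E] {v : ℂ → E} (hv : IsPeriodicAnalytic T v) {a : ℝ} (ha : 0 ≤ a)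
    (hode : ∀ z ∈ strip T, ‖deriv (deriv v) z‖ ≤ a * (‖deriv v z‖ + ‖v z‖)) :
    ∃ C : ℝ, ∀ z ∈ strip T, ‖deriv v z‖ ≤ C := by
  obtain ⟨A, hA⟩ := hv.exists_norm_le_real hT
  obtain ⟨B, hB⟩ := hv.deriv.exists_norm_le_real hT
  refine ⟨max A B * Real.exp (T * (1 + 2 * a) * 1), fun z hz => ?_⟩
  let p : ℝ → ℂ := fun t => z.re + t * (z.im * Complex.I)
  have hp : ∀ t : ℝ, HasDerivAt p (z.im * Complex.I) t := fun t => by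
    have h := ((Complex.ofRealCLM.hasDerivAt (x := t)).mul_const (z.im * Complex.I)).const_add
      (z.re : ℂ)
    rw [Complex.ofRealCLM_apply, Complex.ofReal_one, one_mul] at h
    exact h
  have him : |z.im| < T := abs_lt.mpr hz
  have hpm : ∀ t ∈ Set.Icc (0 : ℝ) 1, p t ∈ strip T := fun t ht => by
    have h1 : p t = (z.re : ℂ) + ((t * z.im : ℝ) : ℂ) * Complex.I := by
      simp only [p]
      push_cast
      ring
    rw [h1]
    refine ofReal_add_mul_I_mem_strip ?_ _
    rw [abs_mul, abs_of_nonneg ht.1]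
    exact (mul_le_of_le_one_left (abs_nonneg _) ht.2).trans_lt him
  have hcomp : ∀ {F : ℂ → E}, IsPeriodicAnalytic T F → ∀ t ∈ Set.Icc (0 : ℝ) 1,
      HasDerivAt (fun t => F (p t)) ((z.im * Complex.I) • deriv F (p t)) t := fun {F} hF t ht =>
    HasDerivAt.scomp t (hF.analytic.differentiableAt
      ((isOpen_strip T).mem_nhds (hpm t ht))).hasDerivAt (hp t)
  have hY : ∀ t ∈ Set.Icc (0 : ℝ) 1, HasDerivAt (fun t => (v (p t), deriv v (p t)))
      ((z.im * Complex.I) • deriv v (p t), (z.im * Complex.I) • deriv (deriv v) (p t)) t :=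
    fun t ht => (hcomp hv t ht).prodMk (hcomp hv.deriv t ht)
  have hn : ‖(z.im * Complex.I : ℂ)‖ ≤ T := by
    rw [norm_mul, Complex.norm_I, mul_one, Complex.norm_real]
    exact him.le
  -- The pair `(v, v')` is followed from `Re z` to `z` with speed at most `T`. In the maximum norm
  -- `Y` of the pair, `‖v'‖ ≤ Y` and `‖v''‖ ≤ 2aY`, so `1 + 2a` bounds both components; the initial
  -- value is bounded on the real axis by periodicity.
  have hg := norm_le_gronwallBound_of_norm_deriv_right_le (δ := max A B) (K := T * (1 + 2 * a))
    (ε := 0) (fun t ht => (hY t ht).continuousAt.continuousWithinAt)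
    (fun t ht => (hY t ⟨ht.1, ht.2.le⟩).hasDerivWithinAt) (by
      have h0 : p 0 = (z.re : ℂ) := by simp [p]
      rw [h0, Prod.norm_mk]
      exact max_le_max (hA _) (hB _)) (fun t ht => by
      have hz' := hpm t ⟨ht.1, ht.2.le⟩
      have h1 := hode _ hz'
      have e1 : ‖v (p t)‖ ≤ ‖(v (p t), deriv v (p t))‖ := le_max_left _ _
      have e2 : ‖deriv v (p t)‖ ≤ ‖(v (p t), deriv v (p t))‖ := le_max_right _ _
      set Y := ‖(v (p t), deriv v (p t))‖
      have hY0 : 0 ≤ Y := (norm_nonneg _).trans e1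
      have h2 : ‖deriv (deriv v) (p t)‖ ≤ (1 + 2 * a) * Y := by nlinarith
      have h3 : ‖deriv v (p t)‖ ≤ (1 + 2 * a) * Y := by nlinarith
      rw [add_zero, Prod.norm_mk, norm_smul, norm_smul, mul_assoc]
      exact max_le (mul_le_mul hn h3 (norm_nonneg _) hT.le)
        (mul_le_mul hn h2 (norm_nonneg _) hT.le)) 1 ⟨zero_le_one, le_rfl⟩
  rw [gronwallBound_ε0, sub_zero] at hg
  have h1 : p 1 = z := by simp [p, Complex.re_add_im]
  rw [h1] at hg
  exact (le_max_right _ _).trans hg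

/-! ### The domain and the m-sectoriality of the shifted operator. -/

namespace IsSymbol

variable {P₂ P₁ P₀ : ℂ → Matrix (Fin K) (Fin K) ℂ} {C₀ : ℝ}
  {M₂ N₂ M₁ M₀ : HardySpace T K →L[ℂ] HardySpace T K}

theorem diffExpr_eq (h : IsSymbol T P₂ P₁ P₀ C₀ M₂ N₂ M₁ M₀) {f : ℂ → EuclideanSpace ℂ (Fin K)}
    (hf : IsPeriodicAnalytic T f) {z : ℂ} (hz : z ∈ strip T) :
    diffExpr P₂ P₁ P₀ f z =
      -(Matrix.toEuclideanLin (Matrix.of fun k l => deriv (fun w => P₂ w k l) z) (deriv f z) +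
        Matrix.toEuclideanLin (P₂ z) (deriv (deriv f) z)) +
      Matrix.toEuclideanLin (P₁ z) (deriv f z) + Matrix.toEuclideanLin (P₀ z) (f z) := by
  rw [diffExpr, h.mult₂.deriv_mulVec hf.deriv.analytic hz]

/-- Solutions in `⊕_K H²` of the homogeneous equation have their derivative in `⊕_K H²`. -/
theorem exists_deriv_of_homogeneous (h : IsSymbol T P₂ P₁ P₀ C₀ M₂ N₂ M₁ M₀) {c : ℂ}
    {v : HardySpace T K} (hv : ∀ z ∈ strip T, diffExpr P₂ P₁ P₀ v z + c • v z = 0) :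
    ∃ v₁ : HardySpace T K, ∀ z ∈ strip T, v₁ z = deriv v z := by
  have hC := h.pos_C
  have hp := v.2.isPeriodicAnalytic
  obtain ⟨A, hA0, hA⟩ := h.mult₂'.bounded
  obtain ⟨B, hB0, hB⟩ := h.mult₁.bounded
  obtain ⟨D, hD0, hD⟩ := h.mult₀.bounded
  have hode : ∀ z ∈ strip T, ‖deriv (deriv v) z‖ ≤
      ((A + B + D + ‖c‖) / C₀) * (‖deriv v z‖ + ‖v z‖) := fun z hz => by
    have h1 := hv z hz
    rw [h.diffExpr_eq hp hz] at h1
    have h2 : Matrix.toEuclideanLin (P₂ z) (deriv (deriv v) z) =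
        -Matrix.toEuclideanLin (Matrix.of fun k l => deriv (fun w => P₂ w k l) z) (deriv v z) +
        Matrix.toEuclideanLin (P₁ z) (deriv v z) + Matrix.toEuclideanLin (P₀ z) (v z) + c • v z := by
      rw [← sub_eq_zero, ← neg_eq_zero, ← h1]
      abel
    have h3 := h.le_norm_apply hz (deriv (deriv v) z)
    have h4 := hA z hz (deriv v z)
    have h5 := hB z hz (deriv v z)
    have h6 := hD z hz (v z)
    rw [h2] at h3
    have h7 := h3.trans (norm_add₄_le)
    rw [norm_neg, norm_smul] at h7
    rw [div_mul_eq_mul_div, le_div_iff₀ hC]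
    nlinarith [mul_nonneg hA0 (norm_nonneg (v z)), mul_nonneg hB0 (norm_nonneg (v z)),
      mul_nonneg hD0 (norm_nonneg (deriv v z)), mul_nonneg (norm_nonneg c) (norm_nonneg (deriv v z))]
  obtain ⟨C, hbd⟩ := exists_norm_deriv_le h.pos_T hp (by positivity) hode
  exact hp.deriv.exists_hardy_of_norm_le h.pos_T hbd

theorem diffExpr_sub (h : IsRegular T P₂ P₁ P₀) (f g : HardySpace T K) {z : ℂ}
    (hz : z ∈ strip T) : diffExpr P₂ P₁ P₀ (f - g : HardySpace T K) z =
      diffExpr P₂ P₁ P₀ f z - diffExpr P₂ P₁ P₀ g z := by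
  have h1 : f - g = f + (-1 : ℂ) • g := by rw [neg_one_smul, sub_eq_add_neg]
  rw [h1, diffExpr_add h.coeff₂ _ _ hz, diffExpr_smul, neg_one_smul, sub_eq_add_neg]

/-- Elements of the domain have their derivative in `⊕_K H²`. -/
theorem exists_deriv_of_mem_domain (hreg : IsRegular T P₂ P₁ P₀)
    (h : IsSymbol T P₂ P₁ P₀ C₀ M₂ N₂ M₁ M₀) {f g : HardySpace T K}
    (hg : ∀ z ∈ strip T, g z = diffExpr P₂ P₁ P₀ f z) :
    ∃ f₁ : HardySpace T K, ∀ z ∈ strip T, f₁ z = deriv f z := by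
  -- For this `c` there is a solution `u` of `(L + c) u = (L + c) f` with `u'` in the space, and `f
  -- - u` solves the homogeneous equation.
  set c : ℂ := ((C₀ / 2 + ‖M₀‖ + ‖M₁‖ ^ 2 / (2 * C₀) : ℝ) : ℂ) with hc
  obtain ⟨R, hR⟩ := h.exists_solution (c := c) (by rw [hc, Complex.ofReal_re])
  obtain ⟨⟨u₁, hu₁⟩, hu⟩ := hR (g + c • f)
  set u := R (g + c • f)
  obtain ⟨v₁, hv₁⟩ := h.exists_deriv_of_homogeneous (c := c) (v := f - u) fun z hz => by
    have h1 := hu z hz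
    rw [HardySpace.add_apply, HardySpace.smul_apply, hg z hz] at h1
    rw [diffExpr_sub hreg _ _ hz, HardySpace.sub_apply, smul_sub]
    rw [sub_add_sub_comm, h1, sub_self]
  refine ⟨v₁ + u₁, fun z hz => ?_⟩
  have hd : ∀ w : HardySpace T K, DifferentiableAt ℂ (w : ℂ → _) z := fun w =>
    w.2.analytic.differentiableAt ((isOpen_strip T).mem_nhds hz)
  rw [HardySpace.add_apply, hv₁ z hz, hu₁ z hz, ← deriv_add (hd _) (hd _)]
  congr 1
  funext w
  exact sub_add_cancel (f w) (u w)

theorem mem_domain_iff_deriv_deriv (hreg : IsRegular T P₂ P₁ P₀)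
    (h : IsSymbol T P₂ P₁ P₀ C₀ M₂ N₂ M₁ M₀) (f : HardySpace T K) :
    f ∈ (diffOp hreg).domain ↔
      ∃ g : HardySpace T K, ∀ z ∈ strip T, g z = deriv (deriv f) z := by
  have hT := h.pos_T
  have hp := f.2.isPeriodicAnalytic
  constructor
  · rintro ⟨g, hg⟩
    obtain ⟨f₁, hf₁⟩ := IsSymbol.exists_deriv_of_mem_domain hreg h hg
    refine hp.deriv.deriv.exists_hardy_of_norm_le_norm hT (-N₂ f₁ + M₁ f₁ + M₀ f - g) (C := C₀⁻¹)
      fun z hz => ?_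
    have h1 : Matrix.toEuclideanLin (P₂ z) (deriv (deriv f) z) =
        (-N₂ f₁ + M₁ f₁ + M₀ f - g : HardySpace T K) z := by
      rw [HardySpace.sub_apply, HardySpace.add_apply, HardySpace.add_apply, HardySpace.neg_apply,
        h.apply₂' _ z hz, h.apply₁ _ z hz, h.apply₀ _ z hz, hg z hz, h.diffExpr_eq hp hz, hf₁ z hz]
      abel
    rw [← h1, inv_mul_eq_div, le_div_iff₀' h.pos_C]
    exact h.le_norm_apply hz _
  · rintro ⟨f₂, hf₂⟩
    have hc₁ := hp.coeff_deriv hT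
    have hc₂ : ∀ n, coeff f₂ n = (Complex.I * n) • (Complex.I * n) • coeff f n := fun n => by
      rw [coeff_congr_strip hT hf₂, hp.deriv.coeff_deriv hT, hc₁]
    -- Interpolation between `f` and `f''`: `n² ≤ 1 + n⁴` puts `f'` in the space.
    obtain ⟨f₁, hf₁⟩ := hp.deriv.exists_hardy_of_summable hT (by
      refine Summable.of_nonneg_of_le (fun n => mul_nonneg (sq_nonneg _) (Real.cosh_pos _).le)
        (fun n => ?_) (f.2.summable.add f₂.2.summable)
      rw [hc₁, hc₂, ← add_mul]
      refine mul_le_mul_of_nonneg_right ?_ (Real.cosh_pos _).le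
      rw [norm_smul, norm_smul, norm_smul, norm_mul, Complex.norm_I, one_mul, Complex.norm_intCast]
      nlinarith [sq_nonneg (‖coeff f n‖ * (|(n : ℝ)| ^ 2 - 1)), sq_nonneg (|(n : ℝ)| * ‖coeff f n‖)])
    refine ⟨-(N₂ f₁ + M₂ f₂) + M₁ f₁ + M₀ f, fun z hz => ?_⟩
    rw [h.diffExpr_eq hp hz, HardySpace.add_apply, HardySpace.add_apply, HardySpace.neg_apply,
      HardySpace.add_apply, h.apply₂ _ z hz, h.apply₂' _ z hz, h.apply₁ _ z hz, h.apply₀ _ z hz,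
      hf₁ z hz, hf₂ z hz]

/-- The numerical range of `L + μ` lies in a sector. -/
theorem re_inner_diffOp_ge (hreg : IsRegular T P₂ P₁ P₀)
    (h : IsSymbol T P₂ P₁ P₀ C₀ M₂ N₂ M₁ M₀) (f : (diffOp hreg).domain) :
    ∃ N : ℝ, ‖(f : HardySpace T K)‖ ^ 2 ≤ N ∧
      C₀ / 2 * N ≤ (inner ℂ (f : HardySpace T K) (diffOp hreg f)).re +
        (C₀ / 2 + ‖M₀‖ + ‖M₁‖ ^ 2 / (2 * C₀)) * ‖(f : HardySpace T K)‖ ^ 2 ∧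
      |(inner ℂ (f : HardySpace T K) (diffOp hreg f)).im| ≤ (‖M₂‖ + ‖M₁‖ + ‖M₀‖) * N := by
  have hg : ∀ z ∈ strip T, diffOp hreg f z = diffExpr P₂ P₁ P₀ (f : HardySpace T K) z :=
    fun z hz => diffOp_apply hreg f hz
  obtain ⟨f₁, hf₁⟩ := IsSymbol.exists_deriv_of_mem_domain hreg h hg
  -- `N` is the squared first order Sobolev norm; its existence is all that the sector estimate
  -- needs.
  refine ⟨‖f₁‖ ^ 2 + ‖(f : HardySpace T K)‖ ^ 2, by nlinarith [sq_nonneg ‖f₁‖], ?_, ?_⟩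
  · rw [h.inner_diffExpr hf₁ hg]
    exact h.re_form_ge _ _
  · rw [h.inner_diffExpr hf₁ hg]
    exact abs_im_form_le _ _

theorem inner_shift {H : Type*} [NormedAddCommGroup H] [InnerProductSpace ℂ H] (A : H →ₗ.[ℂ] H)
    (μ : ℝ) (u : (shift A μ).domain) : inner ℂ (u : H) (shift A μ u) =
      inner ℂ (u : H) (A u) + ((μ * ‖(u : H)‖ ^ 2 : ℝ) : ℂ) := by
  have h1 : shift A μ u = A u + (μ : ℂ) • (u : H) := rfl
  rw [h1, inner_add_right, inner_smul_right, inner_self_eq_ofReal_norm_sq, Complex.ofReal_mul]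

/-- The shift `μ` absorbs the negative term of Gårding's inequality. The resulting lower bound gives
the sector, the resolvent bound and uniqueness; existence is `exists_solution` with the constant `μ
+ c`. -/
theorem isMSectorial_shift (hreg : IsRegular T P₂ P₁ P₀)
    (h : IsSymbol T P₂ P₁ P₀ C₀ M₂ N₂ M₁ M₀) {μ : ℝ}
    (hμ : C₀ / 2 + ‖M₀‖ + ‖M₁‖ ^ 2 / (2 * C₀) ≤ μ) : IsMSectorial (shift (diffOp hreg) μ) := by
  have hC := h.pos_C
  have hre : ∀ u : (shift (diffOp hreg) μ).domain, ∃ N : ℝ, ‖(u : HardySpace T K)‖ ^ 2 ≤ N ∧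
      C₀ / 2 * N ≤ (inner ℂ (u : HardySpace T K) (shift (diffOp hreg) μ u)).re ∧
      |(inner ℂ (u : HardySpace T K) (shift (diffOp hreg) μ u)).im| ≤
        (‖M₂‖ + ‖M₁‖ + ‖M₀‖) * N := fun u => by
    obtain ⟨N, h1, h2, h3⟩ := IsSymbol.re_inner_diffOp_ge hreg h u
    refine ⟨N, h1, ?_, ?_⟩
    · rw [inner_shift, Complex.add_re, Complex.ofReal_re]
      refine h2.trans ?_
      gcongr
    · rw [inner_shift, Complex.add_im, Complex.ofReal_im, add_zero]
      exact h3
  -- The slope is the bound for the imaginary part divided by the lower bound `C₀ / 2` for the real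
  -- part; `+ 1` keeps it positive.
  refine ⟨fun c hc => ?_, 2 * (‖M₂‖ + ‖M₁‖ + ‖M₀‖) / C₀ + 1, by positivity, fun u => ?_⟩
  · have hacc : ∀ u : (shift (diffOp hreg) μ).domain, c.re * ‖(u : HardySpace T K)‖ ≤
        ‖shift (diffOp hreg) μ u + c • (u : HardySpace T K)‖ := fun u => by
      obtain ⟨N, h1, h2, -⟩ := hre u
      have h3 : c.re * ‖(u : HardySpace T K)‖ ^ 2 ≤ (inner ℂ (u : HardySpace T K)
          (shift (diffOp hreg) μ u + c • (u : HardySpace T K))).re := by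
        have h4 : (inner ℂ (u : HardySpace T K) (c • (u : HardySpace T K))).re =
            c.re * ‖(u : HardySpace T K)‖ ^ 2 := by
          rw [inner_smul_right, inner_self_eq_ofReal_norm_sq, Complex.re_mul_ofReal]
        rw [inner_add_right, Complex.add_re, h4]
        nlinarith [sq_nonneg ‖(u : HardySpace T K)‖]
      have h4 := h3.trans ((Complex.re_le_norm _).trans (norm_inner_le_norm _ _))
      rcases eq_or_lt_of_le (norm_nonneg (u : HardySpace T K)) with hu | hu
      · rw [← hu, mul_zero]
        exact norm_nonneg _
      · refine le_of_mul_le_mul_left ?_ hu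
        linarith
    obtain ⟨R, hR⟩ := h.exists_solution (c := (μ : ℂ) + c) (by
      rw [Complex.add_re, Complex.ofReal_re]
      linarith)
    have hRdom : ∀ x, R x ∈ (shift (diffOp hreg) μ).domain := fun x =>
      ⟨x - ((μ : ℂ) + c) • R x, fun z hz => by
        rw [HardySpace.sub_apply, HardySpace.smul_apply, ← (hR x).2 z hz, add_sub_cancel_right]⟩
    have hReq : ∀ x, shift (diffOp hreg) μ ⟨R x, hRdom x⟩ + c • R x = x := fun x =>
      HardySpace.ext_strip fun z hz => by
        have h1 : shift (diffOp hreg) μ ⟨R x, hRdom x⟩ =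
          diffOp hreg ⟨R x, hRdom x⟩ + (μ : ℂ) • R x := rfl
        rw [h1, HardySpace.add_apply, HardySpace.add_apply, HardySpace.smul_apply,
          HardySpace.smul_apply, diffOp_apply hreg _ hz, add_assoc, ← add_smul]
        exact (hR x).2 z hz
    refine ⟨R, R.opNorm_le_bound (by positivity) fun x => ?_, fun x y => ⟨?_, ?_⟩⟩
    · have h1 := hacc ⟨R x, hRdom x⟩
      rw [hReq] at h1
      rw [one_div, inv_mul_eq_div, le_div_iff₀' hc]
      exact h1
    · rintro rfl
      exact ⟨hRdom x, hReq x⟩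
    · rintro ⟨hy, hyx⟩
      have h1 := hacc (⟨R x, hRdom x⟩ - ⟨y, hy⟩)
      have h2 : shift (diffOp hreg) μ (⟨R x, hRdom x⟩ - ⟨y, hy⟩) +
          c • ((⟨R x, hRdom x⟩ - ⟨y, hy⟩ : (shift (diffOp hreg) μ).domain) : HardySpace T K) = 0 := by
        rw [LinearPMap.map_sub, Submodule.coe_sub, smul_sub, sub_add_sub_comm, hReq, hyx, sub_self]
      rw [h2, norm_zero, Submodule.coe_sub] at h1
      have h3 : ‖R x - y‖ ≤ 0 := nonpos_of_mul_nonpos_right h1 hc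
      exact sub_eq_zero.mp (norm_le_zero_iff.mp h3)
  · obtain ⟨N, h1, h2, h3⟩ := hre u
    have hN : 0 ≤ N := (sq_nonneg _).trans h1
    refine h3.trans ?_
    have h4 : (‖M₂‖ + ‖M₁‖ + ‖M₀‖) * N =
        2 * (‖M₂‖ + ‖M₁‖ + ‖M₀‖) / C₀ * (C₀ / 2 * N) := by field_simp
    have h5 : 0 ≤ C₀ / 2 * N := by positivity
    rw [h4, add_mul, one_mul]
    have h6 : 2 * (‖M₂‖ + ‖M₁‖ + ‖M₀‖) / C₀ * (C₀ / 2 * N) ≤ 2 * (‖M₂‖ + ‖M₁‖ + ‖M₀‖) / C₀ *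
        (inner ℂ (u : HardySpace T K) (shift (diffOp hreg) μ u)).re :=
      mul_le_mul_of_nonneg_left h2 (by positivity)
    linarith

end IsSymbol

end Hardy

/-! ### From strong to norm holomorphy. -/

/-- A strongly holomorphic locally bounded operator valued function is norm holomorphic. -/
theorem differentiableOn_of_forall_apply {E F : Type*} [NormedAddCommGroup E] [NormedSpace ℂ E]
    [NormedAddCommGroup F] [NormedSpace ℂ F] [CompleteSpace F] {U : Set ℂ} (hU : IsOpen U)
    {Z : ℂ → E →L[ℂ] F} {M : ℝ} (hM : ∀ ζ ∈ U, ‖Z ζ‖ ≤ M)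
    (hZ : ∀ x, DifferentiableOn ℂ (fun ζ => Z ζ x) U) : DifferentiableOn ℂ Z U := by
  intro ζ₀ hζ₀
  refine DifferentiableAt.differentiableWithinAt ?_
  obtain ⟨ε, hε, hball⟩ := Metric.isOpen_iff.mp hU ζ₀ hζ₀
  -- Two Cauchy estimates on circles of radius `r`, starting from points within `r` of `ζ₀`, stay
  -- within `3r`.
  obtain ⟨r, hr, hrε⟩ : ∃ r : ℝ, 0 < r ∧ 3 * r < ε := ⟨ε / 4, by positivity, by linarith⟩
  have hsub : ∀ w, dist w ζ₀ ≤ 3 * r → w ∈ U := fun w hw =>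
    hball (Metric.mem_ball.mpr (hw.trans_lt hrε))
  have hM0 : 0 ≤ M := (norm_nonneg _).trans (hM ζ₀ hζ₀)
  have hd : ∀ x, ∀ w, dist w ζ₀ ≤ 2 * r → ‖deriv (fun ζ => Z ζ x) w‖ ≤ M * ‖x‖ / r :=
    fun x w hw => by
      have hcl : Metric.closedBall w r ⊆ U := fun v hv => hsub v (by
        have := dist_triangle v w ζ₀
        have := Metric.mem_closedBall.mp hv
        linarith)
      refine Complex.norm_deriv_le_of_forall_mem_sphere_norm_le hr
        ((hZ x).diffContOnCl_ball hcl) fun v hv => ?_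
      exact (Z v).le_of_opNorm_le (hM v (hcl (Metric.sphere_subset_closedBall hv))) x
  have hd2 : ∀ x, ∀ w, dist w ζ₀ ≤ r →
      ‖deriv (deriv (fun ζ => Z ζ x)) w‖ ≤ M * ‖x‖ / r / r := fun x w hw => by
    have hle : ∀ v ∈ Metric.closedBall w r, dist v ζ₀ ≤ 2 * r := fun v hv => by
      have := dist_triangle v w ζ₀
      have := Metric.mem_closedBall.mp hv
      linarith
    refine Complex.norm_deriv_le_of_forall_mem_sphere_norm_le hr
      (((hZ x).deriv hU).diffContOnCl_ball fun v hv => hsub v ?_) fun v hv => ?_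
    · linarith [hle v hv]
    · exact hd x v (hle v (Metric.sphere_subset_closedBall hv))
  have hat : ∀ x, ∀ w ∈ U, HasDerivAt (fun ζ => Z ζ x) (deriv (fun ζ => Z ζ x) w) w := fun x w hw =>
    ((hZ x).differentiableAt (hU.mem_nhds hw)).hasDerivAt
  let L : E →L[ℂ] F := LinearMap.mkContinuous
    { toFun := fun x => deriv (fun ζ => Z ζ x) ζ₀
      map_add' := fun x y => by
        simp only [map_add]
        exact ((hat x ζ₀ hζ₀).add (hat y ζ₀ hζ₀)).deriv
      map_smul' := fun c x => by
        simp only [map_smul, RingHom.id_apply]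
        exact ((hat x ζ₀ hζ₀).const_smul c).deriv } (M / r) fun x => by
      refine (hd x ζ₀ (by rw [dist_self]; positivity)).trans_eq ?_
      ring
  -- A second order Taylor estimate whose constant is linear in `‖x‖`, hence an estimate in operator
  -- norm.
  have hquad : ∀ w ∈ Metric.closedBall ζ₀ r,
      ‖Z w - Z ζ₀ - (w - ζ₀) • L‖ ≤ M / r / r * ‖‖w - ζ₀‖ ^ 2‖ := fun w hw => by
    refine ContinuousLinearMap.opNorm_le_bound _ (by positivity) fun x => ?_
    have hconv : Convex ℝ (Metric.closedBall ζ₀ (dist w ζ₀)) := convex_closedBall _ _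
    have hsm : ∀ v ∈ Metric.closedBall ζ₀ (dist w ζ₀), dist v ζ₀ ≤ r := fun v hv =>
      (Metric.mem_closedBall.mp hv).trans (Metric.mem_closedBall.mp hw)
    have hmem : ∀ v ∈ Metric.closedBall ζ₀ (dist w ζ₀), v ∈ U := fun v hv =>
      hsub v (by linarith [hsm v hv])
    have h0 : ζ₀ ∈ Metric.closedBall ζ₀ (dist w ζ₀) := Metric.mem_closedBall_self dist_nonneg
    have h1 : ∀ v ∈ Metric.closedBall ζ₀ (dist w ζ₀),
        ‖deriv (fun ζ => Z ζ x) v - deriv (fun ζ => Z ζ x) ζ₀‖ ≤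
          M * ‖x‖ / r / r * ‖w - ζ₀‖ := fun v hv => by
      refine (hconv.norm_image_sub_le_of_norm_deriv_le (𝕜 := ℂ) (fun u hu => ?_)
        (fun u hu => hd2 x u (hsm u hu)) h0 hv).trans ?_
      · exact ((hZ x).deriv hU).differentiableAt (hU.mem_nhds (hmem u hu))
      · have : ‖v - ζ₀‖ ≤ ‖w - ζ₀‖ := by
          rw [← dist_eq_norm, ← dist_eq_norm]
          exact hv
        gcongr
    have h2 : ∀ v ∈ Metric.closedBall ζ₀ (dist w ζ₀),
        HasDerivWithinAt (fun v => Z v x - (v - ζ₀) • L x)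
          (deriv (fun ζ => Z ζ x) v - L x) (Metric.closedBall ζ₀ (dist w ζ₀)) v := fun v hv => by
      have := (hat x v (hmem v hv)).sub
        (((hasDerivAt_id v).sub_const ζ₀).smul_const (L x))
      rw [one_smul] at this
      exact this.hasDerivWithinAt
    have h3 := hconv.norm_image_sub_le_of_norm_hasDerivWithin_le h2 h1 h0
      (Metric.mem_closedBall.mpr le_rfl)
    have h4 : (Z w - Z ζ₀ - (w - ζ₀) • L) x =
        (Z w x - (w - ζ₀) • L x) - (Z ζ₀ x - (ζ₀ - ζ₀) • L x) := by
      rw [sub_self, zero_smul, sub_zero]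
      change Z w x - Z ζ₀ x - (w - ζ₀) • L x = _
      abel
    rw [h4]
    refine h3.trans_eq ?_
    rw [norm_pow, norm_norm]
    ring
  have hderiv : HasDerivAt Z L ζ₀ := by
    rw [hasDerivAt_iff_isLittleO]
    refine Asymptotics.IsBigO.trans_isLittleO ?_
      (Asymptotics.isLittleO_pow_sub_sub ζ₀ (m := 2) one_lt_two)
    exact Asymptotics.IsBigO.of_bound _ (by
      filter_upwards [Metric.closedBall_mem_nhds ζ₀ hr] with w hw using hquad w hw)
  exact hderiv.differentiableAt

/-! ### Exponentials of dissipative bounded operators. -/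

section Exponential

variable {H : Type*} [NormedAddCommGroup H] [InnerProductSpace ℂ H] [CompleteSpace H]

theorem hasDerivAt_exp_smul_apply (C : H →L[ℂ] H) (x : H) (z : ℂ) :
    HasDerivAt (fun z : ℂ => NormedSpace.exp (z • C) x) (NormedSpace.exp (z • C) (C x)) z := by
  have h := (hasDerivAt_exp_smul_const (𝕂 := ℂ) C z).clm_apply (hasDerivAt_const z x)
  rw [map_zero, add_zero] at h
  exact h

theorem hasDerivAt_exp_ofReal_smul_apply (C : H →L[ℂ] H) (x : H) (t : ℝ) :
    HasDerivAt (fun t : ℝ => NormedSpace.exp ((t : ℂ) • C) x)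
      (NormedSpace.exp ((t : ℂ) • C) (C x)) t := by
  have h := HasDerivAt.scomp t (hasDerivAt_exp_smul_apply C x t) Complex.ofRealCLM.hasDerivAt
  rw [Complex.ofRealCLM_apply, Complex.ofReal_one, one_smul] at h
  exact h

/-- The exponential of a dissipative bounded operator is a contraction. -/
theorem norm_exp_apply_le {C : H →L[ℂ] H} (hC : ∀ x, (inner ℂ x (C x)).re ≤ 0) (x : H) :
    ‖NormedSpace.exp C x‖ ≤ ‖x‖ := by
  let _ := InnerProductSpace.rclikeToReal ℂ H
  have hd : ∀ t : ℝ, HasDerivAt (fun t : ℝ => ‖NormedSpace.exp ((t : ℂ) • C) x‖ ^ 2)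
      (2 * inner ℝ (NormedSpace.exp ((t : ℂ) • C) x) (NormedSpace.exp ((t : ℂ) • C) (C x))) t :=
    fun t => (hasDerivAt_exp_ofReal_smul_apply C x t).norm_sq
  have hanti : Antitone fun t : ℝ => ‖NormedSpace.exp ((t : ℂ) • C) x‖ ^ 2 := by
    refine antitone_of_deriv_nonpos (fun t => (hd t).differentiableAt) fun t => ?_
    rw [(hd t).deriv]
    have hcomm : Commute (NormedSpace.exp ((t : ℂ) • C)) C :=
      (((Commute.refl C).smul_left (t : ℂ)).exp_left)
    have h1 : NormedSpace.exp ((t : ℂ) • C) (C x) = C (NormedSpace.exp ((t : ℂ) • C) x) :=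
      congrArg (fun L : H →L[ℂ] H => L x) hcomm.eq
    rw [h1]
    have h2 : inner ℝ (NormedSpace.exp ((t : ℂ) • C) x) (C (NormedSpace.exp ((t : ℂ) • C) x)) ≤ 0 :=
      hC _
    linarith
  have h := hanti zero_le_one
  simp only [Complex.ofReal_one, one_smul, Complex.ofReal_zero, zero_smul, NormedSpace.exp_zero] at h
  exact (pow_le_pow_iff_left₀ (norm_nonneg _) (norm_nonneg _) two_ne_zero).mp h

/-- Exponentials of commuting dissipative operators. -/
theorem norm_exp_sub_exp_apply_le {C C' : H →L[ℂ] H} (hcomm : Commute C C')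
    (hC : ∀ x, (inner ℂ x (C x)).re ≤ 0) (hC' : ∀ x, (inner ℂ x (C' x)).re ≤ 0) (x : H) :
    ‖NormedSpace.exp C x - NormedSpace.exp C' x‖ ≤ ‖C x - C' x‖ := by
  -- The path `e^{C'} e^{t(C - C')}` joins the two exponentials. By commutation it is the
  -- exponential of `(1 - t) C' + t C`, again dissipative, so its derivative has norm at most `‖(C -
  -- C') x‖`.
  have hd : ∀ t : ℝ, HasDerivAt
      (fun t : ℝ => NormedSpace.exp C' (NormedSpace.exp ((t : ℂ) • (C - C')) x))
      (NormedSpace.exp C' (NormedSpace.exp ((t : ℂ) • (C - C')) ((C - C') x))) t := fun t =>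
    ((NormedSpace.exp C').restrictScalars ℝ).hasFDerivAt.comp_hasDerivAt t
      (hasDerivAt_exp_ofReal_smul_apply (C - C') x t)
  have hexp : ∀ (t : ℝ) (y : H), NormedSpace.exp C' (NormedSpace.exp ((t : ℂ) • (C - C')) y) =
      NormedSpace.exp (C' + (t : ℂ) • (C - C')) y := fun t y => by
    let _ := NormedAlgebra.restrictScalars ℚ ℂ (H →L[ℂ] H)
    rw [NormedSpace.exp_add_of_commute (((hcomm.symm).sub_right (Commute.refl C')).smul_right _)]
    rfl
  have hdiss : ∀ t ∈ Set.Ico (0 : ℝ) 1, ∀ y,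
      (inner ℂ y ((C' + (t : ℂ) • (C - C')) y)).re ≤ 0 := fun t ht y => by
    have h1 : (C' + (t : ℂ) • (C - C')) y = C' y + (t : ℂ) • (C y - C' y) := rfl
    rw [h1, inner_add_right, inner_smul_right, inner_sub_right, Complex.add_re,
      Complex.re_ofReal_mul, Complex.sub_re]
    nlinarith [hC y, hC' y, ht.1, ht.2]
  have h := norm_image_sub_le_of_norm_deriv_le_segment_01' (fun t _ => (hd t).hasDerivWithinAt)
    (C := ‖C x - C' x‖) fun t ht => by
      rw [hexp]
      exact norm_exp_apply_le (hdiss t ht) _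
  rw [hexp, hexp, Complex.ofReal_one, one_smul, Complex.ofReal_zero, zero_smul, add_zero,
    add_sub_cancel] at h
  exact h

theorem norm_exp_apply_sub_le {C : H →L[ℂ] H} (hC : ∀ x, (inner ℂ x (C x)).re ≤ 0) (x : H) :
    ‖NormedSpace.exp C x - x‖ ≤ ‖C x‖ := by
  have h := norm_exp_sub_exp_apply_le (Commute.zero_right C) hC (by simp) x
  simpa using h

end Exponential

/-! ### Cones and sectors in the complex plane. -/

/-- The closed cone `γ |Im ζ| ≤ Re ζ`. -/
def cone (γ : ℝ) : Set ℂ := {ζ | γ * |ζ.im| ≤ ζ.re}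

/-- The open cone `γ |Im ζ| < Re ζ`. -/
def openCone (γ : ℝ) : Set ℂ := {ζ | γ * |ζ.im| < ζ.re}

theorem isOpen_openCone (γ : ℝ) : IsOpen (openCone γ) :=
  isOpen_lt (by fun_prop) Complex.continuous_re

theorem openCone_subset_cone (γ : ℝ) : openCone γ ⊆ cone γ := fun ζ (h : γ * |ζ.im| < ζ.re) => h.le

theorem add_mem_cone {γ : ℝ} (hγ : 0 ≤ γ) {ζ ξ : ℂ} (hζ : ζ ∈ cone γ) (hξ : ξ ∈ cone γ) :
    ζ + ξ ∈ cone γ := by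
  have h := mul_le_mul_of_nonneg_left (abs_add_le ζ.im ξ.im) hγ
  simp only [cone, Set.mem_ofPred_eq, Complex.add_im, Complex.add_re] at *
  linarith

theorem ofReal_mem_cone {γ t : ℝ} (ht : 0 ≤ t) : (t : ℂ) ∈ cone γ := by
  simpa [cone] using ht

theorem sector_subset_openCone {γ : ℝ} (hγ : 0 < γ) : sector (Real.arctan γ⁻¹) ⊆ openCone γ := by
  rintro ζ ⟨h0, harg⟩
  have hlt := harg.trans (Real.arctan_lt_pi_div_two _)
  have hre : 0 < ζ.re := by
    rcases Complex.abs_arg_lt_pi_div_two_iff.mp hlt with h | h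
    · exact h
    · exact absurd h h0
  have h1 := abs_lt.mp harg
  have h2 := abs_lt.mp hlt
  have e1 := Real.tan_lt_tan_of_lt_of_lt_pi_div_two h2.1 (Real.arctan_lt_pi_div_two _) h1.2
  rw [Real.tan_arctan, Complex.tan_arg, div_lt_iff₀ hre] at e1
  have e2 := Real.tan_lt_tan_of_lt_of_lt_pi_div_two
    (by linarith [Real.arctan_lt_pi_div_two γ⁻¹]) h2.2 h1.1
  rw [Real.tan_neg, Real.tan_arctan, Complex.tan_arg, lt_div_iff₀ hre] at e2
  have e3 : |ζ.im| < γ⁻¹ * ζ.re := abs_lt.mpr ⟨by linarith, e1⟩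
  rw [inv_mul_eq_div, lt_div_iff₀' hγ] at e3
  exact e3

/-! ### Limits of semigroups with commuting sectorial generators. -/

section Semigroup

variable {H : Type*} [NormedAddCommGroup H] [InnerProductSpace ℂ H]

/-- For `w` in the numerical range, `Re (ζ w) ≤ (Re ζ - γ |Im ζ|) Re w`, a product of a nonnegative
and a nonpositive factor. -/
theorem re_inner_smul_nonpos_of_mem_cone {G : H →L[ℂ] H} {γ : ℝ} (hγ : 0 < γ)
    (hG : ∀ x, |(inner ℂ x (G x)).im| ≤ -(γ * (inner ℂ x (G x)).re)) {ζ : ℂ} (hζ : ζ ∈ cone γ)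
    (x : H) : (inner ℂ x ((ζ • G) x)).re ≤ 0 := by
  have h1 : (ζ • G) x = ζ • G x := rfl
  rw [h1, inner_smul_right, Complex.mul_re]
  have hre : (inner ℂ x (G x)).re ≤ 0 := by
    have := (abs_nonneg _).trans (hG x)
    nlinarith
  have h2 : -(ζ.im * (inner ℂ x (G x)).im) ≤ |ζ.im| * -(γ * (inner ℂ x (G x)).re) := by
    refine (neg_le_abs _).trans ?_
    rw [abs_mul]
    exact mul_le_mul_of_nonneg_left (hG x) (abs_nonneg _)
  have hζ' : γ * |ζ.im| ≤ ζ.re := hζ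
  nlinarith [mul_nonneg_of_nonpos_of_nonpos hre (sub_nonpos.mpr hζ')]

/-- A commuting sequence of bounded operators with numerical ranges in the sector
`|Im ζ| ≤ -γ Re ζ` which converges on a dense set. -/
structure IsSectorialApprox (γ : ℝ) (G : ℕ → H →L[ℂ] H) (D : Set H) (B : H → H) : Prop where
  pos : 0 < γ
  comm : ∀ n m, Commute (G n) (G m)
  sectorial : ∀ n x, |(inner ℂ x (G n x)).im| ≤ -(γ * (inner ℂ x (G n x)).re)
  dense : Dense D
  tendsto : ∀ x ∈ D, Tendsto (fun n => G n x) atTop (𝓝 (B x))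

namespace IsSectorialApprox

variable {γ : ℝ} {G : ℕ → H →L[ℂ] H} {D : Set H} {B : H → H}

theorem re_inner_le (h : IsSectorialApprox γ G D B) {ζ : ℂ} (hζ : ζ ∈ cone γ) (n : ℕ) (x : H) :
    (inner ℂ x ((ζ • G n) x)).re ≤ 0 :=
  re_inner_smul_nonpos_of_mem_cone h.pos (h.sectorial n) hζ x

variable [CompleteSpace H]

theorem norm_exp_le (h : IsSectorialApprox γ G D B) {ζ : ℂ} (hζ : ζ ∈ cone γ) (n : ℕ) (x : H) :
    ‖NormedSpace.exp (ζ • G n) x‖ ≤ ‖x‖ :=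
  norm_exp_apply_le (h.re_inner_le hζ n) x

/-- Contractivity handles `x - x'`, and the comparison of commuting exponentials handles `x'`. With
`x'` in the dense set and close to `x`, the right side is small, uniformly for bounded `ζ`. -/
theorem norm_exp_sub_exp_le (h : IsSectorialApprox γ G D B) {ζ : ℂ} (hζ : ζ ∈ cone γ) (n m : ℕ)
    (x x' : H) : ‖NormedSpace.exp (ζ • G n) x - NormedSpace.exp (ζ • G m) x‖ ≤
      2 * ‖x - x'‖ + ‖ζ‖ * ‖G n x' - G m x'‖ := by
  have h1 := norm_exp_sub_exp_apply_le (((h.comm n m).smul_left ζ).smul_right ζ)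
    (h.re_inner_le hζ n) (h.re_inner_le hζ m) x'
  have h2 : (ζ • G n) x' - (ζ • G m) x' = ζ • (G n x' - G m x') := (smul_sub _ _ _).symm
  rw [h2, norm_smul] at h1
  have h3 : NormedSpace.exp (ζ • G n) x - NormedSpace.exp (ζ • G m) x =
      NormedSpace.exp (ζ • G n) (x - x') - NormedSpace.exp (ζ • G m) (x - x') +
        (NormedSpace.exp (ζ • G n) x' - NormedSpace.exp (ζ • G m) x') := by
    rw [map_sub, map_sub]
    abel
  rw [h3]
  refine (norm_add_le _ _).trans ?_
  have h4 := norm_sub_le (NormedSpace.exp (ζ • G n) (x - x')) (NormedSpace.exp (ζ • G m) (x - x'))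
  have h5 := h.norm_exp_le hζ n (x - x')
  have h6 := h.norm_exp_le hζ m (x - x')
  linarith

theorem exists_tendsto (h : IsSectorialApprox γ G D B) {ζ : ℂ} (hζ : ζ ∈ cone γ) (x : H) :
    ∃ y, Tendsto (fun n => NormedSpace.exp (ζ • G n) x) atTop (𝓝 y) := by
  refine cauchySeq_tendsto_of_complete (Metric.cauchySeq_iff.mpr fun ε hε => ?_)
  obtain ⟨x', hx', hxx'⟩ := Metric.dense_iff.mp h.dense x (ε / 4) (by positivity)
  obtain ⟨N, hN⟩ := Metric.cauchySeq_iff.mp (h.tendsto x' hxx').cauchySeq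
    (ε / (2 * (‖ζ‖ + 1))) (by positivity)
  refine ⟨N, fun m hm n hn => ?_⟩
  have h1 := h.norm_exp_sub_exp_le hζ m n x x'
  have h2 := hN m hm n hn
  rw [Metric.mem_ball, dist_comm, dist_eq_norm] at hx'
  rw [dist_eq_norm] at h2 ⊢
  have h3 : ‖ζ‖ * ‖G m x' - G n x'‖ ≤ ‖ζ‖ * (ε / (2 * (‖ζ‖ + 1))) := by gcongr
  have h4 : ‖ζ‖ * (ε / (2 * (‖ζ‖ + 1))) ≤ ε / 2 := by
    rw [mul_div_assoc', div_le_div_iff₀ (by positivity) two_pos]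
    nlinarith [norm_nonneg ζ]
  linarith

/-- The limit of the semigroups generated by the approximations. -/
theorem exists_limit (h : IsSectorialApprox γ G D B) : ∃ Z : ℂ → H →L[ℂ] H, ∀ ζ ∈ cone γ, ∀ x,
    Tendsto (fun n => NormedSpace.exp (ζ • G n) x) atTop (𝓝 (Z ζ x)) := by
  have hex : ∀ ζ : ℂ, ∃ L : H →L[ℂ] H, ζ ∈ cone γ → ∀ x,
      Tendsto (fun n => NormedSpace.exp (ζ • G n) x) atTop (𝓝 (L x)) := fun ζ => by
    by_cases hζ : ζ ∈ cone γ
    · choose f hf using h.exists_tendsto hζ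
      exact ⟨continuousLinearMapOfTendsto (fun n => NormedSpace.exp (ζ • G n))
        (tendsto_pi_nhds.mpr hf), fun _ => hf⟩
    · exact ⟨0, fun h => absurd h hζ⟩
  choose Z hZ using hex
  exact ⟨Z, fun ζ hζ => hZ ζ hζ⟩

variable {Z : ℂ → H →L[ℂ] H}

theorem norm_limit_apply_le (h : IsSectorialApprox γ G D B) (hZ : ∀ ζ ∈ cone γ, ∀ x,
    Tendsto (fun n => NormedSpace.exp (ζ • G n) x) atTop (𝓝 (Z ζ x))) {ζ : ℂ} (hζ : ζ ∈ cone γ)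
    (x : H) : ‖Z ζ x‖ ≤ ‖x‖ :=
  le_of_tendsto (hZ ζ hζ x).norm (Eventually.of_forall fun n => h.norm_exp_le hζ n x)

theorem norm_exp_sub_limit_le (h : IsSectorialApprox γ G D B) (hZ : ∀ ζ ∈ cone γ, ∀ x,
    Tendsto (fun n => NormedSpace.exp (ζ • G n) x) atTop (𝓝 (Z ζ x))) {ζ : ℂ} (hζ : ζ ∈ cone γ)
    (n : ℕ) (x : H) {x' : H} (hx' : x' ∈ D) :
    ‖NormedSpace.exp (ζ • G n) x - Z ζ x‖ ≤ 2 * ‖x - x'‖ + ‖ζ‖ * ‖G n x' - B x'‖ :=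
  le_of_tendsto_of_tendsto (tendsto_const_nhds.sub (hZ ζ hζ x)).norm
    (((tendsto_const_nhds.sub (h.tendsto x' hx')).norm.const_mul _).const_add _)
    (Eventually.of_forall fun m => h.norm_exp_sub_exp_le hζ n m x x')

theorem limit_zero (hZ : ∀ ζ ∈ cone γ, ∀ x,
    Tendsto (fun n => NormedSpace.exp (ζ • G n) x) atTop (𝓝 (Z ζ x))) : Z 0 = 1 := by
  ext x
  have h := hZ 0 (by simp [cone]) x
  simp only [zero_smul, NormedSpace.exp_zero] at h
  exact tendsto_nhds_unique h tendsto_const_nhds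

theorem limit_add (h : IsSectorialApprox γ G D B) (hZ : ∀ ζ ∈ cone γ, ∀ x,
    Tendsto (fun n => NormedSpace.exp (ζ • G n) x) atTop (𝓝 (Z ζ x))) {ζ ξ : ℂ} (hζ : ζ ∈ cone γ)
    (hξ : ξ ∈ cone γ) : Z (ζ + ξ) = Z ζ * Z ξ := by
  ext x
  refine tendsto_nhds_unique (hZ _ (add_mem_cone h.pos.le hζ hξ) x) ?_
  have h1 : ∀ n, NormedSpace.exp ((ζ + ξ) • G n) x =
      NormedSpace.exp (ζ • G n) (NormedSpace.exp (ξ • G n) x - Z ξ x) +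
        NormedSpace.exp (ζ • G n) (Z ξ x) := fun n => by
    let _ := NormedAlgebra.restrictScalars ℚ ℂ (H →L[ℂ] H)
    rw [add_smul, NormedSpace.exp_add_of_commute
      (((Commute.refl (G n)).smul_left ζ).smul_right ξ), map_sub, sub_add_cancel]
    rfl
  simp only [h1]
  have h2 : Tendsto (fun n => NormedSpace.exp (ζ • G n) (NormedSpace.exp (ξ • G n) x - Z ξ x))
      atTop (𝓝 0) := by
    refine squeeze_zero_norm (fun n => h.norm_exp_le hζ n _) ?_
    exact tendsto_iff_norm_sub_tendsto_zero.mp (hZ ξ hξ x)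
  simpa using h2.add (hZ ζ hζ (Z ξ x))

theorem differentiableOn_limit (h : IsSectorialApprox γ G D B) (hZ : ∀ ζ ∈ cone γ, ∀ x,
    Tendsto (fun n => NormedSpace.exp (ζ • G n) x) atTop (𝓝 (Z ζ x))) :
    DifferentiableOn ℂ Z (openCone γ) := by
  refine differentiableOn_of_forall_apply (M := 1) (isOpen_openCone γ)
    (fun ζ hζ => ContinuousLinearMap.opNorm_le_bound _ zero_le_one fun x => ?_) fun x => ?_
  · rw [one_mul]
    exact h.norm_limit_apply_le hZ (openCone_subset_cone γ hζ) x
  · have hloc : TendstoLocallyUniformlyOn (fun (n : ℕ) (ζ : ℂ) => NormedSpace.exp (ζ • G n) x)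
        (fun ζ => Z ζ x) atTop (openCone γ) := by
      rw [Metric.tendstoLocallyUniformlyOn_iff]
      intro ε hε ζ₀ _
      refine ⟨openCone γ ∩ Metric.ball ζ₀ 1, inter_mem self_mem_nhdsWithin
        (mem_nhdsWithin_of_mem_nhds (Metric.ball_mem_nhds _ one_pos)), ?_⟩
      obtain ⟨x', hx', hxD⟩ := Metric.dense_iff.mp h.dense x (ε / 4) (by positivity)
      rw [Metric.mem_ball, dist_comm, dist_eq_norm] at hx'
      filter_upwards [Metric.tendsto_nhds.mp (h.tendsto x' hxD) (ε / (2 * (‖ζ₀‖ + 1)))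
        (by positivity)] with n hn ζ hζ
      rw [dist_comm, dist_eq_norm]
      rw [dist_eq_norm] at hn
      have h1 := h.norm_exp_sub_limit_le hZ (openCone_subset_cone γ hζ.1) n x hxD
      have h2 : ‖ζ‖ ≤ ‖ζ₀‖ + 1 := by
        have h3 := Metric.mem_ball.mp hζ.2
        rw [dist_eq_norm] at h3
        have := norm_le_norm_add_norm_sub' ζ ζ₀
        linarith
      have h4 : ‖ζ‖ * ‖G n x' - B x'‖ ≤ (‖ζ₀‖ + 1) * (ε / (2 * (‖ζ₀‖ + 1))) := by gcongr
      have h5 : (‖ζ₀‖ + 1) * (ε / (2 * (‖ζ₀‖ + 1))) = ε / 2 := by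
        field_simp
      linarith
    refine hloc.differentiableOn (Eventually.of_forall fun n ζ _ => ?_) (isOpen_openCone γ)
    exact (hasDerivAt_exp_smul_apply (G n) x ζ).differentiableAt.differentiableWithinAt

theorem norm_limit_sub_le (h : IsSectorialApprox γ G D B) (hZ : ∀ ζ ∈ cone γ, ∀ x,
    Tendsto (fun n => NormedSpace.exp (ζ • G n) x) atTop (𝓝 (Z ζ x))) {ζ : ℂ} (hζ : ζ ∈ cone γ)
    (x : H) {x' : H} (hx' : x' ∈ D) : ‖Z ζ x - x‖ ≤ 2 * ‖x - x'‖ + ‖ζ‖ * ‖B x'‖ := by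
  have h1 : ‖Z ζ x' - x'‖ ≤ ‖ζ‖ * ‖B x'‖ := by
    refine le_of_tendsto_of_tendsto ((hZ ζ hζ x').sub_const x').norm
      ((h.tendsto x' hx').norm.const_mul ‖ζ‖) (Eventually.of_forall fun n => ?_)
    refine (norm_exp_apply_sub_le (h.re_inner_le hζ n) x').trans_eq ?_
    exact norm_smul ζ (G n x')
  have h2 := h.norm_limit_apply_le hZ hζ (x - x')
  have h3 : Z ζ x - x = Z ζ (x - x') - (x - x') + (Z ζ x' - x') := by
    rw [map_sub]
    abel
  rw [h3]
  have h4 := norm_add_le (Z ζ (x - x') - (x - x')) (Z ζ x' - x')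
  have h5 := norm_sub_le (Z ζ (x - x')) (x - x')
  linarith

theorem tendsto_limit (h : IsSectorialApprox γ G D B) (hZ : ∀ ζ ∈ cone γ, ∀ x,
    Tendsto (fun n => NormedSpace.exp (ζ • G n) x) atTop (𝓝 (Z ζ x))) (x : H) :
    Tendsto (fun ζ => Z ζ x) (𝓝[cone γ] 0) (𝓝 x) := by
  rw [Metric.tendsto_nhds]
  intro ε hε
  obtain ⟨x', hx', hxD⟩ := Metric.dense_iff.mp h.dense x (ε / 4) (by positivity)
  rw [Metric.mem_ball, dist_comm, dist_eq_norm] at hx'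
  have hsmall : ∀ᶠ ζ : ℂ in 𝓝[cone γ] 0, ‖ζ‖ * ‖B x'‖ < ε / 2 := by
    have hc : Tendsto (fun ζ : ℂ => ‖ζ‖ * ‖B x'‖) (𝓝 0) (𝓝 0) := by
      have : Continuous fun ζ : ℂ => ‖ζ‖ * ‖B x'‖ := by fun_prop
      simpa using this.tendsto 0
    exact (hc.mono_left nhdsWithin_le_nhds).eventually (gt_mem_nhds (by positivity))
  filter_upwards [self_mem_nhdsWithin, hsmall] with ζ hζ hs
  rw [dist_eq_norm]
  have := h.norm_limit_sub_le hZ hζ x hxD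
  linarith

/-- The mean value inequality for `s ↦ e^{sG_n} x - s B x`, followed by `n → ∞`. Since `B x` need
not lie in `D`, a nearby `x'` in `D` replaces it where `e^{sG_n}` is compared with the identity. -/
theorem norm_limit_sub_sub_le (h : IsSectorialApprox γ G D B) (hZ : ∀ ζ ∈ cone γ, ∀ x,
    Tendsto (fun n => NormedSpace.exp (ζ • G n) x) atTop (𝓝 (Z ζ x))) {t : ℝ} (ht : 0 ≤ t)
    {x x' : H} (hx : x ∈ D) (hx' : x' ∈ D) :
    ‖Z t x - x - (t : ℂ) • B x‖ ≤ t * (2 * ‖B x - x'‖ + t * ‖B x'‖) := by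
  have hlim : Tendsto (fun n => ‖NormedSpace.exp ((t : ℂ) • G n) x - x - (t : ℂ) • B x‖) atTop
      (𝓝 ‖Z t x - x - (t : ℂ) • B x‖) :=
    (((hZ t (ofReal_mem_cone ht) x).sub_const x).sub_const _).norm
  have hlim2 : Tendsto (fun n => (‖G n x - B x‖ + (2 * ‖B x - x'‖ + t * ‖G n x'‖)) * (t - 0)) atTop
      (𝓝 ((0 + (2 * ‖B x - x'‖ + t * ‖B x'‖)) * (t - 0))) :=
    ((tendsto_iff_norm_sub_tendsto_zero.mp (h.tendsto x hx)).add
      (((h.tendsto x' hx').norm.const_mul t).const_add _)).mul_const _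
  rw [zero_add, sub_zero, mul_comm _ t] at hlim2
  refine le_of_tendsto_of_tendsto hlim hlim2 (Eventually.of_forall fun n => ?_)
  have hd : ∀ s : ℝ, HasDerivAt (fun s : ℝ => NormedSpace.exp ((s : ℂ) • G n) x - (s : ℂ) • B x)
      (NormedSpace.exp ((s : ℂ) • G n) (G n x) - B x) s := fun s => by
    have h1 : HasDerivAt (fun s : ℝ => (s : ℂ) • B x) (B x) s := by
      have := (Complex.ofRealCLM.hasDerivAt (x := s)).smul_const (B x)
      rw [Complex.ofRealCLM_apply, Complex.ofReal_one, one_smul] at this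
      exact this
    exact (hasDerivAt_exp_ofReal_smul_apply (G n) x s).sub h1
  have hmv := norm_image_sub_le_of_norm_deriv_le_segment' (a := 0) (b := t)
    (fun s _ => (hd s).hasDerivWithinAt)
    (C := ‖G n x - B x‖ + (2 * ‖B x - x'‖ + t * ‖G n x'‖)) (fun s hs => by
      have hc : (s : ℂ) ∈ cone γ := ofReal_mem_cone hs.1
      have e1 := h.norm_exp_le hc n (G n x - B x)
      have e2 := h.norm_exp_le hc n (B x - x')
      have e3 := norm_exp_apply_sub_le (h.re_inner_le hc n) x'
      have e4 : ‖((s : ℂ) • G n) x'‖ = s * ‖G n x'‖ := by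
        rw [_root_.smul_apply, norm_smul, Complex.norm_real, Real.norm_of_nonneg hs.1]
      have e5 : s * ‖G n x'‖ ≤ t * ‖G n x'‖ := by
        have := hs.2.le
        gcongr
      have e6 : NormedSpace.exp ((s : ℂ) • G n) (G n x) - B x =
          NormedSpace.exp ((s : ℂ) • G n) (G n x - B x) +
          (NormedSpace.exp ((s : ℂ) • G n) (B x - x') +
          ((NormedSpace.exp ((s : ℂ) • G n) x' - x') - (B x - x'))) := by
        rw [map_sub, map_sub]
        abel
      rw [e6]
      refine (norm_add_le _ _).trans (add_le_add e1 ((norm_add_le _ _).trans ?_))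
      have e7 := norm_sub_le (NormedSpace.exp ((s : ℂ) • G n) x' - x') (B x - x')
      linarith) t ⟨ht, le_rfl⟩
  rw [Complex.ofReal_zero, zero_smul, zero_smul, NormedSpace.exp_zero, sub_zero, sub_zero] at hmv
  refine (le_of_eq ?_).trans hmv
  exact congrArg norm (sub_right_comm _ _ _)

theorem tendsto_limit_quotient (h : IsSectorialApprox γ G D B) (hZ : ∀ ζ ∈ cone γ, ∀ x,
    Tendsto (fun n => NormedSpace.exp (ζ • G n) x) atTop (𝓝 (Z ζ x))) {x : H} (hx : x ∈ D) :
    Tendsto (fun t : ℝ => ((t : ℂ)⁻¹) • (Z t x - x)) (𝓝[>] 0) (𝓝 (B x)) := by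
  rw [Metric.tendsto_nhds]
  intro ε hε
  obtain ⟨x', hx', hxD⟩ := Metric.dense_iff.mp h.dense (B x) (ε / 4) (by positivity)
  rw [Metric.mem_ball, dist_comm, dist_eq_norm] at hx'
  have hsmall : ∀ᶠ t : ℝ in 𝓝[>] 0, t * ‖B x'‖ < ε / 2 := by
    have hc : Tendsto (fun t : ℝ => t * ‖B x'‖) (𝓝 0) (𝓝 0) := by
      have : Continuous fun t : ℝ => t * ‖B x'‖ := by fun_prop
      simpa using this.tendsto 0
    exact (hc.mono_left nhdsWithin_le_nhds).eventually (gt_mem_nhds (by positivity))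
  filter_upwards [self_mem_nhdsWithin, hsmall] with t ht hs
  have ht0 : 0 < t := ht
  have htC : (t : ℂ) ≠ 0 := by exact_mod_cast ht0.ne'
  have h1 := h.norm_limit_sub_sub_le hZ ht0.le hx hxD
  have h2 : ((t : ℂ)⁻¹) • (Z t x - x) - B x = ((t : ℂ)⁻¹) • (Z t x - x - (t : ℂ) • B x) := by
    rw [smul_sub _ (Z t x - x), inv_smul_smul₀ htC]
  rw [dist_eq_norm, h2, norm_smul, norm_inv, Complex.norm_real, Real.norm_of_nonneg ht0.le,
    inv_mul_lt_iff₀ ht0]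
  refine h1.trans_lt ?_
  gcongr
  linarith

end IsSectorialApprox

/-! ### Yosida approximation and generation of the semigroup. -/

/-- The Yosida approximations of an m-sectorial operator. -/
theorem IsMSectorial.exists_isSectorialApprox [CompleteSpace H] {A : H →ₗ.[ℂ] H}
    (hA : IsMSectorial A) : ∃ γ : ℝ, ∃ G : ℕ → H →L[ℂ] H, ∃ B : H → H,
      (∀ x (hx : x ∈ A.domain), B x = -A ⟨x, hx⟩) ∧ IsSectorialApprox γ G A.domain B := by
  classical
  obtain ⟨hacc, γ, hγ, hsec⟩ := hA
  have hcpos : ∀ n : ℕ, 0 < (((n : ℝ) + 1 : ℝ) : ℂ).re := fun n => by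
    rw [Complex.ofReal_re]
    positivity
  choose R hRn hR using fun n : ℕ => hacc (((n : ℝ) + 1 : ℝ) : ℂ) (hcpos n)
  set c : ℕ → ℂ := fun n => (((n : ℝ) + 1 : ℝ) : ℂ) with hc
  have hmem : ∀ n x, R n x ∈ A.domain := fun n x => ((hR n x _).mp rfl).choose
  have hAR : ∀ n x, A ⟨R n x, hmem n x⟩ = x - c n • R n x := fun n x =>
    eq_sub_of_add_eq ((hR n x _).mp rfl).choose_spec
  have hRA : ∀ n x (hx : x ∈ A.domain), R n (A ⟨x, hx⟩) = x - c n • R n x := fun n x hx => by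
    have h1 : R n (A ⟨x, hx⟩ + c n • x) = x := (hR n _ _).mpr ⟨hx, rfl⟩
    rw [map_add, map_smul] at h1
    exact eq_sub_of_add_eq h1
  have hresolvent : ∀ n m x, R m x - R n x = (c n - c m) • R n (R m x) := fun n m x => by
    have h1 := hRA n (R m x) (hmem m x)
    rw [hAR, map_sub, map_smul] at h1
    rw [sub_eq_sub_iff_add_eq_add] at h1
    rw [sub_smul, sub_eq_sub_iff_add_eq_add, ← h1, add_comm]
  have hcomm : ∀ n m, Commute (R n) (R m) := fun n m => by
    rcases eq_or_ne n m with rfl | hnm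
    · exact Commute.refl _
    · have hne : c n - c m ≠ 0 := by
        rw [sub_ne_zero, hc]
        intro h
        have : (n : ℝ) + 1 = m + 1 := Complex.ofReal_injective h
        exact hnm (by exact_mod_cast add_right_cancel this)
      ext x
      have h1 := hresolvent n m x
      have h2 := hresolvent m n x
      rw [← neg_sub, h2, ← neg_smul, neg_sub] at h1
      exact (smul_right_injective H hne h1).symm
  have hdense : Dense (A.domain : Set H) := by
    -- If `v` is orthogonal to the domain and `r = (A + 1)⁻¹ v`, then `0 = Re ⟨r, v⟩ = Re ⟨r, A r⟩ +
    -- ‖r‖²`, so `r = 0` and `v = 0`.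
    rw [Submodule.dense_iff_topologicalClosure_eq_top, Submodule.topologicalClosure_eq_top_iff,
      Submodule.eq_bot_iff]
    intro v hv
    have h1 := hv (R 0 v) (hmem 0 v)
    have hc0 : c 0 = 1 := by simp [hc]
    have h2 : v = A ⟨R 0 v, hmem 0 v⟩ + R 0 v := by rw [hAR, hc0, one_smul, sub_add_cancel]
    set r := R 0 v with hr
    have h1 : inner ℂ r (A ⟨r, hmem 0 v⟩ + r) = 0 := h2 ▸ h1
    rw [inner_add_right] at h1
    have h3 := (abs_nonneg _).trans (hsec ⟨r, hmem 0 v⟩)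
    have h4 := congrArg Complex.re h1
    have h5 : (inner ℂ r r).re = ‖r‖ ^ 2 := inner_self_eq_norm_sq (𝕜 := ℂ) _
    rw [Complex.add_re, h5, Complex.zero_re] at h4
    have h6 : 0 ≤ (inner ℂ r (A ⟨r, hmem 0 v⟩)).re := nonneg_of_mul_nonneg_right h3 hγ
    have h7 : ‖r‖ = 0 := by nlinarith [sq_nonneg ‖r‖]
    have h8 : r = 0 := norm_eq_zero.mp h7
    obtain ⟨hy, h9⟩ := (hR 0 v 0).mp h8
    have h10 : A ⟨0, hy⟩ = 0 := A.map_zero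
    rw [h10, smul_zero, add_zero] at h9
    exact h9.symm
  have hcn : ∀ n, ‖c n‖ = (n : ℝ) + 1 := fun n => by
    rw [hc, Complex.norm_real, Real.norm_of_nonneg (by positivity)]
  have hRb : ∀ n x, ‖R n x‖ ≤ (1 / ((n : ℝ) + 1)) * ‖x‖ := fun n x =>
    (R n).le_of_opNorm_le (by simpa [hc] using hRn n) x
  have hcRb : ∀ n x, ‖c n • R n x‖ ≤ ‖x‖ := fun n x => by
    rw [norm_smul, hcn]
    have := hRb n x
    have hp : (0 : ℝ) < (n : ℝ) + 1 := by positivity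
    rw [one_div, inv_mul_eq_div, le_div_iff₀' hp] at this
    exact this
  have hinv : Tendsto (fun n : ℕ => 1 / ((n : ℝ) + 1)) atTop (𝓝 0) :=
    tendsto_one_div_add_atTop_nhds_zero_nat
  have hcR : ∀ x, Tendsto (fun n => c n • R n x) atTop (𝓝 x) := fun x => by
    rw [Metric.tendsto_nhds]
    intro ε hε
    obtain ⟨x', hx', hxD⟩ := Metric.dense_iff.mp hdense x (ε / 4) (by positivity)
    rw [Metric.mem_ball, dist_comm, dist_eq_norm] at hx'
    have h0 : Tendsto (fun n : ℕ => 1 / ((n : ℝ) + 1) * ‖A ⟨x', hxD⟩‖) atTop (𝓝 0) := by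
      simpa using hinv.mul_const ‖A ⟨x', hxD⟩‖
    filter_upwards [h0.eventually (gt_mem_nhds (half_pos hε))] with n hn
    have h1 : c n • R n x - x = c n • R n (x - x') - (x - x') - R n (A ⟨x', hxD⟩) := by
      rw [hRA, map_sub, smul_sub]
      abel
    rw [dist_eq_norm, h1]
    have h2 := norm_sub_le (c n • R n (x - x') - (x - x')) (R n (A ⟨x', hxD⟩))
    have h3 := norm_sub_le (c n • R n (x - x')) (x - x')
    have h4 := hcRb n (x - x')
    have h5 := hRb n (A ⟨x', hxD⟩)
    linarith
  set G : ℕ → H →L[ℂ] H := fun n => c n • (c n • R n - 1) with hG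
  have hGA : ∀ n x, G n x = -(c n • A ⟨R n x, hmem n x⟩) := fun n x => by
    rw [hAR, ← smul_neg, neg_sub]
    rfl
  refine ⟨γ, G, fun x => if hx : x ∈ A.domain then -A ⟨x, hx⟩ else 0, fun x hx => dif_pos hx,
    hγ, fun n m => ?_, fun n x => ?_, hdense, fun x hx => ?_⟩
  · have h1 : Commute (c n • R n - 1) (c m • R m - 1) :=
      ((((hcomm n m).smul_left _).smul_right _).sub_left (Commute.one_left _)).sub_right
        (Commute.one_right _)
    exact (h1.smul_left _).smul_right _
  · have h1 := hsec ⟨R n x, hmem n x⟩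
    set r := R n x with hr
    set a := A ⟨r, hmem n x⟩ with ha
    have hx : x = a + c n • r := by rw [ha, hAR, sub_add_cancel]
    -- With `x = a + c r` and `G x = -c a`, the value is `-c ‖a‖² - c² ⟨r, a⟩`: a nonpositive number
    -- plus a point of the reflected sector.
    have h2 : inner ℂ x (G n x) = -((((n : ℝ) + 1) * ‖a‖ ^ 2 : ℝ) : ℂ) -
        ((((n : ℝ) + 1) ^ 2 : ℝ) : ℂ) * inner ℂ r a := by
      have h3 : inner ℂ x (G n x) = -(c n * inner ℂ (a + c n • r) a) := by
        rw [hGA, inner_neg_right, inner_smul_right, ← hx]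
      rw [h3, inner_add_left, inner_smul_left, inner_self_eq_ofReal_norm_sq, hc, Complex.conj_ofReal]
      push_cast
      ring
    have hn : (0 : ℝ) < (n : ℝ) + 1 := by positivity
    have him : (inner ℂ x (G n x)).im = -(((n : ℝ) + 1) ^ 2 * (inner ℂ r a).im) := by
      rw [h2, Complex.sub_im, Complex.neg_im, Complex.ofReal_im, Complex.im_ofReal_mul]
      ring
    have hre : (inner ℂ x (G n x)).re =
        -(((n : ℝ) + 1) * ‖a‖ ^ 2) - ((n : ℝ) + 1) ^ 2 * (inner ℂ r a).re := by
      rw [h2, Complex.sub_re, Complex.neg_re, Complex.ofReal_re, Complex.re_ofReal_mul]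
    rw [him, hre, abs_neg, abs_mul, abs_of_nonneg (sq_nonneg _)]
    have h3 := mul_le_mul_of_nonneg_left h1 (sq_nonneg ((n : ℝ) + 1))
    have h4 : 0 ≤ γ * (((n : ℝ) + 1) * ‖a‖ ^ 2) := by positivity
    linarith
  · have hB : (if hx : x ∈ A.domain then -A ⟨x, hx⟩ else 0) = -A ⟨x, hx⟩ := dif_pos hx
    rw [hB]
    have h1 : ∀ n, G n x = -(c n • R n (A ⟨x, hx⟩)) := fun n => by
      rw [hGA, hRA, hAR]
    simp only [h1]
    exact (hcR _).neg

/-- An m-sectorial operator is minus the generator of a holomorphic contraction semigroup. -/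
theorem IsMSectorial.exists_semigroup [CompleteSpace H] {A : H →ₗ.[ℂ] H}
    (hA : IsMSectorial A) : ∃ γ : ℝ, 0 < γ ∧ ∃ Z : ℂ → H →L[ℂ] H,
      DifferentiableOn ℂ Z (openCone γ) ∧ Z 0 = 1 ∧
      (∀ ζ ∈ cone γ, ∀ ξ ∈ cone γ, Z (ζ + ξ) = Z ζ * Z ξ) ∧
      (∀ x, Tendsto (fun ζ => Z ζ x) (𝓝[cone γ] 0) (𝓝 x)) ∧
      ∀ x y, (∃ hx : x ∈ A.domain, -A ⟨x, hx⟩ = y) ↔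
        Tendsto (fun t : ℝ => ((t : ℂ)⁻¹) • (Z t x - x)) (𝓝[>] 0) (𝓝 y) := by
  obtain ⟨γ, G, B, hB, hG⟩ := hA.exists_isSectorialApprox
  obtain ⟨Z, hZ⟩ := hG.exists_limit
  have hgen : ∀ x (hx : x ∈ A.domain),
      Tendsto (fun t : ℝ => ((t : ℂ)⁻¹) • (Z t x - x)) (𝓝[>] 0) (𝓝 (-A ⟨x, hx⟩)) := fun x hx => by
    rw [← hB x hx]
    exact hG.tendsto_limit_quotient hZ hx
  refine ⟨γ, hG.pos, Z, hG.differentiableOn_limit hZ, IsSectorialApprox.limit_zero hZ,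
    fun ζ hζ ξ hξ => hG.limit_add hZ hζ hξ, hG.tendsto_limit hZ, fun x y => ⟨?_, fun hy => ?_⟩⟩
  · rintro ⟨hx, rfl⟩
    exact hgen x hx
  -- Take `w` in the domain with `(A + 1) w = x - y`. The difference quotients of `x - w` tend to `x
  -- - w` itself; contractivity makes their real inner product with `x - w` nonpositive, so `x = w`.
  · obtain ⟨R, -, hR⟩ := hA.1 1 (by simp)
    obtain ⟨hw, hwe⟩ := (hR (x - y) _).mp rfl
    set w := R (x - y)
    have h1 := hy.sub (hgen w hw)
    have h2 : y - -A ⟨w, hw⟩ = x - w := by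
      rw [one_smul] at hwe
      rw [sub_neg_eq_add, ← sub_eq_iff_eq_add.mpr hwe.symm]
      abel
    have h3 : ∀ t : ℝ, ((t : ℂ)⁻¹) • (Z t x - x) - ((t : ℂ)⁻¹) • (Z t w - w) =
        ((t : ℂ)⁻¹) • (Z t (x - w) - (x - w)) := fun t => by
      rw [← smul_sub, map_sub]
      congr 1
      abel
    simp only [h3, h2] at h1
    have h4 : Tendsto (fun t : ℝ => (inner ℂ (x - w) (((t : ℂ)⁻¹) • (Z t (x - w) - (x - w)))).re)
        (𝓝[>] 0) (𝓝 (inner ℂ (x - w) (x - w)).re) :=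
      (Complex.continuous_re.tendsto _).comp (tendsto_const_nhds.inner h1)
    have h5 : (inner ℂ (x - w) (x - w)).re = ‖x - w‖ ^ 2 := inner_self_eq_norm_sq (𝕜 := ℂ) _
    have h6 : ‖x - w‖ ^ 2 ≤ 0 := by
      rw [← h5]
      refine le_of_tendsto h4 ?_
      filter_upwards [self_mem_nhdsWithin] with t ht
      have ht0 : 0 < t := ht
      rw [inner_smul_right, ← Complex.ofReal_inv, Complex.re_ofReal_mul, inner_sub_right,
        Complex.sub_re, h5]
      have h7 : (inner ℂ (x - w) (Z t (x - w))).re ≤ ‖x - w‖ * ‖x - w‖ :=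
        (Complex.re_le_norm _).trans ((norm_inner_le_norm _ _).trans (mul_le_mul_of_nonneg_left
          (hG.norm_limit_apply_le hZ (ofReal_mem_cone ht0.le) _) (norm_nonneg _)))
      exact mul_nonpos_of_nonneg_of_nonpos (inv_nonneg.mpr ht0.le) (by linarith)
    have h8 : ‖x - w‖ = 0 := by nlinarith [sq_nonneg ‖x - w‖]
    have h9 : x = w := sub_eq_zero.mp (norm_eq_zero.mp h8)
    have h10 : x ∈ A.domain := h9 ▸ hw
    refine ⟨h10, tendsto_nhds_unique (hgen x h10) hy⟩

/-- The product rule at `t = 0`; the converse is the same rule with `-μ`. -/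
theorem tendsto_quotient_exp_smul_iff {Z : ℝ → H →L[ℂ] H} (x y : H) (μ : ℝ) :
    Tendsto (fun t : ℝ => ((t : ℂ)⁻¹) • (Complex.exp (μ * t) • Z t x - x)) (𝓝[>] 0) (𝓝 y) ↔
      Tendsto (fun t : ℝ => ((t : ℂ)⁻¹) • (Z t x - x)) (𝓝[>] 0) (𝓝 (y - (μ : ℂ) • x)) := by
  have hofReal : Tendsto (fun t : ℝ => (t : ℂ)) (𝓝[>] 0) (𝓝[≠] 0) := by
    refine tendsto_nhdsWithin_iff.mpr ⟨?_, ?_⟩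
    · exact (Complex.continuous_ofReal.tendsto' 0 0 Complex.ofReal_zero).mono_left nhdsWithin_le_nhds
    · filter_upwards [self_mem_nhdsWithin] with t ht
      have ht0 : 0 < t := ht
      simpa using ht0.ne'
  have key : ∀ ν : ℝ, Tendsto (fun t : ℝ => Complex.exp (ν * t)) (𝓝[>] 0) (𝓝 1) ∧
      Tendsto (fun t : ℝ => (t : ℂ)⁻¹ * (Complex.exp (ν * t) - 1)) (𝓝[>] 0) (𝓝 ν) := fun ν => by
    constructor
    · have hc : Continuous fun t : ℝ => Complex.exp (ν * t) := by fun_prop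
      exact (hc.tendsto' 0 1 (by simp)).mono_left nhdsWithin_le_nhds
    · have hd : HasDerivAt (fun z : ℂ => Complex.exp (ν * z)) ν 0 := by
        simpa using ((hasDerivAt_id (0 : ℂ)).const_mul (ν : ℂ)).cexp
      have := (hasDerivAt_iff_tendsto_slope_zero.mp hd).comp hofReal
      refine this.congr fun t => ?_
      simp
  have hmul : ∀ (ν : ℝ) (u : ℝ → H) (v : H),
      Tendsto (fun t : ℝ => ((t : ℂ)⁻¹) • (u t - x)) (𝓝[>] 0) (𝓝 v) →
      Tendsto (fun t : ℝ => ((t : ℂ)⁻¹) • (Complex.exp (ν * t) • u t - x)) (𝓝[>] 0)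
        (𝓝 (v + (ν : ℂ) • x)) := fun ν u v h => by
    have h1 := ((key ν).1.smul h).add ((key ν).2.smul_const x)
    rw [one_smul] at h1
    refine h1.congr fun t => ?_
    rw [smul_comm, mul_smul, ← smul_add]
    congr 1
    rw [sub_smul, one_smul, smul_sub]
    abel
  constructor
  · intro h
    have h1 := hmul (-μ) (fun t => Complex.exp (μ * t) • Z t x) y h
    have h2 : y + ((-μ : ℝ) : ℂ) • x = y - (μ : ℂ) • x := by
      rw [Complex.ofReal_neg, neg_smul, sub_eq_add_neg]
    rw [h2] at h1
    refine h1.congr fun t => ?_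
    rw [smul_smul, ← Complex.exp_add, Complex.ofReal_neg, neg_mul, neg_add_cancel, Complex.exp_zero,
      one_smul]
  · intro h
    have h1 := hmul μ (fun t => Z t x) _ h
    rwa [sub_add_cancel] at h1

/-- If a shift of `A` is m-sectorial, then `-A` generates a holomorphic semigroup. -/
theorem exists_isHolomorphicSemigroup_of_shift [CompleteSpace H] {A : H →ₗ.[ℂ] H} {μ : ℝ}
    (hA : IsMSectorial (shift A μ)) :
    ∃ S : ℝ → H →L[ℂ] H, IsHolomorphicSemigroup S ∧ IsGenerator (-A) S := by
  obtain ⟨γ, hγ, Z, hdiff, hzero, hadd, htend, hgen⟩ := hA.exists_semigroup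
  -- As `-A = -(A + μ) + μ`, the factor `e^{μζ}` undoes the shift.
  set W : ℂ → H →L[ℂ] H := fun ζ => Complex.exp (μ * ζ) • Z ζ with hW
  have hWadd : ∀ ζ ∈ cone γ, ∀ ξ ∈ cone γ, W (ζ + ξ) = W ζ * W ξ := fun ζ hζ ξ hξ => by
    simp only [hW]
    rw [hadd ζ hζ ξ hξ, mul_add, Complex.exp_add, smul_mul_smul_comm]
  have hWtend : ∀ x, Tendsto (fun ζ => W ζ x) (𝓝[cone γ] 0) (𝓝 x) := fun x => by
    have hc : Continuous fun ζ : ℂ => Complex.exp (μ * ζ) := by fun_prop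
    have h1 := ((hc.tendsto' 0 1 (by simp)).mono_left (nhdsWithin_le_nhds (s := cone γ))).smul
      (htend x)
    rwa [one_smul] at h1
  have hsec := sector_subset_openCone hγ
  have hsec' : sector (Real.arctan γ⁻¹) ⊆ cone γ := hsec.trans (openCone_subset_cone γ)
  refine ⟨fun t => W t, ⟨⟨?_, fun s t hs ht => ?_, fun x => ?_⟩,
    Real.arctan γ⁻¹, Real.arctan_pos.mpr (inv_pos.mpr hγ), Real.arctan_lt_pi_div_two _, W,
    ?_, fun t _ => rfl, fun ζ hζ ξ hξ => hWadd ζ (hsec' hζ) ξ (hsec' hξ),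
    fun x => (hWtend x).mono_left (nhdsWithin_mono _ hsec')⟩, fun x y => ?_⟩
  · simp [hW, hzero]
  · simp only [Complex.ofReal_add]
    exact hWadd s (ofReal_mem_cone hs) t (ofReal_mem_cone ht)
  · refine (hWtend x).comp (tendsto_nhdsWithin_iff.mpr ⟨?_, ?_⟩)
    · exact (Complex.continuous_ofReal.tendsto' 0 0 Complex.ofReal_zero).mono_left nhdsWithin_le_nhds
    · filter_upwards [self_mem_nhdsWithin] with t ht
      exact ofReal_mem_cone (le_of_lt ht)
  · have he : Differentiable ℂ fun ζ : ℂ => Complex.exp (μ * ζ) := by fun_prop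
    exact (he.differentiableOn.smul hdiff).mono hsec
  · refine Iff.trans ?_ (tendsto_quotient_exp_smul_iff (Z := fun t : ℝ => Z t) x y μ).symm
    rw [← hgen x]
    refine exists_congr fun hx => ?_
    have h1 : shift A μ ⟨x, hx⟩ = A ⟨x, hx⟩ + (μ : ℂ) • x := rfl
    have h2 : (-A) ⟨x, hx⟩ = -(A ⟨x, hx⟩) := rfl
    rw [h1, h2, neg_add, ← sub_eq_add_neg, sub_left_inj]

end Semigroup

end PeriodicHardy

theorem mainTheorem4 (T : ℝ) (hT : 0 < T) (K : ℕ)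
    (P₂ P₁ P₀ : ℂ → Matrix (Fin K) (Fin K) ℂ)
    (hreg : PeriodicHardy.IsRegular T P₂ P₁ P₀)
    (C₀ : ℝ) (hC₀ : 0 < C₀)
    (hpos : ∀ z ∈ PeriodicHardy.closedStrip T, ∀ V : EuclideanSpace ℂ (Fin K),
      C₀ * ‖V‖ ^ 2 ≤ (inner ℂ V (Matrix.toEuclideanLin (P₂ z) V)).re) :
    (∀ f : PeriodicHardy.HardySpace T K, f ∈ (PeriodicHardy.diffOp hreg).domain ↔
      ∃ g : PeriodicHardy.HardySpace T K, ∀ z ∈ PeriodicHardy.strip T, g z = deriv (deriv f) z) ∧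
    (∃ μ₀ : ℝ, 0 < μ₀ ∧ ∀ μ : ℝ, μ₀ ≤ μ →
      PeriodicHardy.IsMSectorial (PeriodicHardy.shift (PeriodicHardy.diffOp hreg) μ)) ∧
    ∃ S : ℝ → PeriodicHardy.HardySpace T K →L[ℂ] PeriodicHardy.HardySpace T K,
      PeriodicHardy.IsHolomorphicSemigroup S ∧
      PeriodicHardy.IsGenerator (-PeriodicHardy.diffOp hreg) S := by
  obtain ⟨M₂, N₂, M₁, M₀, h⟩ := hreg.exists_isSymbol hT hC₀ hpos
  have := PeriodicHardy.completeSpace_hardySpace (K := K) hT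
  exact ⟨PeriodicHardy.IsSymbol.mem_domain_iff_deriv_deriv hreg h,
    ⟨C₀ / 2 + ‖M₀‖ + ‖M₁‖ ^ 2 / (2 * C₀), by positivity,
      fun μ hμ => PeriodicHardy.IsSymbol.isMSectorial_shift hreg h hμ⟩,
    PeriodicHardy.exists_isHolomorphicSemigroup_of_shift
      (PeriodicHardy.IsSymbol.isMSectorial_shift hreg h le_rfl)⟩
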